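/- **Conventions.** An $(a,b)$-module is a free $\mathbb{C}[[b]]$-module $E$ of finite rank with a $\mathbb{C}$-linear operator $a$ such that $ab-ba=b^2$. Let $\tilde{\mathcal A}$ be the algebra of the series $\sum_{\nu\ge 0}P_\nu(a)b^\nu$, $P_\nu$ polynomials, with $ab-ba=b^2$. For $\mu\in\mathbb{Q}$, $\mu>0$, let $\Xi_\mu^{(N)}=\bigoplus_{j=0}^{N}\mathbb{C}[[b]]\,e_j$ (where $e_j=s^{\mu-1}(\mathrm{Log}\,s)^j/j!$), with $a e_0=\mu b e_0$ and $a e_j=\mu b e_j+b e_{j-1}$ for $1\le j\le N$. A $[\lambda]$-primitive theme is an $(a,b)$-module isomorphic to $\tilde{\mathcal A}\varphi\subset\Xi_\mu^{(N)}$ for some $N\ge 0$, some $\mu>0$ in $\lambda+\mathbb{Z}$ and some $\varphi$ ($\lambda\in\mathbb{Q}$). A theme $E$ of rank $k$ has for each $j\in[0,k]$ a unique normal (that is, $bx\in F_j\Rightarrow x\in F_j$) sub-$(a,b)$-module $F_j$ of rank $j$. Its exponents $\lambda_1,\dots,\lambda_k$ are given by $F_j/F_{j-1}\simeq E_{\lambda_j}$,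 where $E_\mu=\mathbb{C}[[b]]e_\mu$, $ae_\mu=\mu be_\mu$. Its fundamental invariants are $\lambda_1$ and the integers $p_j\ge 0$ with $\lambda_{j+1}=\lambda_j+p_j-1$. For $1\le j<k$ with $p_j\ge1$, its $j$-th principal parameter is the unique $\alpha_j\in\mathbb{C}^*$ such that $$F_{j+1}/F_{j-1}\simeq\tilde{\mathcal A}\big/\tilde{\mathcal A}\,(a-\lambda_j b)(1+\alpha_j b^{p_j})^{-1}(a-\lambda_{j+1}b);$$ if $p_j=0$ the $j$-th principal parameter is empty by convention. For $\theta\in\mathbb{C}[[a]]$ with $\theta(0)=0$, $\theta'(0)\neq0$, the $(a,b)$-module $\theta_*(E)$ is the space $E$ on which $a$ acts as $\theta(a)$ and $b$ acts as $b\,\theta'(a)$. Let $X$ be a reduced complex space. A holomorphic map $\varphi:U\to\Xi_\mu^{(N)}$ on an open $U\subset X$ is $k$-thematic if the $\mathcal{O}_U[[b]]$-module $\mathbb{E}_\varphi$ generated by $\varphi,a\varphi,a^2\varphi,\dots$ is free with basis $\varphi,a\varphi,\dots,a^{k-1}\varphi$, and these form at each $x\in U$ a $\mathbb{C}[[b]]$-basis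 of $\tilde{\mathcal A}\varphi(x)$. A holomorphic family $\mathbb{E}=(E(x))_{x\in X}$ of $[\lambda]$-primitive themes of rank $k$ is a family of $(a,b)$-modules with a sheaf of holomorphic sections that is locally on $X$ isomorphic to $(\tilde{\mathcal A}\varphi(x))_x$ with the sheaf $\mathbb{E}_\varphi$, for a $k$-thematic $\varphi$ with values in some $\Xi_\mu^{(N)}$, $\mu>0$, $\mu\in\lambda+\mathbb{Z}$. A relative change of variable is a $\theta\in\mathcal{O}(X)[[a]]$ with $\theta(0)=0$ and $\theta'(0)(x)\ne0$ for all $x\in X$; $\theta_*(\mathbb{E})$ is the family of the $(\theta_x)_*(E(x))$, with the same sheaf of holomorphic sections. **Statement.** Let $X$ be a connected reduced complex space, $\mathbb{E}$ a holomorphic family of $[\lambda]$-primitive themes of rank $k$ parametrized by $X$, and $\theta$ a relative change of variable; put $r:=\theta'(0)\in\mathcal{O}(X)$. Then the fundamental invariants $(\lambda_1,p_1,\dots,p_{k-1})$ of $E(x)$ do not depend on $x\in X$, and the principal parameters of the $E(x)$ define holomorphic functions $\alpha_j$ on $X$ (for $1\le j<k$ with $p_j\geq 1$). Moreover $\theta_*(\mathbb{E})$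 is a holomorphic family of $[\lambda]$-primitive themes of rank $k$, it has the same fundamental invariants $(\lambda_1,p_1,\dots,p_{k-1})$, and its principal parameters define the holomorphic functions $r^{-p_j}\alpha_j$ on $X$ (for $1\le j<k$ with $p_j\geq1$). -/

import Mathlib

open Filter Topology
open scoped PowerSeries

noncomputable section

/-! ### Reduced complex spaces -/

/-- `A` is a (closed) analytic subset of `D`: near each point of `D` it is the common zero set of
finitely many holomorphic functions. -/
def IsAnalyticSubset {n : ℕ} (D A : Set (Fin n → ℂ)) : Prop :=
  A ⊆ D ∧ ∀ w ∈ D, ∃ W ∈ 𝓝 w, ∃ (m : ℕ) (g : Fin m → (Fin n → ℂ) → ℂ),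
    (∀ i, AnalyticOnNhd ℂ (g i) W) ∧ A ∩ W = {v ∈ W | ∀ i, g i v = 0}

/-- A reduced complex space. The structure sheaf is a sheaf of complex valued functions, given by
the predicate `HolAt f x` ("`f` is holomorphic in a neighbourhood of `x`"); locally the space is
isomorphic to an analytic subset of an open set `D` of some `ℂⁿ`, the holomorphic
functions being those that locally are restrictions of holomorphic functions of `n` variables. -/
class ReducedComplexSpace (X : Type*) [TopologicalSpace X] where
  HolAt : (X → ℂ) → X → Prop
  local_model : ∀ x₀ : X, ∃ (n : ℕ) (U : Set X) (z : X → Fin n → ℂ) (D A : Set (Fin n → ℂ)),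
    IsOpen U ∧ x₀ ∈ U ∧ IsOpen D ∧ IsAnalyticSubset D A ∧
    IsEmbedding (fun x : U => z x) ∧ z '' U = A ∧
    ∀ x ∈ U, ∀ f : X → ℂ,
      HolAt f x ↔ ∃ F : (Fin n → ℂ) → ℂ, AnalyticAt ℂ F (z x) ∧ f =ᶠ[𝓝 x] F ∘ z

section Holomorphic

variable {X : Type*} [TopologicalSpace X] [ReducedComplexSpace X]

/-- Holomorphic functions on the open set `U`. -/
def HolOn (U : Set X) (f : X → ℂ) : Prop := ∀ x ∈ U, ReducedComplexSpace.HolAt f x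

/-- Sections of `𝒪_X[[t]]` over the open set `U`: power series in one variable all of whose
coefficients are holomorphic on `U`. -/
def HolSeriesOn (U : Set X) (S : X → ℂ⟦X⟧) : Prop :=
  ∀ n : ℕ, HolOn U (fun x => PowerSeries.coeff n (S x))

/-- A relative change of variable: `θ ∈ 𝒪(X)[[a]]` with `θ(0) = 0` and `θ'(0)` nowhere zero. -/
def IsRelativeChangeOfVariable (θ : X → ℂ⟦X⟧) : Prop :=
  HolSeriesOn Set.univ θ ∧
    ∀ x, PowerSeries.coeff 0 (θ x) = 0 ∧ PowerSeries.coeff 1 (θ x) ≠ 0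

end Holomorphic

/-! ### Vector spaces with two operators `a` and `b`, and (a,b)-modules -/

/-- The operators `a` and `b` on a complex vector space. For the spaces considered below one has
`a b - b a = b²`, and `ℂ[[b]]` acts by `b`-adic continuity. -/
structure ABStructure (V : Type*) [AddCommGroup V] [Module ℂ V] where
  a : Module.End ℂ V
  b : Module.End ℂ V

namespace ABStructure

variable {V : Type*} [AddCommGroup V] [Module ℂ V] {W : Type*} [AddCommGroup W] [Module ℂ W]

/-- Isomorphism: a `ℂ`-linear bijection commuting with `a` and with `b`. -/
def Iso (A : ABStructure V) (B : ABStructure W) : Prop :=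
  ∃ e : V ≃ₗ[ℂ] W, (∀ v, e (A.a v) = B.a (e v)) ∧ ∀ v, e (A.b v) = B.b (e v)

/-- `V` is free of rank `k` over `ℂ[[b]]`. -/
def IsFreeOfRank (A : ABStructure V) (k : ℕ) : Prop :=
  ∃ e : V ≃ₗ[ℂ] (Fin k → ℂ⟦X⟧), ∀ v, e (A.b v) = (PowerSeries.X : ℂ⟦X⟧) • e v

def IsStable (A : ABStructure V) (F : Submodule ℂ V) : Prop :=
  (∀ v ∈ F, A.a v ∈ F) ∧ ∀ v ∈ F, A.b v ∈ F

/-- The induced structure on a stable subspace. -/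
def restrict (A : ABStructure V) (F : Submodule ℂ V) (hF : A.IsStable F) : ABStructure F where
  a := A.a.restrict hF.1
  b := A.b.restrict hF.2

/-- The induced structure on the quotient by a stable subspace. -/
def quotient (A : ABStructure V) (F : Submodule ℂ V) (hF : A.IsStable F) :
    ABStructure (V ⧸ F) where
  a := F.mapQ F A.a hF.1
  b := F.mapQ F A.b hF.2

theorem IsStable.submoduleOf {A : ABStructure V} {G F : Submodule ℂ V} (hG : A.IsStable G)
    (hF : A.IsStable F) : (A.restrict F hF).IsStable (G.submoduleOf F) :=
  ⟨fun v hv => hG.1 v hv, fun v hv => hG.2 v hv⟩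

/-- The induced structure on `F / G`, for `G ⊆ F` stable. -/
def subquotient (A : ABStructure V) (G F : Submodule ℂ V) (hG : A.IsStable G)
    (hF : A.IsStable F) : ABStructure (F ⧸ G.submoduleOf F) :=
  (A.restrict F hF).quotient (G.submoduleOf F) (hG.submoduleOf hF)

/-- `F` is a normal sub-(a,b)-module of rank `j`: it is stable, free of rank `j` over `ℂ[[b]]`,
and `b v ∈ F` implies `v ∈ F`. -/
structure IsNormalSub (A : ABStructure V) (F : Submodule ℂ V) (j : ℕ) : Prop where
  stable : A.IsStable F
  free : (A.restrict F stable).IsFreeOfRank j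
  normal : ∀ v, A.b v ∈ F → v ∈ F

/-- `F_j / F_i ≃ B`, where `F_i ⊆ F_j` are normal sub-(a,b)-modules of ranks `i` and `j`
(in a `[λ]`-primitive theme the normal sub-(a,b)-module of a given rank is unique). -/
def SubquotientIso (A : ABStructure V) (i j : ℕ) (B : ABStructure W) : Prop :=
  ∃ (G F : Submodule ℂ V) (hG : A.IsNormalSub G i) (hF : A.IsNormalSub F j),
    G ≤ F ∧ (A.subquotient G F hG.stable hF.stable).Iso B

/-! ### Change of variable -/

/-- `y = ∑ₙ Tₙ aⁿ x`, the series being convergent for the `b`-adic topology. -/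
def IsAdicSum (A : ABStructure V) (T : ℂ⟦X⟧) (x y : V) : Prop :=
  ∀ m : ℕ, ∃ M : ℕ, ∀ n ≥ M,
    y - ∑ i ∈ Finset.range n, PowerSeries.coeff i T • (A.a ^ i) x ∈ LinearMap.range (A.b ^ m)

theorem IsAdicSum.add {A : ABStructure V} {T : ℂ⟦X⟧} {x y x' y' : V} (h : A.IsAdicSum T x y)
    (h' : A.IsAdicSum T x' y') : A.IsAdicSum T (x + x') (y + y') := by
  intro m
  obtain ⟨M, hM⟩ := h m
  obtain ⟨M', hM'⟩ := h' m
  refine ⟨max M M', fun n hn => ?_⟩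
  have := Submodule.add_mem _ (hM n (le_trans (le_max_left _ _) hn))
    (hM' n (le_trans (le_max_right _ _) hn))
  convert this using 1
  simp only [map_add, smul_add, Finset.sum_add_distrib]
  abel

theorem IsAdicSum.smul {A : ABStructure V} {T : ℂ⟦X⟧} {x y : V} (c : ℂ) (h : A.IsAdicSum T x y) :
    A.IsAdicSum T (c • x) (c • y) := by
  intro m
  obtain ⟨M, hM⟩ := h m
  refine ⟨M, fun n hn => ?_⟩
  have := Submodule.smul_mem _ c (hM n hn)
  convert this using 1
  simp only [map_smul, smul_sub, Finset.smul_sum, smul_comm c]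

open Classical in
/-- The operator `T(a) = ∑ₙ Tₙ aⁿ`. (The series converges, to a unique limit, on every
regular (a,b)-module; the value `0` is used if this fails.) -/
def evalA (A : ABStructure V) (T : ℂ⟦X⟧) : Module.End ℂ V :=
  if h : ∀ x, ∃! y, A.IsAdicSum T x y then
    { toFun := fun x => (h x).choose
      map_add' := fun x x' => ((h (x + x')).unique (h (x + x')).choose_spec.1
        ((h x).choose_spec.1.add (h x').choose_spec.1))
      map_smul' := fun c x => ((h (c • x)).unique (h (c • x)).choose_spec.1
        ((h x).choose_spec.1.smul c)) }
  else 0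

/-- The change of variable `θ_*(E)`: the same space, on which `a` now acts as `θ(a)`
and `b` as `b θ'(a)`. -/
def changeVar (A : ABStructure V) (θ : ℂ⟦X⟧) : ABStructure V where
  a := A.evalA θ
  b := A.b * A.evalA (PowerSeries.derivative ℂ θ)

end ABStructure

/-! ### The standard (a,b)-modules -/

/-- Multiplication by `b`, and the operator `S ↦ μ b S + b² S'`, on `ℂ[[b]]`. -/
def mulB : Module.End ℂ ℂ⟦X⟧ := LinearMap.mulLeft ℂ PowerSeries.X

def eulerOp (μ : ℂ) : Module.End ℂ ℂ⟦X⟧ :=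
  μ • mulB + mulB * mulB * (PowerSeries.derivative ℂ).toLinearMap

/-- `E_μ = ℂ[[b]] e_μ` with `a e_μ = μ b e_μ`. -/
def rankOne (μ : ℂ) : ABStructure ℂ⟦X⟧ where
  a := eulerOp μ
  b := mulB

/-- The rank two (a,b)-module `Ã / Ã (a - l b) (1 + c b^p)⁻¹ (a - (l + p - 1) b)`.
Its elements are the pairs `(u, v)`, standing for `u e₁ + v e₂`, where `e₂` is the class of `1`
and `e₁ = (1 + c b^p)⁻¹ (a - (l + p - 1) b) e₂`, so that
`a e₁ = l b e₁` and `a e₂ = (l + p - 1) b e₂ + (1 + c b^p) e₁`. -/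
def rankTwo (l : ℂ) (p : ℕ) (c : ℂ) : ABStructure (ℂ⟦X⟧ × ℂ⟦X⟧) where
  a := LinearMap.prod
    (eulerOp l ∘ₗ LinearMap.fst ℂ _ _ +
      LinearMap.mulLeft ℂ (1 + c • (PowerSeries.X : ℂ⟦X⟧) ^ p) ∘ₗ LinearMap.snd ℂ _ _)
    (eulerOp (l + p - 1) ∘ₗ LinearMap.snd ℂ _ _)
  b := LinearMap.prodMap mulB mulB

/-- `Ξ_μ^{(N)}` (of rank `N + 1`): the component `f j` of an element `f` is its coefficient on
`s^(μ-1) (Log s)^j / j!`, and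
`a (s^(μ-1) (Log s)^j / j!) = μ b (s^(μ-1) (Log s)^j / j!) + b (s^(μ-1) (Log s)^(j-1) / (j-1)!)`,
without the last term if `j = 0`. -/
def Xi (μ : ℂ) (N : ℕ) : ABStructure (Fin (N + 1) → ℂ⟦X⟧) where
  a := LinearMap.pi fun j =>
    eulerOp μ ∘ₗ LinearMap.proj j +
      if h : (j : ℕ) + 1 < N + 1 then mulB ∘ₗ LinearMap.proj (⟨(j : ℕ) + 1, h⟩ : Fin (N + 1)) else 0
  b := LinearMap.pi fun j => mulB ∘ₗ LinearMap.proj j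

/-- The sub-(a,b)-module `Ã φ` of `Ξ_μ^{(N)}` generated by `φ`. -/
def generated (μ : ℂ) (N : ℕ) (φ : Fin (N + 1) → ℂ⟦X⟧) : Submodule ℂ⟦X⟧ (Fin (N + 1) → ℂ⟦X⟧) :=
  Submodule.span ℂ⟦X⟧ (Set.range fun ν : ℕ => ((Xi μ N).a ^ ν) φ)

/-! ### Fundamental invariants and principal parameters -/

/-- The exponents `λ_j = λ₁ + ∑_{i < j} (p_i - 1)`, that is `λ_{j+1} = λ_j + p_j - 1`
(`j ≥ 1`). -/
def exponent (l₁ : ℚ) (p : ℕ → ℕ) (j : ℕ) : ℚ :=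
  l₁ + ∑ i ∈ Finset.Ico 1 j, ((p i : ℚ) - 1)

section Invariants

variable {V : Type*} [AddCommGroup V] [Module ℂ V]

/-- `(λ₁, p₁, …, p_{k-1})` are the fundamental invariants of the rank `k` theme: for
`1 ≤ j ≤ k` the quotient `F_j / F_{j-1}` is isomorphic to `E_μ` exactly for `μ = λ_j`. -/
def HasFundamentalInvariants (A : ABStructure V) (k : ℕ) (l₁ : ℚ) (p : ℕ → ℕ) : Prop :=
  ∀ j, 1 ≤ j → j ≤ k → ∀ μ : ℂ,
    A.SubquotientIso (j - 1) j (rankOne μ) ↔ μ = (exponent l₁ p j : ℂ)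

/-- `c` is the `j`-th principal parameter (where `j ≥ 1` and `p_j ≥ 1`) of a theme with
fundamental invariants `(λ₁, p₁, …)`: the parameter of the rank two theme `F_{j+1} / F_{j-1}`,
which has fundamental invariants `(λ_j, p_j)`. -/
def IsPrincipalParameter (A : ABStructure V) (l₁ : ℚ) (p : ℕ → ℕ) (j : ℕ) (c : ℂ) : Prop :=
  c ≠ 0 ∧ A.SubquotientIso (j - 1) (j + 1) (rankTwo (exponent l₁ p j : ℂ) (p j) c)

end Invariants

/-! ### Holomorphic families of themes -/

section Families

variable {X : Type*} [TopologicalSpace X] [ReducedComplexSpace X]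

/-- `φ : U → Ξ_μ^{(N)}` is `k`-thematic: it is holomorphic and the
`𝒪_U[[b]]`-submodule `𝔼_φ` generated by `φ, a φ, a² φ, …` is free with basis
`φ, a φ, …, a^{k-1} φ`, these elements being also at each point `x` of `U`
a `ℂ[[b]]`-basis of `Ã φ(x)`. -/
def IsThematic (U : Set X) (μ : ℂ) (N k : ℕ) (φ : X → Fin (N + 1) → ℂ⟦X⟧) : Prop :=
  (∀ i, HolSeriesOn U (fun x => φ x i)) ∧
  (∀ x ∈ U, LinearIndependent ℂ⟦X⟧ (fun j : Fin k => ((Xi μ N).a ^ (j : ℕ)) (φ x))) ∧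
  ∃ S : Fin k → X → ℂ⟦X⟧, (∀ j, HolSeriesOn U (S j)) ∧
    ∀ x ∈ U, ((Xi μ N).a ^ k) (φ x) = ∑ j : Fin k, S j x • ((Xi μ N).a ^ (j : ℕ)) (φ x)

/-- A holomorphic family, parametrized by `X`, of `[lam]`-primitive themes of rank `k`. It consists
of the (a,b)-modules `E x`, and of the sheaf of holomorphic sections of the family, given by the
predicate `Hol s x` ("`s` is a holomorphic section in a neighbourhood of `x`"). Locally on
`X` it is isomorphic to the family `Ã φ(x)` with its sheaf `𝔼_φ`, for a `k`-thematic map `φ`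
with values in some `Ξ_μ^{(N)}`, where `μ > 0` is congruent to `lam` modulo `ℤ`. -/
def IsHolomorphicThemeFamily (lam : ℚ) (k : ℕ) {E : X → Type*} [∀ x, AddCommGroup (E x)]
    [∀ x, Module ℂ (E x)] (A : ∀ x, ABStructure (E x)) (Hol : (∀ x, E x) → X → Prop) : Prop :=
  ∀ x₀ : X, ∃ (U : Set X) (μ : ℚ) (N : ℕ) (φ : X → Fin (N + 1) → ℂ⟦X⟧)
    (i : ∀ x, E x →ₗ[ℂ] (Fin (N + 1) → ℂ⟦X⟧)),
    IsOpen U ∧ x₀ ∈ U ∧ 0 < μ ∧ (∃ m : ℤ, μ = lam + m) ∧ IsThematic U (μ : ℂ) N k φ ∧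
    (∀ x ∈ U, Function.Injective (i x) ∧ Set.range (i x) = (generated (μ : ℂ) N (φ x) : Set _) ∧
      (∀ v, i x ((A x).a v) = (Xi (μ : ℂ) N).a (i x v)) ∧
      ∀ v, i x ((A x).b v) = (Xi (μ : ℂ) N).b (i x v)) ∧
    ∀ x ∈ U, ∀ s : ∀ x, E x, Hol s x ↔
      ∃ (W : Set X) (S : Fin k → X → ℂ⟦X⟧), IsOpen W ∧ x ∈ W ∧ (∀ j, HolSeriesOn W (S j)) ∧
        ∀ y ∈ W, i y (s y) = ∑ j : Fin k, S j y • ((Xi (μ : ℂ) N).a ^ (j : ℕ)) (φ y)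

/-- For every `j` with `1 ≤ j < k` and `p_j ≥ 1`, the function `α_j` is holomorphic on `X` and its
value at `x` is the unique `j`-th principal parameter of `E x`. (If `p_j = 0`, the `j`-th principal
parameter is empty by convention.) -/
def HasPrincipalParameterFunctions {E : X → Type*} [∀ x, AddCommGroup (E x)]
    [∀ x, Module ℂ (E x)] (A : ∀ x, ABStructure (E x)) (k : ℕ) (l₁ : ℚ) (p : ℕ → ℕ)
    (α : ℕ → X → ℂ) : Prop :=
  ∀ j, 1 ≤ j → j < k → 1 ≤ p j →
    HolOn Set.univ (α j) ∧ ∀ x c, IsPrincipalParameter (A x) l₁ p j c ↔ c = α j x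

end Families

end

/-! ### Calculus of holomorphic functions on a reduced complex space -/

section HolomorphicCalculus

variable {X : Type*} [TopologicalSpace X] [ReducedComplexSpace X]

/-! In `Ξ`, `b` is multiplication by `X`, and `a` sends `X ^ n` in coordinate `j` to `(μ + n) X ^ (n
+ 1)` in coordinate `j` plus `X ^ (n + 1)` in coordinate `j - 1`. Normalize the highest nonzero
coordinate of a generator `φ` to `X ^ n`: then `a - (μ + n) b` kills this coordinate and leaves the
one below nonzero. Iterating gives a triangular basis `ψ 1, …, ψ k` with `(a - (μ + d j) b) ψ (j +
1) = V j • ψ j` and units `V j` (`exists_chain`). It determines every invariant. The normal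
submodules are the spans of `ψ 1, …, ψ j` (`Chain.eq_suppSub`), the exponents are the `μ + d j`, and
so `p (j + 1) = d (j + 1) + 1 - d j`. The logarithmic term forces the coefficient of `X ^ p (j + 1)`
in `V (j + 1)` to be `1`, and the principal parameter is the inverse of the constant coefficient of
`V (j + 1)` (`Chain.subquotientIso_rankTwo`).

In a family, the holomorphic relation expressing `a ^ k φ` yields an indicial polynomial with roots
`μ + d (k - 1 - i) - i` (`Chain.indicial`). Its values at the points `μ + t`, `t` a natural number,
are integers depending continuously on the parameter. Hence the exponents are locally constant, and
the invariants are constant on a connected space. With constant exponents the basis is obtained from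
`φ` by applying `a` and `b`, dividing by fixed powers of `X` and inverting units, so it is
holomorphic, and so are the parameters (`holMap_chain`).

For the change of variable, `Ξ` is isomorphic to `θ_* Ξ`, holomorphically in the parameter. The
image of the highest logarithmic vector solves a linear equation degree by degree
(`exists_isTransportVector`); the logarithmic shift and the operator `b θ'(a)` give the rest. This
isomorphism multiplies leading coefficients in degree `n` by `r ^ n`. If `g` is its inverse, `θ_*`
of the theme of `φ` is the theme of `g φ`. Comparing leading coefficients in the two triangular
bases from the top down (`Chain.inverse_step`) gives the same `d` and `r ^ d j * V'(0) = r ^ (d (j +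
1) + 1) * V(0)` for the units of index `j + 1`. Thus `V'(0) = r ^ p * V(0)`, and the principal
parameter is multiplied by `r ^ (-p)`. -/

theorem exists_local_model (x : X) : ∃ (n : ℕ) (z : X → Fin n → ℂ), ContinuousAt z x ∧
    ∀ f : X → ℂ, ReducedComplexSpace.HolAt f x ↔
      ∃ F : (Fin n → ℂ) → ℂ, AnalyticAt ℂ F (z x) ∧ f =ᶠ[𝓝 x] F ∘ z := by
  obtain ⟨n, U, z, D, A, hU, hx, -, -, hz, -, h⟩ := ReducedComplexSpace.local_model x
  refine ⟨n, z, ?_, h x hx⟩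
  have : ContinuousOn z U := continuousOn_iff_continuous_domRestrict.2 hz.continuous
  exact this.continuousAt (hU.mem_nhds hx)

namespace HolAt

open ReducedComplexSpace

theorem continuousAt {f : X → ℂ} {x : X} (h : HolAt f x) : ContinuousAt f x := by
  obtain ⟨n, z, hz, hf⟩ := exists_local_model x
  obtain ⟨F, hF, e⟩ := (hf f).1 h
  exact (ContinuousAt.comp (f := z) (g := F) hF.continuousAt hz).congr e.symm

theorem congr {f g : X → ℂ} {x : X} (h : HolAt f x) (e : f =ᶠ[𝓝 x] g) : HolAt g x := by
  obtain ⟨n, z, hz, hf⟩ := exists_local_model x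
  obtain ⟨F, hF, e'⟩ := (hf f).1 h
  exact (hf g).2 ⟨F, hF, e.symm.trans e'⟩

theorem const (c : ℂ) (x : X) : HolAt (fun _ : X => c) x := by
  obtain ⟨n, z, hz, hf⟩ := exists_local_model x
  exact (hf _).2 ⟨fun _ => c, analyticAt_const, Eventually.of_forall fun _ => rfl⟩

theorem add {f g : X → ℂ} {x : X} (h : HolAt f x) (h' : HolAt g x) :
    HolAt (fun y => f y + g y) x := by
  obtain ⟨n, z, hz, hf⟩ := exists_local_model x
  obtain ⟨F, hF, e⟩ := (hf f).1 h
  obtain ⟨G, hG, e'⟩ := (hf g).1 h'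
  exact (hf _).2 ⟨_, hF.fun_add hG, e.add e'⟩

theorem mul {f g : X → ℂ} {x : X} (h : HolAt f x) (h' : HolAt g x) :
    HolAt (fun y => f y * g y) x := by
  obtain ⟨n, z, hz, hf⟩ := exists_local_model x
  obtain ⟨F, hF, e⟩ := (hf f).1 h
  obtain ⟨G, hG, e'⟩ := (hf g).1 h'
  exact (hf _).2 ⟨_, hF.fun_mul hG, e.mul e'⟩

theorem inv {f : X → ℂ} {x : X} (h : HolAt f x) (h0 : f x ≠ 0) :
    HolAt (fun y => (f y)⁻¹) x := by
  obtain ⟨n, z, hz, hf⟩ := exists_local_model x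
  obtain ⟨F, hF, e⟩ := (hf f).1 h
  refine (hf _).2 ⟨_, hF.fun_inv ?_, e.inv⟩
  rw [e.eq_of_nhds] at h0
  exact h0

end HolAt

namespace HolOn

variable {U : Set X} {f g : X → ℂ}

theorem mono {W : Set X} (h : HolOn U f) (hW : W ⊆ U) : HolOn W f := fun x hx => h x (hW hx)

theorem congr (h : HolOn U f) (hU : IsOpen U) (e : ∀ x ∈ U, f x = g x) : HolOn U g :=
  fun x hx => HolAt.congr (h x hx) (Filter.eventually_of_mem (hU.mem_nhds hx) e)

theorem const (c : ℂ) : HolOn U fun _ => c := fun x _ => HolAt.const c x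

theorem add (h : HolOn U f) (h' : HolOn U g) : HolOn U fun x => f x + g x :=
  fun x hx => HolAt.add (h x hx) (h' x hx)

theorem mul (h : HolOn U f) (h' : HolOn U g) : HolOn U fun x => f x * g x :=
  fun x hx => HolAt.mul (h x hx) (h' x hx)

theorem neg (h : HolOn U f) : HolOn U fun x => - f x := by
  simpa using (HolOn.const (U := U) (-1)).mul h

theorem sub (h : HolOn U f) (h' : HolOn U g) : HolOn U fun x => f x - g x := by
  simpa [sub_eq_add_neg] using h.add h'.neg

theorem inv (h : HolOn U f) (h0 : ∀ x ∈ U, f x ≠ 0) : HolOn U fun x => (f x)⁻¹ :=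
  fun x hx => HolAt.inv (h x hx) (h0 x hx)

theorem pow (h : HolOn U f) (n : ℕ) : HolOn U fun x => f x ^ n := by
  induction n with
  | zero => simpa using HolOn.const (U := U) 1
  | succ n ih => simpa [pow_succ] using ih.mul h

theorem sum {ι : Type*} {s : Finset ι} {F : ι → X → ℂ} (h : ∀ i ∈ s, HolOn U (F i)) :
    HolOn U fun x => ∑ i ∈ s, F i x := by
  classical
  induction s using Finset.induction_on with
  | empty => simpa using HolOn.const (U := U) 0
  | insert a s ha ih =>
    simp only [Finset.sum_insert ha]
    exact (h a (by simp)).add (ih fun i hi => h i (by simp [hi]))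

end HolOn

namespace HolSeriesOn

variable {U : Set X} {S T : X → ℂ⟦X⟧}

theorem mono {W : Set X} (h : HolSeriesOn U S) (hW : W ⊆ U) : HolSeriesOn W S :=
  fun n => (h n).mono hW

theorem congr (h : HolSeriesOn U S) (hU : IsOpen U) (e : ∀ x ∈ U, S x = T x) :
    HolSeriesOn U T := fun n => (h n).congr hU fun x hx => by rw [e x hx]

theorem const (P : ℂ⟦X⟧) : HolSeriesOn U fun _ => P := fun _ => HolOn.const _

theorem add (h : HolSeriesOn U S) (h' : HolSeriesOn U T) : HolSeriesOn U fun x => S x + T x :=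
  fun n => by simpa using (h n).add (h' n)

theorem sub (h : HolSeriesOn U S) (h' : HolSeriesOn U T) : HolSeriesOn U fun x => S x - T x :=
  fun n => by simpa using (h n).sub (h' n)

theorem mul (h : HolSeriesOn U S) (h' : HolSeriesOn U T) : HolSeriesOn U fun x => S x * T x :=
  fun n => by
    simp only [PowerSeries.coeff_mul]
    exact HolOn.sum fun i _ => (h _).mul (h' _)

theorem smul {c : X → ℂ} (hc : HolOn U c) (h : HolSeriesOn U S) :
    HolSeriesOn U fun x => c x • S x :=
  fun n => by simpa using hc.mul (h n)

theorem sum {ι : Type*} {s : Finset ι} {F : ι → X → ℂ⟦X⟧} (h : ∀ i ∈ s, HolSeriesOn U (F i)) :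
    HolSeriesOn U fun x => ∑ i ∈ s, F i x :=
  fun n => by
    simp only [map_sum]
    exact HolOn.sum fun i hi => h i hi n

theorem derivative (h : HolSeriesOn U S) :
    HolSeriesOn U fun x => PowerSeries.derivative ℂ (S x) := fun n => by
  simp only [PowerSeries.coeff_derivative]
  exact (h _).mul (HolOn.const _)

/-- The recursion for the coefficients of an inverse divides only by the constant coefficient. -/
theorem inv (h : HolSeriesOn U S) (h0 : ∀ x ∈ U, PowerSeries.coeff 0 (S x) ≠ 0) :
    HolSeriesOn U fun x => (S x)⁻¹ := by
  intro n
  have hi : HolOn U fun x => (PowerSeries.constantCoeff (S x))⁻¹ := by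
    simpa using (h 0).inv h0
  induction n using Nat.strong_induction_on with
  | _ n ih =>
    have e : (fun x => PowerSeries.coeff n (S x)⁻¹) = fun x => if n = 0 then
        (PowerSeries.constantCoeff (S x))⁻¹ else - (PowerSeries.constantCoeff (S x))⁻¹ *
        ∑ i ∈ Finset.HasAntidiagonal.antidiagonal n, if i.2 < n then
          PowerSeries.coeff i.1 (S x) * PowerSeries.coeff i.2 (S x)⁻¹ else 0 := by
      funext x
      rw [PowerSeries.coeff_inv]
    rw [e]
    split_ifs with hn
    · exact hi
    · refine hi.neg.mul (HolOn.sum fun i _ => ?_)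
      split_ifs with h2
      · exact (h _).mul (ih _ h2)
      · exact HolOn.const _

theorem divXPow (h : HolSeriesOn U S) (d : ℕ) :
    HolSeriesOn U fun x => PowerSeries.mk fun n => PowerSeries.coeff (n + d) (S x) := fun n => by
  simpa using h (n + d)

end HolSeriesOn

end HolomorphicCalculus

/-! ### The modules `Ξ_μ^{(N)}` -/

/-- The space underlying `Ξ_μ^{(N)}`. -/
abbrev XiSpace (N : ℕ) := Fin (N + 1) → ℂ⟦X⟧

/-- The `l`-th coordinate of an element of `Ξ_μ^{(N)}`, being `0` for `l > N`. -/
def cf {N : ℕ} (f : XiSpace N) (l : ℕ) : ℂ⟦X⟧ := if h : l < N + 1 then f ⟨l, h⟩ else 0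

section Coordinates

variable {N : ℕ}

theorem cf_fin (f : XiSpace N) (j : Fin (N + 1)) : cf f j = f j := dif_pos j.2

theorem cf_ext {f g : XiSpace N} (h : ∀ l, cf f l = cf g l) : f = g := by
  funext j
  rw [← cf_fin f, ← cf_fin g, h]

@[simp] theorem cf_zero (l : ℕ) : cf (0 : XiSpace N) l = 0 := by simp [cf]

@[simp] theorem cf_add (f g : XiSpace N) (l : ℕ) : cf (f + g) l = cf f l + cf g l := by
  unfold cf; split_ifs <;> simp

@[simp] theorem cf_sub (f g : XiSpace N) (l : ℕ) : cf (f - g) l = cf f l - cf g l := by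
  unfold cf; split_ifs <;> simp

@[simp] theorem cf_smul (P : ℂ⟦X⟧) (f : XiSpace N) (l : ℕ) : cf (P • f) l = P * cf f l := by
  unfold cf; split_ifs <;> simp

@[simp] theorem cf_smul_complex (c : ℂ) (f : XiSpace N) (l : ℕ) : cf (c • f) l = c • cf f l := by
  unfold cf; split_ifs <;> simp

@[simp] theorem cf_sum {ι : Type*} (s : Finset ι) (f : ι → XiSpace N) (l : ℕ) :
    cf (∑ i ∈ s, f i) l = ∑ i ∈ s, cf (f i) l := by
  unfold cf; split_ifs <;> simp

theorem cf_of_lt (f : XiSpace N) {l : ℕ} (h : N < l) : cf f l = 0 := by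
  unfold cf; rw [dif_neg (by omega)]

theorem eulerOp_apply (μ : ℂ) (P : ℂ⟦X⟧) : eulerOp μ P =
    μ • (PowerSeries.X * P) + PowerSeries.X ^ 2 * PowerSeries.derivative ℂ P := by
  simp [eulerOp, mulB, pow_two, mul_assoc]

theorem coeff_succ_eulerOp (μ : ℂ) (P : ℂ⟦X⟧) (n : ℕ) :
    PowerSeries.coeff (n + 1) (eulerOp μ P) = (μ + n) * PowerSeries.coeff n P := by
  rw [eulerOp_apply]
  cases n with
  | zero => simp [PowerSeries.coeff_succ_X_mul, pow_two, mul_assoc]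
  | succ n =>
    rw [pow_two, mul_assoc]
    simp [PowerSeries.coeff_succ_X_mul, PowerSeries.coeff_derivative]
    ring

theorem coeff_zero_eulerOp (μ : ℂ) (P : ℂ⟦X⟧) : PowerSeries.coeff 0 (eulerOp μ P) = 0 := by
  simp [eulerOp_apply, pow_two, mul_assoc]

theorem eulerOp_mul (μ : ℂ) (P Q : ℂ⟦X⟧) : eulerOp μ (P * Q) =
    P * eulerOp μ Q + PowerSeries.X ^ 2 * PowerSeries.derivative ℂ P * Q := by
  simp only [eulerOp_apply, Derivation.leibniz, smul_eq_mul, PowerSeries.smul_eq_C_mul]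
  ring

/-- Subtracting `ν b`. -/
theorem eulerOp_sub (μ ν : ℂ) (P : ℂ⟦X⟧) :
    eulerOp μ P - ν • (PowerSeries.X * P) = eulerOp (μ - ν) P := by
  simp only [eulerOp_apply, sub_smul]
  ring

/-- `eulerOp ν` sends `X ^ m` to `(ν + m) X ^ (m + 1)`, so `X ^ n` is the only monomial killed when
`ν = -n`. -/
theorem eulerOp_neg_eq_zero {n : ℕ} {P : ℂ⟦X⟧} (h : eulerOp (-n : ℂ) P = 0) :
    P = PowerSeries.C (PowerSeries.coeff n P) * PowerSeries.X ^ n := by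
  ext m
  have := coeff_succ_eulerOp (-n : ℂ) P m
  rw [h, map_zero, eq_comm, mul_eq_zero] at this
  rw [PowerSeries.coeff_C_mul_X_pow]
  split_ifs with hm
  · rw [hm]
  · refine this.resolve_left fun h => hm ?_
    have : (m : ℂ) = n := by linear_combination h
    exact_mod_cast this

theorem eulerOp_X_pow (μ : ℂ) (n : ℕ) :
    eulerOp μ (PowerSeries.X ^ n) = (μ + n) • PowerSeries.X ^ (n + 1) := by
  ext m
  cases m with
  | zero => simp [coeff_zero_eulerOp]
  | succ m =>
    simp only [coeff_succ_eulerOp, PowerSeries.coeff_X_pow, map_smul, smul_eq_mul,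
      add_left_inj]
    split_ifs with h
    · rw [h]
    · simp

variable (μ : ℂ)

theorem cf_a (f : XiSpace N) (l : ℕ) :
    cf ((Xi μ N).a f) l = eulerOp μ (cf f l) + PowerSeries.X * cf f (l + 1) := by
  by_cases h : l < N + 1
  · by_cases h' : l + 1 < N + 1
    · have h2 : l < N := by omega
      simp [cf, Xi, h, mulB, h2]
    · have : ¬ l < N := by omega
      simp [cf, Xi, h, this]
  · rw [cf_of_lt _ (by omega), cf_of_lt f (by omega : N < l), cf_of_lt f (by omega : N < l + 1)]
    simp

@[simp] theorem Xi_b (f : XiSpace N) : (Xi μ N).b f = (PowerSeries.X : ℂ⟦X⟧) • f := by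
  funext j; simp [Xi, mulB]

theorem a_smul (P : ℂ⟦X⟧) (f : XiSpace N) : (Xi μ N).a (P • f) =
    P • (Xi μ N).a f + (PowerSeries.X ^ 2 * PowerSeries.derivative ℂ P) • f := by
  refine cf_ext fun l => ?_
  simp only [cf_a, cf_smul, cf_add, eulerOp_mul]
  ring

/-- The nilpotent operator `s^(μ-1) (Log s)^j / j! ↦ s^(μ-1) (Log s)^(j-1) / (j-1)!`. -/
def logShift (N : ℕ) : XiSpace N →ₗ[ℂ⟦X⟧] XiSpace N where
  toFun f j := cf f (j + 1)
  map_add' f g := by funext j; simp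
  map_smul' P f := by funext j; simp

@[simp] theorem cf_logShift (f : XiSpace N) (l : ℕ) : cf (logShift N f) l = cf f (l + 1) := by
  by_cases h : l < N + 1
  · conv_lhs => rw [cf]
    rw [dif_pos h]; rfl
  · rw [cf_of_lt _ (by omega), cf_of_lt _ (by omega)]

/-- Together with `ℂ⟦X⟧`-linearity this makes the shift an endomorphism of `Ξ`, which is why one
vector later suffices to transport the whole module. -/
theorem a_logShift (f : XiSpace N) :
    (Xi μ N).a (logShift N f) = logShift N ((Xi μ N).a f) := by
  refine cf_ext fun l => ?_
  simp [cf_a]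

/-- `f` involves only the first `j` basis vectors. -/
def Supp (j : ℕ) (f : XiSpace N) : Prop := ∀ l, j ≤ l → cf f l = 0

theorem Supp.add {j : ℕ} {f g : XiSpace N} (hf : Supp j f) (hg : Supp j g) : Supp j (f + g) :=
  fun l hl => by simp [hf l hl, hg l hl]

theorem Supp.sub {j : ℕ} {f g : XiSpace N} (hf : Supp j f) (hg : Supp j g) : Supp j (f - g) :=
  fun l hl => by simp [hf l hl, hg l hl]

theorem Supp.smul {j : ℕ} {f : XiSpace N} (P : ℂ⟦X⟧) (hf : Supp j f) : Supp j (P • f) :=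
  fun l hl => by simp [hf l hl]

theorem Supp.smul_complex {j : ℕ} {f : XiSpace N} (c : ℂ) (hf : Supp j f) : Supp j (c • f) :=
  fun l hl => by simp [hf l hl]

theorem Supp.sum {ι : Type*} {s : Finset ι} {j : ℕ} {f : ι → XiSpace N}
    (hf : ∀ i ∈ s, Supp j (f i)) : Supp j (∑ i ∈ s, f i) :=
  fun l hl => by rw [cf_sum]; exact Finset.sum_eq_zero fun i hi => hf i hi l hl

theorem Supp.mono {i j : ℕ} {f : XiSpace N} (hf : Supp i f) (h : i ≤ j) : Supp j f :=
  fun l hl => hf l (h.trans hl)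

theorem Supp.a {μ : ℂ} {j : ℕ} {f : XiSpace N} (hf : Supp j f) : Supp j ((Xi μ N).a f) :=
  fun l hl => by simp [cf_a, hf l hl, hf (l + 1) (by omega)]

theorem supp_zero_iff {f : XiSpace N} : Supp 0 f ↔ f = 0 :=
  ⟨fun h => cf_ext fun l => by simp [h l], fun h => by simp [h, Supp]⟩

theorem supp_last (f : XiSpace N) : Supp (N + 1) f := fun _ hl => cf_of_lt f (by omega)

theorem Supp.pred {j : ℕ} {f : XiSpace N} (hf : Supp (j + 1) f) (h : cf f j = 0) : Supp j f :=
  fun l hl => by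
    rcases hl.eq_or_lt with rfl | hl
    · exact h
    · exact hf l hl

end Coordinates

/-! ### Holomorphic maps with values in `Ξ` -/

section HolomorphicMaps

variable {X : Type*} [TopologicalSpace X] [ReducedComplexSpace X] {N : ℕ}

/-- Holomorphic maps to `Ξ_μ^{(N)}`. -/
def HolMap (U : Set X) (f : X → XiSpace N) : Prop := ∀ l, HolSeriesOn U fun x => cf (f x) l

theorem holMap_iff {U : Set X} {f : X → XiSpace N} :
    HolMap U f ↔ ∀ i, HolSeriesOn U fun x => f x i := by
  refine ⟨fun h i => by simpa [cf_fin] using h i, fun h l => ?_⟩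
  unfold cf
  split_ifs with hl
  · exact h _
  · exact HolSeriesOn.const 0

namespace HolMap

variable {U : Set X} {f g : X → XiSpace N}

theorem mono {W : Set X} (h : HolMap U f) (hW : W ⊆ U) : HolMap W f := fun l => (h l).mono hW

theorem congr (h : HolMap U f) (hU : IsOpen U) (e : ∀ x ∈ U, f x = g x) : HolMap U g :=
  fun l => (h l).congr hU fun x hx => by rw [e x hx]

theorem const (v : XiSpace N) : HolMap U fun _ => v := fun _ => HolSeriesOn.const _

theorem add (h : HolMap U f) (h' : HolMap U g) : HolMap U fun x => f x + g x :=
  fun l => by simpa using (h l).add (h' l)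

theorem sub (h : HolMap U f) (h' : HolMap U g) : HolMap U fun x => f x - g x :=
  fun l => by simpa using (h l).sub (h' l)

theorem smul {S : X → ℂ⟦X⟧} (hS : HolSeriesOn U S) (h : HolMap U f) :
    HolMap U fun x => S x • f x :=
  fun l => by simpa using hS.mul (h l)

theorem smul_complex {c : X → ℂ} (hc : HolOn U c) (h : HolMap U f) :
    HolMap U fun x => c x • f x :=
  fun l => by simpa using HolSeriesOn.smul hc (h l)

theorem sum {ι : Type*} {s : Finset ι} {F : ι → X → XiSpace N} (h : ∀ i ∈ s, HolMap U (F i)) :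
    HolMap U fun x => ∑ i ∈ s, F i x :=
  fun l => by
    simp only [cf_sum]
    exact HolSeriesOn.sum fun i hi => h i hi l

theorem a (μ : ℂ) (h : HolMap U f) : HolMap U fun x => (Xi μ N).a (f x) := fun l => by
  simp only [cf_a, eulerOp_apply]
  exact ((HolSeriesOn.smul (HolOn.const _) ((HolSeriesOn.const _).mul (h l))).add
    ((HolSeriesOn.const _).mul (h l).derivative)).add ((HolSeriesOn.const _).mul (h (l + 1)))

theorem pow_a (μ : ℂ) (h : HolMap U f) (n : ℕ) : HolMap U fun x => ((Xi μ N).a ^ n) (f x) := by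
  induction n with
  | zero => simpa using h
  | succ n ih => simpa [pow_succ'] using ih.a μ

end HolMap

end HolomorphicMaps

/-! ### Triangular bases of themes -/

/-- A triangular basis `ψ 1, …, ψ k` of the theme generated by `φ` in `Ξ_μ^{(N)}`. The exponents of
the theme are `μ + d 0, …, μ + d (k - 1)`, and the `V j` are the units of the factorization
`(a - λ₁ b) V₁⁻¹ ⋯ (a - λₖ b) Vₖ⁻¹` of the annihilator of `φ`. -/
structure Chain (μ : ℂ) {N : ℕ} (k : ℕ) (φ : XiSpace N) (d : ℕ → ℕ) (ψ : ℕ → XiSpace N)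
    (V : ℕ → ℂ⟦X⟧) : Prop where
  le : k ≤ N + 1
  supp : ∀ j ≤ k, Supp j (ψ j)
  top : ∀ j < k, cf (ψ (j + 1)) j = PowerSeries.X ^ d j
  unit : ∀ j ≤ k, PowerSeries.coeff 0 (V j) ≠ 0
  gen : φ = V k • ψ k
  step : ∀ j < k, (Xi μ N).a (ψ (j + 1)) - (μ + d j) • ((PowerSeries.X : ℂ⟦X⟧) • ψ (j + 1)) =
    V j • ψ j

section TriangularBasis

variable {μ : ℂ} {N : ℕ}

theorem cf_a_sub (ν : ℂ) (f : XiSpace N) (l : ℕ) :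
    cf ((Xi μ N).a f - ν • ((PowerSeries.X : ℂ⟦X⟧) • f)) l =
      eulerOp (μ - ν) (cf f l) + PowerSeries.X * cf f (l + 1) := by
  rw [cf_sub, cf_a, cf_smul_complex, cf_smul, ← eulerOp_sub]
  ring

theorem exists_eq_unit_mul_X_pow {P : ℂ⟦X⟧} (h : P ≠ 0) :
    ∃ (n : ℕ) (u : ℂ⟦X⟧), PowerSeries.coeff 0 u ≠ 0 ∧ P = u * PowerSeries.X ^ n := by
  refine ⟨P.order.toNat, P.divXPowOrder, ?_, ?_⟩
  · rw [PowerSeries.coeff_divXPowOrder, zero_add]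
    exact PowerSeries.coeff_order h
  · rw [mul_comm, PowerSeries.X_pow_order_mul_divXPowOrder]

/-- Dividing by the unit of the top coordinate makes that coordinate `X ^ n`. Then `a - (μ + n) b`
lowers the support by exactly one, and the induction applies to the result. -/
theorem exists_chain (k : ℕ) (φ : XiSpace N) (hs : Supp k φ)
    (h0 : ∀ j, k = j + 1 → cf φ j ≠ 0) : ∃ d ψ V, Chain μ k φ d ψ V := by
  induction k generalizing φ with
  | zero =>
    rw [supp_zero_iff] at hs
    exact ⟨fun _ => 0, fun _ => 0, fun _ => 1, by omega, fun j hj => by simp [Supp],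
      fun j hj => by omega, by simp, by simp [hs], fun j hj => by omega⟩
  | succ k ih =>
    obtain ⟨n, u, hu, e⟩ := exists_eq_unit_mul_X_pow (h0 k rfl)
    have huu : u⁻¹ * u = 1 := PowerSeries.inv_mul_cancel u (by simpa using hu)
    set χ : XiSpace N := u⁻¹ • φ with hχ
    have hφ : φ = u • χ := by rw [hχ, smul_smul, mul_comm, huu, one_smul]
    have hχs : Supp (k + 1) χ := hs.smul _
    have hχk : cf χ k = PowerSeries.X ^ n := by rw [hχ, cf_smul, e, ← mul_assoc, huu, one_mul]
    set z := (Xi μ N).a χ - (μ + n) • ((PowerSeries.X : ℂ⟦X⟧) • χ) with hz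
    have hzs : Supp k z := by
      refine Supp.pred (hχs.a.sub ((hχs.smul _).smul_complex _)) ?_
      rw [hz, cf_a_sub, hχk, hχs _ le_rfl, eulerOp_X_pow]
      simp
    -- `eulerOp (-n)` never produces `X ^ (n + 1)`, so the coefficient `1` contributed by the
    -- logarithmic term survives.
    have hz0 : ∀ j, k = j + 1 → cf z j ≠ 0 := by
      rintro j rfl h
      have := congrArg (PowerSeries.coeff (n + 1)) h
      rw [hz, cf_a_sub, hχk, ← pow_succ', map_add, coeff_succ_eulerOp, PowerSeries.coeff_X_pow]
        at this
      simp at this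
    obtain ⟨d, ψ, V, C⟩ := ih z hzs hz0
    have hkN : k + 1 ≤ N + 1 := by
      by_contra h
      exact h0 k rfl (cf_of_lt _ (by omega))
    refine ⟨fun j => if j = k then n else d j, fun j => if j = k + 1 then χ else ψ j,
      fun j => if j = k + 1 then u else V j, hkN, ?_, ?_, ?_, by simpa using hφ, ?_⟩
    · intro j hj
      split_ifs with h
      · exact h ▸ hχs
      · exact C.supp j (by omega)
    · intro j hj
      simp only [add_left_inj]
      split_ifs with h
      · exact h ▸ hχk
      · exact C.top j (by omega)
    · intro j hj
      split_ifs with h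
      · exact hu
      · exact C.unit j (by omega)
    · intro j hj
      simp only [add_left_inj, if_neg (show j ≠ k + 1 by omega)]
      split_ifs with h
      · rw [h, ← C.gen]
      · exact C.step j (by omega)

theorem a_mem_generated {φ f : XiSpace N} (hf : f ∈ generated μ N φ) :
    (Xi μ N).a f ∈ generated μ N φ := by
  induction hf using Submodule.span_induction with
  | mem x hx =>
    obtain ⟨n, rfl⟩ := hx
    exact Submodule.subset_span ⟨n + 1, by simp [pow_succ']⟩
  | zero => simp
  | add x y _ _ hx hy => rw [map_add]; exact add_mem hx hy
  | smul P x h hx =>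
    rw [a_smul]
    exact add_mem (Submodule.smul_mem _ _ hx) (Submodule.smul_mem _ _ h)

theorem self_mem_generated (φ : XiSpace N) : φ ∈ generated μ N φ :=
  Submodule.subset_span ⟨0, by simp⟩

theorem generated_le {φ : XiSpace N} {L : Submodule ℂ⟦X⟧ (XiSpace N)} (h : φ ∈ L)
    (ha : ∀ f ∈ L, (Xi μ N).a f ∈ L) : generated μ N φ ≤ L := by
  refine Submodule.span_le.2 ?_
  rintro _ ⟨n, rfl⟩
  induction n with
  | zero => simpa using h
  | succ n ih => simpa [pow_succ'] using ha _ ih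

/-- The submodule generated by `ψ 0, …, ψ j`. -/
noncomputable def flag (ψ : ℕ → XiSpace N) (j : ℕ) : Submodule ℂ⟦X⟧ (XiSpace N) :=
  Submodule.span ℂ⟦X⟧ (ψ '' Set.Iic j)

theorem mem_flag (ψ : ℕ → XiSpace N) {i j : ℕ} (h : i ≤ j) : ψ i ∈ flag ψ j :=
  Submodule.subset_span ⟨i, h, rfl⟩

theorem flag_mono (ψ : ℕ → XiSpace N) {i j : ℕ} (h : i ≤ j) : flag ψ i ≤ flag ψ j :=
  Submodule.span_mono (Set.image_mono (Set.Iic_subset_Iic.2 h))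

theorem mem_flag_succ {ψ : ℕ → XiSpace N} {j : ℕ} {f : XiSpace N} :
    f ∈ flag ψ (j + 1) ↔ ∃ (P : ℂ⟦X⟧), ∃ g ∈ flag ψ j, f = P • ψ (j + 1) + g := by
  have : ψ '' Set.Iic (j + 1) = insert (ψ (j + 1)) (ψ '' Set.Iic j) := by
    rw [← Set.image_insert_eq]
    congr 1
    ext i
    simp only [Set.mem_Iic, Set.mem_insert_iff]
    omega
  rw [flag, this, Submodule.mem_span_insert]
  rfl

namespace Chain

variable {k : ℕ} {φ : XiSpace N} {d : ℕ → ℕ} {ψ : ℕ → XiSpace N} {V : ℕ → ℂ⟦X⟧}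

theorem psi_zero (C : Chain μ k φ d ψ V) : ψ 0 = 0 := supp_zero_iff.1 (C.supp 0 (by omega))

theorem a_psi (C : Chain μ k φ d ψ V) {j : ℕ} (hj : j < k) : (Xi μ N).a (ψ (j + 1)) =
    (μ + d j) • ((PowerSeries.X : ℂ⟦X⟧) • ψ (j + 1)) + V j • ψ j := by
  rw [← C.step j hj]; abel

theorem a_smul_psi (C : Chain μ k φ d ψ V) {j : ℕ} (hj : j < k) (P : ℂ⟦X⟧) :
    (Xi μ N).a (P • ψ (j + 1)) = eulerOp (μ + d j) P • ψ (j + 1) + (P * V j) • ψ j := by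
  rw [a_smul, C.a_psi hj, eulerOp_apply]
  generalize μ + (d j : ℂ) = ν
  refine cf_ext fun l => ?_
  simp only [cf_add, cf_smul, cf_smul_complex, PowerSeries.smul_eq_C_mul]
  ring

theorem supp_of_mem_flag (C : Chain μ k φ d ψ V) {j : ℕ} (hj : j ≤ k) {f : XiSpace N}
    (hf : f ∈ flag ψ j) : Supp j f := by
  induction hf using Submodule.span_induction with
  | mem x hx =>
    obtain ⟨i, hi, rfl⟩ := hx
    have hi : i ≤ j := hi
    exact (C.supp i (hi.trans hj)).mono hi
  | zero => simp [Supp]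
  | add x y _ _ hx hy => exact hx.add hy
  | smul P x _ hx => exact hx.smul P

theorem cf_of_mem_flag_succ (C : Chain μ k φ d ψ V) {j : ℕ} (hj : j < k) {P : ℂ⟦X⟧}
    {g : XiSpace N} (hg : g ∈ flag ψ j) :
    cf (P • ψ (j + 1) + g) j = P * PowerSeries.X ^ d j := by
  rw [cf_add, cf_smul, C.top j hj, C.supp_of_mem_flag hj.le hg j le_rfl, add_zero]

theorem X_pow_dvd (C : Chain μ k φ d ψ V) {j : ℕ} (hj : j < k) {f : XiSpace N}
    (hf : f ∈ flag ψ (j + 1)) : PowerSeries.X ^ d j ∣ cf f j := by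
  obtain ⟨P, g, hg, rfl⟩ := mem_flag_succ.1 hf
  rw [C.cf_of_mem_flag_succ hj hg]
  exact dvd_mul_left _ _

theorem mem_flag_of_succ (C : Chain μ k φ d ψ V) {j : ℕ} (hj : j < k) {f : XiSpace N}
    (hf : f ∈ flag ψ (j + 1)) (h : cf f j = 0) : f ∈ flag ψ j := by
  obtain ⟨P, g, hg, rfl⟩ := mem_flag_succ.1 hf
  rw [C.cf_of_mem_flag_succ hj hg, mul_eq_zero] at h
  rw [h.resolve_right (pow_ne_zero _ PowerSeries.X_ne_zero)]
  simpa using hg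

/-- If coordinate `n` of an element of `flag ψ (n + 1)` vanishes, its coefficient on `ψ (n + 1)`
vanishes. Membership is thus a support condition, which division by `b` does not affect; this is the
source of normality. -/
theorem mem_flag_iff (C : Chain μ k φ d ψ V) {i j : ℕ} (hij : i ≤ j) (hj : j ≤ k)
    {f : XiSpace N} : f ∈ flag ψ i ↔ f ∈ flag ψ j ∧ Supp i f := by
  refine ⟨fun h => ⟨flag_mono ψ hij h, C.supp_of_mem_flag (hij.trans hj) h⟩, fun ⟨h, hs⟩ => ?_⟩
  induction j, hij using Nat.le_induction with
  | base => exact h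
  | succ n hn ih =>
    have h' := C.mem_flag_of_succ (by omega) h (hs n hn)
    exact ih (by omega) ⟨h', hs⟩ h'

theorem a_mem_flag (C : Chain μ k φ d ψ V) {j : ℕ} (hj : j ≤ k) {f : XiSpace N}
    (hf : f ∈ flag ψ j) : (Xi μ N).a f ∈ flag ψ j := by
  induction hf using Submodule.span_induction with
  | mem x hx =>
    obtain ⟨i, hi, rfl⟩ := hx
    have hi : i ≤ j := hi
    cases i with
    | zero => simp [C.psi_zero]
    | succ i =>
      rw [← one_smul ℂ⟦X⟧ (ψ (i + 1)), C.a_smul_psi (by omega)]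
      exact add_mem (Submodule.smul_mem _ _ (mem_flag ψ hi))
        (Submodule.smul_mem _ _ (mem_flag ψ (by omega)))
  | zero => simp
  | add x y _ _ hx hy => rw [map_add]; exact add_mem hx hy
  | smul P x h hx =>
    rw [a_smul]
    exact add_mem (Submodule.smul_mem _ _ hx) (Submodule.smul_mem _ _ h)

theorem inv_smul_smul (C : Chain μ k φ d ψ V) {j : ℕ} (hj : j ≤ k) (f : XiSpace N) :
    (V j)⁻¹ • (V j) • f = f := by
  rw [smul_smul, PowerSeries.inv_mul_cancel _ (by simpa using C.unit j hj), one_smul]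

/-- The units `V j` are invertible, so `step` recovers `ψ j` from `ψ (j + 1)`. -/
theorem mem_of_stable (C : Chain μ k φ d ψ V) {L : Submodule ℂ⟦X⟧ (XiSpace N)} (h : φ ∈ L)
    (ha : ∀ f ∈ L, (Xi μ N).a f ∈ L) {j : ℕ} (hj : j ≤ k) : ψ j ∈ L := by
  induction hj using Nat.decreasingInduction with
  | self =>
    rw [← C.inv_smul_smul le_rfl (ψ k), ← C.gen]
    exact Submodule.smul_mem _ _ h
  | of_succ j hj ih =>
    rw [← C.inv_smul_smul (le_of_lt hj) (ψ j), ← C.step j hj, smul_comm (μ + (d j : ℂ)),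
      ← IsScalarTower.algebraMap_smul ℂ⟦X⟧ (μ + (d j : ℂ))]
    exact Submodule.smul_mem _ _ (sub_mem (ha _ ih)
      (Submodule.smul_mem _ _ (Submodule.smul_mem _ _ ih)))

theorem generated_eq (C : Chain μ k φ d ψ V) : generated μ N φ = flag ψ k := by
  apply le_antisymm
  · refine generated_le ?_ fun f => C.a_mem_flag le_rfl
    rw [C.gen]
    exact Submodule.smul_mem _ _ (mem_flag ψ le_rfl)
  · refine Submodule.span_le.2 ?_
    rintro _ ⟨j, hj, rfl⟩
    exact C.mem_of_stable (self_mem_generated φ) (fun f => a_mem_generated) hj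

/-- Eliminating coordinates from the top costs a factor `X ^ d j` at each level. The bound converts
`b`-adic approximation in `Ξ` into exact membership in the theme. -/
theorem exists_conductor (C : Chain μ k φ d ψ V) {j : ℕ} (hj : j ≤ k) : ∃ q : ℕ,
    ∀ f : XiSpace N, Supp j f → (∀ l, PowerSeries.X ^ q ∣ cf f l) → f ∈ flag ψ j := by
  induction j with
  | zero => exact ⟨0, fun f hf _ => by rw [supp_zero_iff.1 hf]; exact zero_mem _⟩
  | succ j ih =>
    obtain ⟨q, hq⟩ := ih (by omega)
    refine ⟨q + d j, fun f hf hd => ?_⟩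
    obtain ⟨P, hP⟩ := hd j
    refine mem_flag_succ.2 ⟨PowerSeries.X ^ q * P, f - (PowerSeries.X ^ q * P) • ψ (j + 1),
      hq _ ?_ ?_, by abel⟩
    · refine (hf.sub ((C.supp _ hj).smul _)).pred ?_
      rw [cf_sub, hP, cf_smul, C.top j hj]
      ring
    · intro l
      rw [cf_sub, cf_smul]
      exact dvd_sub ((pow_dvd_pow _ (by omega)).trans (hd l)) ⟨P * cf (ψ (j + 1)) l, by ring⟩

/-- The operator `a`, modulo `b`, on the graded pieces of the flag. -/
theorem a_mod_b (C : Chain μ k φ d ψ V) {j : ℕ} (hj : j < k) {f : XiSpace N}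
    (hf : f ∈ flag ψ (j + 1)) : ∃ z ∈ flag ψ j, ∃ w ∈ flag ψ (j + 1),
      (Xi μ N).a f = z + (PowerSeries.X : ℂ⟦X⟧) • w ∧ ∀ i, j = i + 1 →
        PowerSeries.coeff (d i) (cf z i) =
          PowerSeries.coeff 0 (V j) * PowerSeries.coeff (d j) (cf f j) := by
  obtain ⟨P, g, hg, rfl⟩ := mem_flag_succ.1 hf
  have hX : ∀ ν Q, eulerOp ν Q =
      PowerSeries.X * (ν • Q + PowerSeries.X * PowerSeries.derivative ℂ Q) := fun ν Q => by
    simp only [eulerOp_apply, PowerSeries.smul_eq_C_mul]; ring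
  refine ⟨(P * V j) • ψ j + (Xi μ N).a g,
    add_mem (Submodule.smul_mem _ _ (mem_flag ψ le_rfl)) (C.a_mem_flag hj.le hg),
    ((μ + d j) • P + PowerSeries.X * PowerSeries.derivative ℂ P) • ψ (j + 1),
    Submodule.smul_mem _ _ (mem_flag ψ le_rfl), ?_, ?_⟩
  · rw [map_add, C.a_smul_psi hj, smul_smul, ← hX]
    abel
  · rintro i rfl
    rw [C.cf_of_mem_flag_succ hj hg]
    obtain ⟨Q, g', hg', rfl⟩ := mem_flag_succ.1 hg
    rw [map_add, C.a_smul_psi (by omega), cf_add, cf_add, cf_add, cf_smul, cf_smul, cf_smul,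
      C.top i (by omega), C.supp i (by omega) i le_rfl,
      C.supp_of_mem_flag (by omega) (C.a_mem_flag (by omega) hg') i le_rfl, hX]
    have e1 := PowerSeries.coeff_mul_X_pow (P * V (i + 1)) (d i) 0
    have e2 := PowerSeries.coeff_mul_X_pow P (d (i + 1)) 0
    have e3 := PowerSeries.coeff_mul_X_pow (PowerSeries.X * ((μ + d i) • Q +
      PowerSeries.X * PowerSeries.derivative ℂ Q)) (d i) 0
    rw [zero_add] at e1 e2 e3
    rw [map_add, e1, e2, mul_zero, add_zero, add_zero, e3]
    simp [mul_comm]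

end Chain

end TriangularBasis

/-! ### Uniqueness of the standard modules -/

section Standard

/-- Peeling off constant terms of `P` shows that the defect is divisible by every power of `X`, and
power series are `X`-adically separated. No continuity of `f` has to be assumed. -/
theorem map_smul_of_commute_X {M : Type*} [AddCommGroup M] [Module ℂ M] [Module ℂ⟦X⟧ M]
    [IsScalarTower ℂ ℂ⟦X⟧ M] {ι : Type*} (f : M →ₗ[ℂ] (ι → ℂ⟦X⟧))
    (hf : ∀ m, f ((PowerSeries.X : ℂ⟦X⟧) • m) = (PowerSeries.X : ℂ⟦X⟧) • f m) (P : ℂ⟦X⟧) (m : M) :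
    f (P • m) = P • f m := by
  have key : ∀ (n : ℕ) (P : ℂ⟦X⟧) (i : ι), PowerSeries.X ^ n ∣ f (P • m) i - P * f m i := by
    intro n
    induction n with
    | zero => intro P i; simp
    | succ n ih =>
      intro P i
      obtain ⟨Q, hQ⟩ : ∃ Q : ℂ⟦X⟧, P = PowerSeries.X * Q + algebraMap ℂ _ (PowerSeries.coeff 0 P) :=
        ⟨_, by simpa using PowerSeries.eq_X_mul_shift_add_const P⟩
      have e : f (P • m) i - P * f m i = PowerSeries.X * (f (Q • m) i - Q * f m i) := by
        generalize PowerSeries.coeff 0 P = c at hQ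
        rw [hQ, add_smul, mul_smul, map_add, hf, algebraMap_smul, f.map_smul c m]
        simp [PowerSeries.smul_eq_C_mul]
        ring
      rw [e, pow_succ']
      exact mul_dvd_mul_left _ (ih Q i)
  funext i
  rw [← sub_eq_zero]
  ext n
  exact PowerSeries.X_pow_dvd_iff.1 (key (n + 1) P i) n (Nat.lt_succ_self n)

variable {V : Type*} [AddCommGroup V] [Module ℂ V]

theorem ABStructure.IsFreeOfRank.eq {A : ABStructure V} {j k : ℕ} (hj : A.IsFreeOfRank j)
    (hk : A.IsFreeOfRank k) : j = k := by
  obtain ⟨e, he⟩ := hj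
  obtain ⟨e', he'⟩ := hk
  have h : ∀ (P : ℂ⟦X⟧) (m : Fin j → ℂ⟦X⟧), (e.symm.trans e') (P • m) = P • (e.symm.trans e') m := by
    refine map_smul_of_commute_X (e.symm.trans e').toLinearMap fun m => ?_
    obtain ⟨v, rfl⟩ := e.surjective m
    simp [← he, he']
  let E : (Fin j → ℂ⟦X⟧) ≃ₗ[ℂ⟦X⟧] (Fin k → ℂ⟦X⟧) :=
    { (e.symm.trans e') with map_smul' := h }
  simpa using LinearEquiv.finrank_eq E

theorem ABStructure.Iso.symm {W : Type*} [AddCommGroup W] [Module ℂ W] {A : ABStructure V}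
    {B : ABStructure W} (h : A.Iso B) : B.Iso A := by
  obtain ⟨e, ha, hb⟩ := h
  refine ⟨e.symm, fun w => ?_, fun w => ?_⟩
  · rw [LinearEquiv.symm_apply_eq, ha, LinearEquiv.apply_symm_apply]
  · rw [LinearEquiv.symm_apply_eq, hb, LinearEquiv.apply_symm_apply]

theorem ABStructure.Iso.trans {W Z : Type*} [AddCommGroup W] [Module ℂ W] [AddCommGroup Z]
    [Module ℂ Z] {A : ABStructure V} {B : ABStructure W} {C : ABStructure Z} (h : A.Iso B)
    (h' : B.Iso C) : A.Iso C := by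
  obtain ⟨e, ha, hb⟩ := h
  obtain ⟨e', ha', hb'⟩ := h'
  exact ⟨e.trans e', fun v => by simp [ha, ha'], fun v => by simp [hb, hb']⟩

/-- The image of the generator is again a generator, and the coefficients of `X` in its image under
`a` give both exponents. -/
theorem eq_of_rankOne_iso {μ ν : ℂ} (h : (rankOne μ).Iso (rankOne ν)) : μ = ν := by
  obtain ⟨e, ha, hb⟩ := h
  have hX : ∀ P : ℂ⟦X⟧, e (PowerSeries.X * P) = PowerSeries.X * e P := hb
  obtain ⟨Q, hQ⟩ := e.surjective 1
  -- If `e 1` were divisible by `X`, so would be every value of `e`, including `1`.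
  have h0 : PowerSeries.coeff 0 (e 1) ≠ 0 := by
    intro h0
    rw [PowerSeries.eq_X_mul_shift_add_const Q, map_add, hX, ← mul_one (PowerSeries.C _),
      ← PowerSeries.smul_eq_C_mul, map_smul] at hQ
    have := congrArg (PowerSeries.coeff 0) hQ
    rw [map_add, map_smul, h0] at this
    simp at this
  have h1 : e (eulerOp μ 1) = eulerOp ν (e 1) := ha 1
  rw [eulerOp_apply, map_add] at h1
  have h2 := congrArg (PowerSeries.coeff (0 + 1)) h1
  rw [coeff_succ_eulerOp, map_smul, hX] at h2
  simp only [Derivation.map_one_eq_zero, mul_zero, map_zero, add_zero, map_smul, smul_eq_mul,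
    PowerSeries.coeff_succ_X_mul, Nat.cast_zero] at h2
  exact mul_right_cancel₀ h0 (by simpa using h2)

/-- An isomorphism must send `e₁` to `κ e₁` and `e₂` to `u' e₁ + τ e₂` with constants `κ`, `τ`. In
the equation for `a e₂`, degree `0` gives `τ = κ`. In degree `p` the contributions of `u'` on the
two sides cancel, leaving `c' τ = c κ`. -/
theorem eq_of_rankTwo_iso {l : ℂ} {p : ℕ} (hp : 1 ≤ p) {c c' : ℂ}
    (h : (rankTwo l p c).Iso (rankTwo l p c')) : c = c' := by
  obtain ⟨e, ha, hb⟩ := h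
  have hX : ∀ w : ℂ⟦X⟧ × ℂ⟦X⟧, e (PowerSeries.X * w.1, PowerSeries.X * w.2) =
    (PowerSeries.X * (e w).1, PowerSeries.X * (e w).2) := hb
  have hXp : ∀ (n : ℕ) (w : ℂ⟦X⟧ × ℂ⟦X⟧), e (PowerSeries.X ^ n * w.1, PowerSeries.X ^ n * w.2) =
      (PowerSeries.X ^ n * (e w).1, PowerSeries.X ^ n * (e w).2) := by
    intro n w
    induction n with
    | zero => simp
    | succ n ih => simp only [pow_succ', mul_assoc]; rw [hX (_, _), ih]
  have ha1 : ∀ w, eulerOp l (e w).1 + (1 + c' • (PowerSeries.X : ℂ⟦X⟧) ^ p) * (e w).2 =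
      (e (eulerOp l w.1 + (1 + c • (PowerSeries.X : ℂ⟦X⟧) ^ p) * w.2, eulerOp (l + p - 1) w.2)).1 :=
    fun w => (congrArg Prod.fst (ha w)).symm
  have ha2 : ∀ w, eulerOp (l + p - 1) (e w).2 =
      (e (eulerOp l w.1 + (1 + c • (PowerSeries.X : ℂ⟦X⟧) ^ p) * w.2, eulerOp (l + p - 1) w.2)).2 :=
    fun w => (congrArg Prod.snd (ha w)).symm
  obtain ⟨q, rfl⟩ : ∃ q, p = q + 1 := ⟨p - 1, by omega⟩
  have es : ∀ P : ℂ⟦X⟧, eulerOp l P - l • (PowerSeries.X * P) = eulerOp (-(0 : ℕ)) P := fun P => by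
    rw [eulerOp_sub]; simp
  have es2 : ∀ P : ℂ⟦X⟧, eulerOp (l + (q + 1 : ℕ) - 1) P -
      (l + (q + 1 : ℕ) - 1) • (PowerSeries.X * P) = eulerOp (-(0 : ℕ)) P := fun P => by
    rw [eulerOp_sub]; simp
  -- the image of the first basis vector
  have E1 : e (eulerOp l 1 + (1 + c • (PowerSeries.X : ℂ⟦X⟧) ^ (q + 1)) * 0,
      eulerOp (l + (q + 1 : ℕ) - 1) 0) =
      l • (PowerSeries.X * (e (1, 0)).1, PowerSeries.X * (e (1, 0)).2) := by
    rw [← hX (1, 0), ← map_smul]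
    congr 1
    simp [eulerOp_apply]
  have F1 := ha1 (1, 0)
  have F2 := ha2 (1, 0)
  simp only [E1] at F1 F2
  set u := (e (1, 0)).1 with hu
  set v := (e (1, 0)).2 with hv
  simp only [Prod.smul_mk] at F1 F2
  have hv0 : v = 0 := by
    -- When `q = 0` the second component says nothing about the constant term of `v`; the first
    -- component supplies it.
    have c0 := congrArg (PowerSeries.coeff 0) F1
    have hv0 : PowerSeries.coeff 0 v = 0 := by
      rw [map_add, coeff_zero_eulerOp] at c0
      simpa using c0
    ext n
    rw [map_zero]
    rcases Nat.eq_zero_or_pos n with rfl | hn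
    · exact hv0
    · have := congrArg (PowerSeries.coeff (n + 1)) F2
      rw [coeff_succ_eulerOp, map_smul, PowerSeries.coeff_succ_X_mul, smul_eq_mul,
        ← sub_eq_zero, ← sub_mul, mul_eq_zero] at this
      refine this.resolve_left ?_
      push_cast
      ring_nf
      exact_mod_cast (by omega : q + n ≠ 0)
  have hu0 : u = PowerSeries.C (PowerSeries.coeff 0 u) := by
    rw [hv0, mul_zero, add_zero] at F1
    have := eulerOp_neg_eq_zero (n := 0) (P := u) (by rw [← es, F1, sub_self])
    simpa using this
  -- the image of the second basis vector
  have E2 : e (eulerOp l 0 + (1 + c • (PowerSeries.X : ℂ⟦X⟧) ^ (q + 1)) * 1,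
      eulerOp (l + (q + 1 : ℕ) - 1) 1) =
      (l + (q + 1 : ℕ) - 1) • (PowerSeries.X * (e (0, 1)).1, PowerSeries.X * (e (0, 1)).2) +
      ((u, v) + c • (PowerSeries.X ^ (q + 1) * u, PowerSeries.X ^ (q + 1) * v)) := by
    rw [← hX (0, 1), ← map_smul]
    have : (u, v) = e (1, 0) := rfl
    rw [← hXp (q + 1) (1, 0), this, ← map_smul, ← map_add, ← map_add]
    congr 1
    simp [eulerOp_apply]
  have G1 := ha1 (0, 1)
  have G2 := ha2 (0, 1)
  simp only [E2] at G1 G2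
  set u' := (e (0, 1)).1 with hu'
  set v' := (e (0, 1)).2 with hv'
  simp only [Prod.smul_mk, Prod.mk_add_mk] at G1 G2
  rw [hv0] at G2
  have hv'0 : v' = PowerSeries.C (PowerSeries.coeff 0 v') := by
    have := eulerOp_neg_eq_zero (n := 0) (P := v') (by rw [← es2, G2]; simp)
    simpa using this
  have k0 := congrArg (PowerSeries.coeff 0) G1
  have k1 := congrArg (PowerSeries.coeff (q + 1)) G1
  set κ := PowerSeries.coeff 0 u
  set τ := PowerSeries.coeff 0 v'
  rw [hu0, hv'0] at k0 k1
  have hκτ : τ = κ := by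
    rw [map_add, coeff_zero_eulerOp] at k0
    simpa using k0
  have hκ : κ ≠ 0 := by
    intro h
    have : e (1, 0) = e 0 := by
      rw [map_zero]
      exact Prod.ext (by rw [← hu, hu0, h, map_zero]; rfl) hv0
    simpa using e.injective this
  rw [map_add, coeff_succ_eulerOp] at k1
  simp only [map_add, map_smul, add_mul, one_mul, PowerSeries.coeff_succ_X_mul, smul_mul_assoc,
    PowerSeries.coeff_C, PowerSeries.coeff_mul_C, PowerSeries.coeff_X_pow_self, smul_eq_mul] at k1
  rw [hκτ] at k1
  refine mul_right_cancel₀ hκ ?_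
  push_cast at k1
  linear_combination -k1

end Standard

/-! ### Normal submodules, invariants and parameters of a theme with a triangular basis -/

theorem exists_linearMap_lift {V W M : Type*} [AddCommGroup V] [Module ℂ V] [AddCommGroup W]
    [Module ℂ W] [AddCommGroup M] [Module ℂ M] {i : V →ₗ[ℂ] M} (hi : Function.Injective i)
    (f : W →ₗ[ℂ] M) (hf : ∀ w, f w ∈ Set.range i) : ∃ g : W →ₗ[ℂ] V, ∀ w, i (g w) = f w := by
  refine ⟨(LinearEquiv.ofInjective i hi).symm.toLinearMap ∘ₗ f.codRestrict (LinearMap.range i) hf,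
    fun w => ?_⟩
  have := (LinearEquiv.ofInjective i hi).apply_symm_apply (f.codRestrict (LinearMap.range i) hf w)
  exact congrArg Subtype.val this

theorem ABStructure.subquotientIso_of {V W : Type*} [AddCommGroup V] [Module ℂ V]
    [AddCommGroup W] [Module ℂ W] {A : ABStructure V} {B : ABStructure W} {i j : ℕ}
    {G F : Submodule ℂ V} (hG : A.IsNormalSub G i) (hF : A.IsNormalSub F j) (hGF : G ≤ F)
    (f : W →ₗ[ℂ] V) (hf : ∀ w, f w ∈ F) (h_inj : ∀ w, f w ∈ G → w = 0)
    (h_surj : ∀ v ∈ F, ∃ w, v - f w ∈ G) (ha : ∀ w, f (B.a w) - A.a (f w) ∈ G)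
    (hb : ∀ w, f (B.b w) - A.b (f w) ∈ G) : A.SubquotientIso i j B := by
  refine ⟨G, F, hG, hF, hGF, ABStructure.Iso.symm ?_⟩
  refine ⟨LinearEquiv.ofBijective ((G.submoduleOf F).mkQ ∘ₗ f.codRestrict F hf) ⟨?_, ?_⟩, ?_, ?_⟩
  · rw [← LinearMap.ker_eq_bot, LinearMap.ker_eq_bot']
    intro w hw
    refine h_inj w ?_
    have hw' : f.codRestrict F hf w ∈ G.submoduleOf F := by
      simpa [Submodule.Quotient.mk_eq_zero] using hw
    exact hw'
  · intro y
    obtain ⟨v, rfl⟩ := Submodule.mkQ_surjective _ y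
    obtain ⟨w, hw⟩ := h_surj v v.2
    refine ⟨w, ?_⟩
    symm
    rw [LinearMap.comp_apply, Submodule.mkQ_apply, Submodule.mkQ_apply, Submodule.Quotient.eq]
    exact hw
  · intro w
    exact (Submodule.Quotient.eq _).2 (ha w)
  · intro w
    exact (Submodule.Quotient.eq _).2 (hb w)

/-- `i` identifies `A` with the submodule `L` of `Ξ_μ^{(N)}`. -/
structure IsEmbeddingOnto {V : Type*} [AddCommGroup V] [Module ℂ V] (A : ABStructure V) (μ : ℂ)
    {N : ℕ} (i : V →ₗ[ℂ] XiSpace N) (L : Submodule ℂ⟦X⟧ (XiSpace N)) : Prop where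
  injective : Function.Injective i
  range_eq : Set.range i = L
  map_a : ∀ v, i (A.a v) = (Xi μ N).a (i v)
  map_b : ∀ v, i (A.b v) = (PowerSeries.X : ℂ⟦X⟧) • i v

/-- The elements whose image involves only the first `j` basis vectors. -/
def suppSub {V : Type*} [AddCommGroup V] [Module ℂ V] {N : ℕ} (i : V →ₗ[ℂ] XiSpace N) (j : ℕ) :
    Submodule ℂ V where
  carrier := {v | Supp j (i v)}
  zero_mem' := by simp [Supp]
  add_mem' h h' := by
    simp only [Set.mem_ofPred_eq, map_add] at *
    exact h.add h'
  smul_mem' c v h := by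
    simp only [Set.mem_ofPred_eq, map_smul] at *
    exact h.smul_complex c

section

variable {V : Type*} [AddCommGroup V] [Module ℂ V] {A : ABStructure V} {μ : ℂ} {N : ℕ}
  {i : V →ₗ[ℂ] XiSpace N} {k : ℕ} {φ : XiSpace N} {d : ℕ → ℕ} {ψ : ℕ → XiSpace N} {U : ℕ → ℂ⟦X⟧}

theorem mem_suppSub {j : ℕ} {v : V} : v ∈ suppSub i j ↔ Supp j (i v) := Iff.rfl

namespace Chain

theorem linearIndependent (C : Chain μ k φ d ψ U) {j : ℕ} (hj : j ≤ k) :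
    LinearIndependent ℂ⟦X⟧ fun l : Fin j => ψ (l + 1) := by
  rw [Fintype.linearIndependent_iff]
  induction j with
  | zero => intro P _ l; exact l.elim0
  | succ j ih =>
    intro P hP
    rw [Fin.sum_univ_castSucc] at hP
    have hlast : P (Fin.last j) = 0 := by
      have h := congrArg (fun f => cf f j) hP
      simp only [cf_add, cf_sum, cf_smul, Fin.val_last, Fin.val_castSucc, C.top j hj, cf_zero] at h
      rw [Finset.sum_eq_zero fun l _ => by
        rw [C.supp _ (by omega) j (by have := l.2; omega), mul_zero], zero_add, mul_eq_zero] at h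
      exact h.resolve_right (pow_ne_zero _ PowerSeries.X_ne_zero)
    rw [hlast, zero_smul, add_zero] at hP
    intro l
    refine Fin.lastCases hlast (fun l => ?_) l
    exact ih (by omega) (fun l => P l.castSucc) hP l

theorem span_eq_flag (C : Chain μ k φ d ψ U) (j : ℕ) :
    Submodule.span ℂ⟦X⟧ (Set.range fun l : Fin j => ψ (l + 1)) = flag ψ j := by
  apply le_antisymm
  · refine Submodule.span_le.2 ?_
    rintro _ ⟨l, rfl⟩
    exact mem_flag ψ l.2
  · refine Submodule.span_le.2 ?_
    rintro _ ⟨l, hl, rfl⟩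
    have hl : l ≤ j := hl
    cases l with
    | zero => simp [C.psi_zero]
    | succ l => exact Submodule.subset_span ⟨⟨l, hl⟩, rfl⟩

theorem range_eq (C : Chain μ k φ d ψ U) (h : IsEmbeddingOnto A μ i (generated μ N φ)) :
    Set.range i = flag ψ k := by rw [h.range_eq, C.generated_eq]

theorem mem_suppSub_iff (C : Chain μ k φ d ψ U) (h : IsEmbeddingOnto A μ i (generated μ N φ))
    {j : ℕ} (hj : j ≤ k) {v : V} : v ∈ suppSub i j ↔ i v ∈ flag ψ j := by
  have hv : i v ∈ flag ψ k := by
    rw [← SetLike.mem_coe, ← C.range_eq h]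
    exact ⟨v, rfl⟩
  rw [C.mem_flag_iff hj le_rfl, mem_suppSub]
  exact ⟨fun h => ⟨hv, h⟩, fun h => h.2⟩

theorem suppSub_isStable (h : IsEmbeddingOnto A μ i (generated μ N φ)) (j : ℕ) :
    A.IsStable (suppSub i j) := by
  refine ⟨fun v hv => ?_, fun v hv => ?_⟩ <;> rw [mem_suppSub] at *
  · rw [h.map_a]; exact hv.a
  · rw [h.map_b]; exact hv.smul _

/-- The vectors `ψ 1, …, ψ j` are a basis, and multiplication by `b` does not change the support. -/
theorem suppSub_isNormalSub (C : Chain μ k φ d ψ U)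
    (h : IsEmbeddingOnto A μ i (generated μ N φ)) {j : ℕ} (hj : j ≤ k) :
    A.IsNormalSub (suppSub i j) j := by
  refine ⟨suppSub_isStable h j, ?_, fun v hv l hl => ?_⟩
  · set T := Fintype.linearCombination ℂ⟦X⟧ (fun l : Fin j => ψ (l + 1)) with hT
    have hTinj : Function.Injective T :=
      linearIndependent_iff_injective_fintypeLinearCombination.1 (C.linearIndependent hj)
    have hTr : LinearMap.range T = flag ψ j := by
      rw [hT, Fintype.range_linearCombination, C.span_eq_flag]
    obtain ⟨g, hg⟩ := exists_linearMap_lift (i := i ∘ₗ (suppSub i j).subtype)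
      (h.injective.comp Subtype.val_injective) (T.restrictScalars ℂ) (fun P => by
        have hP : T P ∈ flag ψ j := hTr ▸ LinearMap.mem_range_self T P
        have : T P ∈ Set.range i := by rw [C.range_eq h]; exact flag_mono ψ hj hP
        obtain ⟨v, hv⟩ := this
        exact ⟨⟨v, (C.mem_suppSub_iff h hj).2 (hv ▸ hP)⟩, hv⟩)
    have hg' : ∀ P, i (g P : V) = T P := hg
    have hbij : Function.Bijective g := by
      refine ⟨fun P Q hPQ => hTinj ?_, fun v => ?_⟩
      · rw [← hg', ← hg', hPQ]
      · have hv := (C.mem_suppSub_iff h hj).1 v.2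
        rw [← hTr] at hv
        obtain ⟨P, hP⟩ := hv
        exact ⟨P, Subtype.ext (h.injective (by rw [hg', hP]))⟩
    refine ⟨(LinearEquiv.ofBijective g hbij).symm, fun v => ?_⟩
    rw [LinearEquiv.symm_apply_eq]
    obtain ⟨P, rfl⟩ := hbij.2 v
    have : (LinearEquiv.ofBijective g hbij).symm (g P) = P :=
      (LinearEquiv.ofBijective g hbij).symm_apply_apply P
    rw [this, LinearEquiv.ofBijective_apply]
    refine Subtype.ext (h.injective ?_)
    rw [hg', map_smul, ← hg' P, ← h.map_b]
    rfl
  · have := hv l hl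
    rw [h.map_b, cf_smul, mul_eq_zero] at this
    exact this.resolve_left PowerSeries.X_ne_zero

/-- A stable normal submodule which contains an element involving the basis vector `m` contains
all elements involving only the basis vectors up to `m`. -/
theorem mem_of_cf_ne_zero {L G : Submodule ℂ⟦X⟧ (XiSpace N)} (hGL : G ≤ L)
    (ha : ∀ f ∈ G, (Xi μ N).a f ∈ G)
    (hn : ∀ f ∈ L, (PowerSeries.X : ℂ⟦X⟧) • f ∈ G → f ∈ G) (m : ℕ) {f : XiSpace N} (hf : f ∈ G)
    (hs : Supp (m + 1) f) (h0 : cf f m ≠ 0) {g : XiSpace N} (hg : g ∈ L) (hgs : Supp (m + 1) g) :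
    g ∈ G := by
  induction m generalizing f g with
  | zero =>
    have key : ∀ g ∈ L, Supp 0 g → g ∈ G := fun g _ hgs => by simp [supp_zero_iff.1 hgs]
    obtain ⟨n, u, hu, e⟩ := exists_eq_unit_mul_X_pow h0
    have hmul : (u * PowerSeries.X ^ n) • g ∈ G := by
      have := key ((u * PowerSeries.X ^ n) • g - cf g 0 • f)
        (sub_mem (L.smul_mem _ hg) (L.smul_mem _ (hGL hf)))
        (((hgs.smul _).sub (hs.smul _)).pred (by rw [cf_sub, cf_smul, cf_smul, e]; ring))
      simpa using add_mem this (G.smul_mem (cf g 0) hf)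
    have hX : ∀ n : ℕ, (PowerSeries.X ^ n : ℂ⟦X⟧) • g ∈ G → g ∈ G := by
      intro n
      induction n with
      | zero => simp
      | succ n ih =>
        intro h
        rw [pow_succ', mul_smul] at h
        exact ih (hn _ (L.smul_mem _ hg) h)
    refine hX n ?_
    have := G.smul_mem u⁻¹ hmul
    rwa [smul_smul, ← mul_assoc, PowerSeries.inv_mul_cancel u (by simpa using hu), one_mul] at this
  | succ m ih =>
    obtain ⟨n, u, hu, e⟩ := exists_eq_unit_mul_X_pow h0
    have hu1 : u⁻¹ * u = 1 := PowerSeries.inv_mul_cancel u (by simpa using hu)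
    set f' := u⁻¹ • f with hf'
    have hf'G : f' ∈ G := G.smul_mem _ hf
    have hf's : Supp (m + 1 + 1) f' := hs.smul _
    have hf't : cf f' (m + 1) = PowerSeries.X ^ n := by
      rw [hf', cf_smul, e, ← mul_assoc, hu1, one_mul]
    -- As in the construction of the triangular basis, this element has its highest nonzero
    -- coordinate exactly one step lower, so the induction hypothesis applies to it.
    have hz : (Xi μ N).a f' - (μ + n) • ((PowerSeries.X : ℂ⟦X⟧) • f') ∈ G := by
      refine sub_mem (ha _ hf'G) ?_
      rw [← algebraMap_smul ℂ⟦X⟧ (μ + (n : ℂ))]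
      exact G.smul_mem _ (G.smul_mem _ hf'G)
    have key : ∀ g ∈ L, Supp (m + 1) g → g ∈ G := by
      intro g hg hgs
      refine ih hz ?_ ?_ hg hgs
      · refine Supp.pred (hf's.a.sub ((hf's.smul _).smul_complex _)) ?_
        rw [cf_a_sub, hf't, hf's _ le_rfl, eulerOp_X_pow]
        simp
      · intro h
        have := congrArg (PowerSeries.coeff (n + 1)) h
        rw [cf_a_sub, hf't, ← pow_succ', map_add, coeff_succ_eulerOp,
          PowerSeries.coeff_X_pow] at this
        simp at this
    have hX : ∀ n : ℕ, (PowerSeries.X ^ n : ℂ⟦X⟧) • g ∈ G → g ∈ G := by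
      intro n
      induction n with
      | zero => simp
      | succ n ih =>
        intro h
        rw [pow_succ', mul_smul] at h
        exact ih (hn _ (L.smul_mem _ hg) h)
    refine hX n ?_
    have := key ((PowerSeries.X ^ n : ℂ⟦X⟧) • g - cf g (m + 1) • f')
      (sub_mem (L.smul_mem _ hg) (L.smul_mem _ (hGL hf'G)))
      (((hgs.smul _).sub (hf's.smul _)).pred (by rw [cf_sub, cf_smul, cf_smul, hf't]; ring))
    simpa using add_mem this (G.smul_mem (cf g (m + 1)) hf'G)

/-- Take the least `m` with `F ≤ suppSub i m`. If `m > 0`, then `F` has an element whose coordinate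
`m - 1` is nonzero, and `mem_of_cf_ne_zero` forces `F` to be all of `suppSub i m`. Comparing ranks
gives `m = j`. -/
theorem eq_suppSub (C : Chain μ k φ d ψ U) (h : IsEmbeddingOnto A μ i (generated μ N φ))
    {F : Submodule ℂ V} {j : ℕ} (hF : A.IsNormalSub F j) : F = suppSub i j ∧ j ≤ k := by
  obtain ⟨hst, ⟨e, he⟩, hn⟩ := hF
  have hfree : (A.restrict F hst).IsFreeOfRank j := ⟨e, he⟩
  -- the image of `F` is a `ℂ⟦X⟧`-submodule
  set T₀ : (Fin j → ℂ⟦X⟧) →ₗ[ℂ] XiSpace N := i ∘ₗ F.subtype ∘ₗ e.symm.toLinearMap with hT₀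
  have hT₀X : ∀ m, T₀ ((PowerSeries.X : ℂ⟦X⟧) • m) = (PowerSeries.X : ℂ⟦X⟧) • T₀ m := by
    intro m
    obtain ⟨v, rfl⟩ := e.surjective m
    rw [← he]
    simp only [hT₀, LinearMap.comp_apply, LinearEquiv.coe_coe, LinearEquiv.symm_apply_apply,
      Submodule.subtype_apply]
    rw [← h.map_b]
    rfl
  let T : (Fin j → ℂ⟦X⟧) →ₗ[ℂ⟦X⟧] XiSpace N :=
    { T₀ with map_smul' := fun P m => map_smul_of_commute_X T₀ hT₀X P m }
  have hTmem : ∀ v, i v ∈ LinearMap.range T ↔ v ∈ F := by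
    intro v
    constructor
    · rintro ⟨m, hm⟩
      have hm : i (e.symm m : V) = i v := hm
      rw [← h.injective hm]
      exact (e.symm m).2
    · intro hv
      refine ⟨e ⟨v, hv⟩, ?_⟩
      change i (e.symm (e ⟨v, hv⟩) : V) = i v
      rw [LinearEquiv.symm_apply_apply]
  have hTle : LinearMap.range T ≤ flag ψ k := by
    rintro _ ⟨m, rfl⟩
    rw [← SetLike.mem_coe, ← C.range_eq h]
    exact ⟨e.symm m, rfl⟩
  have hlift : ∀ f ∈ flag ψ k, ∃ v, i v = f := fun f hf => by
    have : f ∈ Set.range i := by rw [C.range_eq h]; exact hf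
    exact this
  have hTa : ∀ f ∈ LinearMap.range T, (Xi μ N).a f ∈ LinearMap.range T := by
    intro f hf
    obtain ⟨v, rfl⟩ := hlift f (hTle hf)
    rw [← h.map_a, hTmem]
    exact hst.1 v ((hTmem v).1 hf)
  have hTn : ∀ f ∈ flag ψ k, (PowerSeries.X : ℂ⟦X⟧) • f ∈ LinearMap.range T →
      f ∈ LinearMap.range T := by
    intro f hf hXf
    obtain ⟨v, rfl⟩ := hlift f hf
    rw [← h.map_b, hTmem] at hXf
    rw [hTmem]
    exact hn v hXf
  -- the smallest member of the flag that contains `F`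
  have hex : ∃ m, F ≤ suppSub i m := ⟨N + 1, fun v _ => supp_last (i v)⟩
  have hexk : F ≤ suppSub i k := fun v _ => by
    rw [C.mem_suppSub_iff h le_rfl, ← SetLike.mem_coe, ← C.range_eq h]
    exact ⟨v, rfl⟩
  classical
  set m := Nat.find hex with hm
  have hmk : m ≤ k := Nat.find_min' hex hexk
  have hle : F ≤ suppSub i m := Nat.find_spec hex
  have hge : suppSub i m ≤ F := by
    intro v hv
    rcases Nat.eq_zero_or_pos m with h0 | h0
    · rw [h0, mem_suppSub, supp_zero_iff, map_eq_zero_iff i h.injective] at hv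
      rw [hv]; exact zero_mem F
    · obtain ⟨n, hn'⟩ : ∃ n, m = n + 1 := ⟨m - 1, by omega⟩
      have hnot : ¬ F ≤ suppSub i n := Nat.find_min hex (by omega)
      obtain ⟨w, hw, hw'⟩ := SetLike.not_le_iff_exists.1 hnot
      have hws : Supp (n + 1) (i w) := hn' ▸ hle hw
      rw [← hTmem]
      refine mem_of_cf_ne_zero hTle hTa hTn n ((hTmem w).2 hw) hws
        (fun h0 => hw' (hws.pred h0)) ?_ (hn' ▸ hv)
      rw [← SetLike.mem_coe, ← C.range_eq h]
      exact ⟨v, rfl⟩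
  have hF : F = suppSub i m := le_antisymm hle hge
  have hmj : m = j := by
    have hm := C.suppSub_isNormalSub h hmk
    rw [← hF] at hm
    exact hm.free.eq hfree
  exact ⟨hmj ▸ hF, hmj ▸ hmk⟩

/-- `SubquotientIso` is existential in the two submodules; uniqueness of normal submodules shows
that only one quotient can occur. -/
theorem iso_of_subquotientIso (C : Chain μ k φ d ψ U)
    (h : IsEmbeddingOnto A μ i (generated μ N φ)) {W W' : Type*} [AddCommGroup W] [Module ℂ W]
    [AddCommGroup W'] [Module ℂ W'] {B : ABStructure W} {B' : ABStructure W'} {m n : ℕ}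
    (hB : A.SubquotientIso m n B) (hB' : A.SubquotientIso m n B') : B.Iso B' := by
  obtain ⟨G, F, hG, hF, -, e⟩ := hB
  obtain ⟨G', F', hG', hF', -, e'⟩ := hB'
  obtain rfl := (C.eq_suppSub h hG).1.trans (C.eq_suppSub h hG').1.symm
  obtain rfl := (C.eq_suppSub h hF).1.trans (C.eq_suppSub h hF').1.symm
  exact e.symm.trans e'

end Chain

end

/-! ### Exponents and principal parameters read off from a triangular basis -/

section

variable {V : Type*} [AddCommGroup V] [Module ℂ V] {A : ABStructure V} {μ : ℂ} {N : ℕ}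
  {i : V →ₗ[ℂ] XiSpace N} {k : ℕ} {φ : XiSpace N} {d : ℕ → ℕ} {ψ : ℕ → XiSpace N} {U : ℕ → ℂ⟦X⟧}

namespace Chain

/-- This is coordinate `j` of `step`; the last term comes from the logarithm. Its degree is the one
that `eulerOp (-d (j + 1))` misses, so its coefficient is unperturbed. The inequality between
consecutive exponents and the normalization of `V (j + 1)` both follow from this. -/
theorem unit_mul_X_pow (C : Chain μ k φ d ψ U) {j : ℕ} (hj : j + 1 < k) :
    U (j + 1) * PowerSeries.X ^ d j = eulerOp (-d (j + 1) : ℂ) (cf (ψ (j + 2)) j) +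
      PowerSeries.X ^ (d (j + 1) + 1) := by
  have h := congrArg (fun f => cf f j) (C.step (j + 1) hj)
  simp only [cf_a_sub] at h
  rw [C.top (j + 1) hj, cf_smul, C.top j (by omega), ← pow_succ'] at h
  rw [← h]
  simp

theorem coeff_unit_mul_X_pow (C : Chain μ k φ d ψ U) {j : ℕ} (hj : j + 1 < k) :
    PowerSeries.coeff (d (j + 1) + 1) (U (j + 1) * PowerSeries.X ^ d j) = 1 := by
  rw [C.unit_mul_X_pow hj, map_add, coeff_succ_eulerOp, PowerSeries.coeff_X_pow_self]
  simp

theorem exponent_le (C : Chain μ k φ d ψ U) {j : ℕ} (hj : j + 1 < k) : d j ≤ d (j + 1) + 1 := by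
  by_contra h
  have := C.coeff_unit_mul_X_pow hj
  rw [PowerSeries.coeff_mul_X_pow', if_neg (by omega)] at this
  exact zero_ne_one this

theorem coeff_unit (C : Chain μ k φ d ψ U) {j p : ℕ} (hj : j + 1 < k)
    (hp : p + d j = d (j + 1) + 1) : PowerSeries.coeff p (U (j + 1)) = 1 := by
  rw [← C.coeff_unit_mul_X_pow hj, ← hp, PowerSeries.coeff_mul_X_pow]

theorem subquotientIso_rankOne (C : Chain μ k φ d ψ U)
    (h : IsEmbeddingOnto A μ i (generated μ N φ)) {j : ℕ} (hj : j < k) :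
    A.SubquotientIso j (j + 1) (rankOne (μ + d j)) := by
  have hmem : ∀ P : ℂ⟦X⟧, P • ψ (j + 1) ∈ flag ψ (j + 1) := fun P =>
    Submodule.smul_mem _ _ (mem_flag ψ le_rfl)
  obtain ⟨f, hf⟩ := exists_linearMap_lift h.injective
    ((LinearMap.toSpanSingleton ℂ⟦X⟧ (XiSpace N) (ψ (j + 1))).restrictScalars ℂ) (fun P => by
      rw [C.range_eq h]
      exact flag_mono ψ hj (hmem P))
  replace hf : ∀ P, i (f P) = P • ψ (j + 1) := hf
  refine ABStructure.subquotientIso_of (C.suppSub_isNormalSub h hj.le)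
    (C.suppSub_isNormalSub h hj) (fun v hv => hv.mono (by omega)) f ?_ ?_ ?_ ?_ ?_
  · intro P
    rw [C.mem_suppSub_iff h hj, hf]
    exact hmem P
  · intro P hP
    rw [mem_suppSub, hf] at hP
    have := hP j le_rfl
    rw [cf_smul, C.top j hj, mul_eq_zero] at this
    exact this.resolve_right (pow_ne_zero _ PowerSeries.X_ne_zero)
  · intro v hv
    rw [C.mem_suppSub_iff h hj, mem_flag_succ] at hv
    obtain ⟨P, g, hg, e⟩ := hv
    refine ⟨P, ?_⟩
    rw [C.mem_suppSub_iff h hj.le, map_sub, hf, e, add_sub_cancel_left]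
    exact hg
  · intro P
    rw [C.mem_suppSub_iff h hj.le, map_sub, h.map_a, hf, hf, C.a_smul_psi hj, ← sub_sub]
    change eulerOp (μ + d j) P • _ - _ - _ ∈ _
    rw [sub_self, zero_sub]
    exact neg_mem (Submodule.smul_mem _ _ (mem_flag ψ le_rfl))
  · intro P
    rw [C.mem_suppSub_iff h hj.le, map_sub, h.map_b, hf, hf, smul_smul]
    change (PowerSeries.X * P) • _ - _ ∈ _
    rw [sub_self]
    exact zero_mem _

/-- `eulerOp (1 - p)` multiplies the coefficient in degree `n` by `n + 1 - p` and moves it to degree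
`n + 1`. Only the degrees `0` and `p` obstruct solvability. -/
theorem exists_eulerOp_eq {p : ℕ} {R : ℂ⟦X⟧} (h0 : PowerSeries.coeff 0 R = 0)
    (hp : PowerSeries.coeff p R = 0) : ∃ W, eulerOp (1 - p : ℂ) W = R := by
  -- At `n = p - 1` the factor is `0⁻¹ = 0`; this is harmless because the coefficient of `R` in
  -- degree `p` vanishes.
  refine ⟨PowerSeries.mk fun n => (1 - p + n : ℂ)⁻¹ * PowerSeries.coeff (n + 1) R, ?_⟩
  ext m
  cases m with
  | zero => rw [coeff_zero_eulerOp, h0]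
  | succ m =>
    rw [coeff_succ_eulerOp, PowerSeries.coeff_mk, ← mul_assoc]
    by_cases hm : (1 - p + m : ℂ) = 0
    · have : p = m + 1 := by
        have : (p : ℂ) = (m + 1 : ℕ) := by push_cast; linear_combination -hm
        exact_mod_cast this
      rw [← this, hp, mul_zero]
    · rw [mul_inv_cancel₀ hm, one_mul]

/-- Replacing `ψ (j + 2)` by `ψ (j + 2) + W • ψ (j + 1)` adds `eulerOp (1 - p) W` to `U (j + 1)`.
Since the resonant coefficient of `U (j + 1)` is `1`, a suitable `W` reduces it to `u + X ^ p = u (1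
+ u⁻¹ X ^ p)`. Rescaling `ψ (j + 1)` by `u` then gives the standard form with parameter `u⁻¹`. -/
theorem subquotientIso_rankTwo (C : Chain μ k φ d ψ U)
    (h : IsEmbeddingOnto A μ i (generated μ N φ)) {j p : ℕ} (hj : j + 1 < k) (hp1 : 1 ≤ p)
    (hp : p + d j = d (j + 1) + 1) : A.SubquotientIso j (j + 2)
      (rankTwo (μ + d j) p (PowerSeries.coeff 0 (U (j + 1)))⁻¹) := by
  set u := PowerSeries.coeff 0 (U (j + 1)) with hu
  have hu0 : u ≠ 0 := C.unit (j + 1) hj.le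
  have hpc : (p : ℂ) + d j = d (j + 1) + 1 := by exact_mod_cast hp
  have hl : μ + d j + p - 1 = μ + d (j + 1) := by linear_combination hpc
  obtain ⟨W, hW⟩ := exists_eulerOp_eq (p := p)
    (R := PowerSeries.C u + PowerSeries.X ^ p - U (j + 1))
    (by simp [hu, show p ≠ 0 by omega])
    (by
      rw [map_sub, map_add, C.coeff_unit hj hp, PowerSeries.coeff_C, PowerSeries.coeff_X_pow_self,
        if_neg (by omega)]
      ring)
  set x₁ := PowerSeries.C u • ψ (j + 1) with hx₁
  set x₂ := ψ (j + 2) + W • ψ (j + 1) with hx₂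
  have hx₁m : x₁ ∈ flag ψ (j + 1) := Submodule.smul_mem _ _ (mem_flag ψ le_rfl)
  have hx₂m : x₂ ∈ flag ψ (j + 2) := add_mem (mem_flag ψ le_rfl)
    (Submodule.smul_mem _ _ (mem_flag ψ (by omega)))
  have hax₁ : ∀ P : ℂ⟦X⟧, (Xi μ N).a (P • x₁) =
      eulerOp (μ + d j) P • x₁ + (P * PowerSeries.C u * U j) • ψ j := by
    intro P
    have e : eulerOp (μ + d j) (P * PowerSeries.C u) = eulerOp (μ + d j) P * PowerSeries.C u := by
      simp only [eulerOp_apply, PowerSeries.smul_eq_C_mul, Derivation.leibniz,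
        PowerSeries.derivative_C, smul_eq_mul]
      ring
    rw [hx₁, smul_smul, C.a_smul_psi (by omega), e, smul_smul]
  have hax₂ : ∀ P : ℂ⟦X⟧, (Xi μ N).a (P • x₂) = eulerOp (μ + d (j + 1)) P • x₂ +
      ((1 + u⁻¹ • (PowerSeries.X : ℂ⟦X⟧) ^ p) * P) • x₁ + (P * W * U j) • ψ j := by
    intro P
    have e : eulerOp (μ + d j) W = PowerSeries.C u + PowerSeries.X ^ p - U (j + 1) +
        PowerSeries.C (μ + d (j + 1) : ℂ) * (PowerSeries.X * W) := by
      rw [← hW, ← PowerSeries.smul_eq_C_mul, ← sub_eq_iff_eq_add, eulerOp_sub]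
      congr 2
      linear_combination hl
    have hCu : PowerSeries.C u⁻¹ * PowerSeries.C u = (1 : ℂ⟦X⟧) := by
      rw [← map_mul, inv_mul_cancel₀ hu0, map_one]
    rw [hx₂, smul_add, smul_smul, map_add, C.a_smul_psi hj, C.a_smul_psi (by omega),
      eulerOp_mul, e, eulerOp_apply _ P, hx₁]
    refine cf_ext fun l => ?_
    simp only [cf_add, cf_smul, PowerSeries.smul_eq_C_mul]
    linear_combination (- P * PowerSeries.X ^ p * cf (ψ (j + 1)) l) * hCu
  have hmem : ∀ w : ℂ⟦X⟧ × ℂ⟦X⟧, w.1 • x₁ + w.2 • x₂ ∈ flag ψ (j + 2) := fun w =>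
    add_mem (Submodule.smul_mem _ _ (flag_mono ψ (by omega) hx₁m)) (Submodule.smul_mem _ _ hx₂m)
  have hcx₁ : cf x₁ j = PowerSeries.C u * PowerSeries.X ^ d j := by
    rw [hx₁, cf_smul, C.top j (by omega)]
  have hsx₁ : cf x₁ (j + 1) = 0 := C.supp_of_mem_flag (by omega) hx₁m _ le_rfl
  have hcx₂ : cf x₂ (j + 1) = PowerSeries.X ^ d (j + 1) := by
    rw [hx₂, cf_add, cf_smul, C.top _ hj, C.supp (j + 1) (by omega) _ le_rfl]
    ring
  clear_value x₁ x₂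
  have hCu0 : PowerSeries.C u ≠ (0 : ℂ⟦X⟧) := by simpa using hu0
  obtain ⟨f, hf⟩ := exists_linearMap_lift h.injective
    (((LinearMap.toSpanSingleton ℂ⟦X⟧ (XiSpace N) x₁).coprod
      (LinearMap.toSpanSingleton ℂ⟦X⟧ (XiSpace N) x₂)).restrictScalars ℂ) (fun w => by
      rw [C.range_eq h]
      exact flag_mono ψ (by omega) (hmem w))
  replace hf : ∀ w : ℂ⟦X⟧ × ℂ⟦X⟧, i (f w) = w.1 • x₁ + w.2 • x₂ := hf
  have hj0 : j ≤ k := by omega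
  have hj2 : j + 2 ≤ k := by omega
  refine ABStructure.subquotientIso_of (C.suppSub_isNormalSub h hj0)
    (C.suppSub_isNormalSub h hj2) (fun v hv => hv.mono (by omega)) f ?_ ?_ ?_ ?_ ?_
  · intro w
    rw [C.mem_suppSub_iff h hj2, hf]
    exact hmem w
  · intro w hw
    rw [mem_suppSub, hf] at hw
    have h1 := hw (j + 1) (by omega)
    rw [cf_add, cf_smul, cf_smul, hsx₁, hcx₂, mul_zero, zero_add, mul_eq_zero] at h1
    have h1 := h1.resolve_right (pow_ne_zero _ PowerSeries.X_ne_zero)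
    have h2 := hw j le_rfl
    rw [cf_add, cf_smul, hcx₁, h1, zero_smul, cf_zero, add_zero, mul_eq_zero] at h2
    exact Prod.ext (h2.resolve_right
      (mul_ne_zero hCu0 (pow_ne_zero _ PowerSeries.X_ne_zero))) h1
  · intro v hv
    rw [C.mem_suppSub_iff h hj2, mem_flag_succ] at hv
    obtain ⟨P, g, hg, e⟩ := hv
    obtain ⟨Q, g', hg', rfl⟩ := mem_flag_succ.1 hg
    -- These are the coordinates of `P • ψ (j + 2) + Q • ψ (j + 1)` in the basis `x₁`, `x₂`.
    refine ⟨((Q - P * W) * PowerSeries.C u⁻¹, P), ?_⟩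
    rw [C.mem_suppSub_iff h hj0, map_sub, hf, e]
    have hCu : PowerSeries.C u⁻¹ * PowerSeries.C u = (1 : ℂ⟦X⟧) := by
      rw [← map_mul, inv_mul_cancel₀ hu0, map_one]
    convert hg' using 1
    refine cf_ext fun l => ?_
    simp only [hx₁, hx₂, cf_add, cf_sub, cf_smul]
    linear_combination (-(Q - P * W) * cf (ψ (j + 1)) l) * hCu
  · intro w
    rw [C.mem_suppSub_iff h hj0, map_sub, h.map_a, hf, hf, map_add, hax₁, hax₂]
    have e : (rankTwo (μ + d j) p u⁻¹).a w = (eulerOp (μ + d j) w.1 +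
        (1 + u⁻¹ • (PowerSeries.X : ℂ⟦X⟧) ^ p) * w.2, eulerOp (μ + d (j + 1)) w.2) := by
      rw [← hl]; rfl
    rw [e]
    convert neg_mem (Submodule.smul_mem (flag ψ j)
      (w.1 * PowerSeries.C u * U j + w.2 * W * U j) (mem_flag ψ le_rfl)) using 1
    simp only [add_smul]
    abel
  · intro w
    rw [C.mem_suppSub_iff h hj0, map_sub, h.map_b, hf, hf, smul_add, smul_smul, smul_smul]
    change (PowerSeries.X * w.1) • _ + (PowerSeries.X * w.2) • _ - _ ∈ _
    rw [sub_self]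
    exact zero_mem _

/-- The fundamental invariants of a theme with a triangular basis. -/
theorem hasFundamentalInvariants (C : Chain μ k φ d ψ U)
    (h : IsEmbeddingOnto A μ i (generated μ N φ)) {l₁ : ℚ} {p : ℕ → ℕ}
    (hl : ∀ j < k, ((exponent l₁ p (j + 1) : ℚ) : ℂ) = μ + d j) :
    HasFundamentalInvariants A k l₁ p := by
  intro j hj1 hjk ν
  obtain ⟨j, rfl⟩ : ∃ n, j = n + 1 := ⟨j - 1, by omega⟩
  rw [hl j hjk, Nat.add_sub_cancel]
  have key := C.subquotientIso_rankOne h (j := j) hjk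
  refine ⟨fun hν => eq_of_rankOne_iso (C.iso_of_subquotientIso h hν key), ?_⟩
  rintro rfl
  exact key

/-- The principal parameters of a theme with a triangular basis. -/
theorem isPrincipalParameter_iff (C : Chain μ k φ d ψ U)
    (h : IsEmbeddingOnto A μ i (generated μ N φ)) {l₁ : ℚ} {p : ℕ → ℕ} {j : ℕ} (hj : j + 1 < k)
    (hl : ((exponent l₁ p (j + 1) : ℚ) : ℂ) = μ + d j) (hp1 : 1 ≤ p (j + 1))
    (hp : p (j + 1) + d j = d (j + 1) + 1) (c : ℂ) :
    IsPrincipalParameter A l₁ p (j + 1) c ↔ c = (PowerSeries.coeff 0 (U (j + 1)))⁻¹ := by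
  have key := C.subquotientIso_rankTwo h hj hp1 hp
  rw [IsPrincipalParameter, hl, Nat.add_sub_cancel]
  refine ⟨fun hc => eq_of_rankTwo_iso hp1 (C.iso_of_subquotientIso h hc.2 key), ?_⟩
  rintro rfl
  exact ⟨inv_ne_zero (C.unit _ hj.le), key⟩

end Chain

end

/-! ### The indicial polynomial, and local constancy of the exponents -/

section Indicial

variable {μ : ℂ} {N k : ℕ} {φ : XiSpace N}

/-- A cyclic vector of rank `k` has a triangular basis of length `k`. -/
theorem exists_chain_of_linearIndependent
    (hi : LinearIndependent ℂ⟦X⟧ fun j : Fin k => ((Xi μ N).a ^ (j : ℕ)) φ)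
    {S : Fin k → ℂ⟦X⟧} (hS : ((Xi μ N).a ^ k) φ = ∑ j, S j • ((Xi μ N).a ^ (j : ℕ)) φ) :
    ∃ d ψ V, Chain μ k φ d ψ V := by
  classical
  have hex : ∃ m, Supp m φ := ⟨N + 1, supp_last φ⟩
  obtain ⟨d, ψ, V, C⟩ := exists_chain (μ := μ) (Nat.find hex) φ (Nat.find_spec hex)
    (fun j hj h0 => Nat.find_min hex (m := j) (by omega) (by
      have := Nat.find_spec hex
      rw [hj] at this
      exact this.pred h0))
  set L := Submodule.span ℂ⟦X⟧ (Set.range fun j : Fin k => ((Xi μ N).a ^ (j : ℕ)) φ) with hL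
  have hk : ((Xi μ N).a ^ k) φ ∈ L := by
    rw [hS]
    exact sum_mem fun j _ => Submodule.smul_mem _ _ (Submodule.subset_span ⟨j, rfl⟩)
  have hle : ∀ j ≤ k, ((Xi μ N).a ^ j) φ ∈ L := by
    intro j hj
    rcases hj.eq_or_lt with rfl | hj
    · exact hk
    · exact Submodule.subset_span ⟨⟨j, hj⟩, rfl⟩
  have hgen : generated μ N φ = L := by
    apply le_antisymm
    · refine generated_le (by simpa using hle 0 (by omega)) fun f hf => ?_
      induction hf using Submodule.span_induction with
      | mem x hx =>
        obtain ⟨j, rfl⟩ := hx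
        simpa [pow_succ'] using hle (j + 1) j.2
      | zero => simp
      | add x y _ _ hx hy => rw [map_add]; exact add_mem hx hy
      | smul P x h hx =>
        rw [a_smul]
        exact add_mem (Submodule.smul_mem _ _ hx) (Submodule.smul_mem _ _ h)
    · refine Submodule.span_mono ?_
      rintro _ ⟨j, rfl⟩
      exact ⟨j, rfl⟩
  -- The chain was built with length the least support bound of `φ`; two bases of the same module
  -- show that this length is `k`.
  have h1 := finrank_span_eq_card hi
  have h2 := finrank_span_eq_card (C.linearIndependent le_rfl)
  rw [C.span_eq_flag, ← C.generated_eq, hgen, h1] at h2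
  simp only [Fintype.card_fin] at h2
  rw [← h2] at C
  exact ⟨d, ψ, V, C⟩

variable {d : ℕ → ℕ} {ψ : ℕ → XiSpace N} {V : ℕ → ℂ⟦X⟧}

/-- Unwinding `step` expresses a unit multiple of `ψ (k - m)` as an operator, homogeneous of degree
`m` up to series coefficients, applied to `φ`. Its symbol replaces `b ^ (m - j) a ^ j` by the rising
factorial `T (T + 1) ⋯ (T + j - 1)`, as dictated by `a = T b` on a vector of exponent `T`. Composing
on the left with `a - ν b` multiplies the symbol by `T + m - ν`. -/
theorem Chain.exists_symbol (C : Chain μ k φ d ψ V) {m : ℕ} (hm : m ≤ k) :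
    ∃ (w : ℂ⟦X⟧) (c : ℕ → ℂ⟦X⟧), PowerSeries.coeff 0 w ≠ 0 ∧ c m = 1 ∧
      w • ψ (k - m) = ∑ j ∈ Finset.range (m + 1),
        (PowerSeries.X ^ (m - j) * c j) • ((Xi μ N).a ^ j) φ ∧
      ∀ T : ℂ, ∑ j ∈ Finset.range (m + 1), PowerSeries.coeff 0 (c j) *
        (ascPochhammer ℂ j).eval T = ∏ i ∈ Finset.range m, (T + i - (μ + d (k - 1 - i))) := by
  induction m with
  | zero => exact ⟨V k, fun _ => 1, C.unit k le_rfl, rfl, by simp [← C.gen], by simp⟩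
  | succ m ih =>
    obtain ⟨w, c, hw, hcm, hψ, hT⟩ := ih (by omega)
    obtain ⟨l, hl⟩ : ∃ l, k = l + m + 1 := ⟨k - m - 1, by omega⟩
    have hwi : w * w⁻¹ = 1 := PowerSeries.mul_inv_cancel w (by simpa using hw)
    rw [show k - m = l + 1 by omega] at hψ
    rw [show k - (m + 1) = l by omega]
    set ν : ℂ := μ + d l with hν
    -- The second term absorbs the commutator of `a` with the unit `w`; it is divisible by `X`, so
    -- the symbol sees only `ν`.
    set τ : ℂ⟦X⟧ := PowerSeries.C ν + PowerSeries.X * PowerSeries.derivative ℂ w * w⁻¹ with hτ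
    have hstep : (w * V l) • ψ l =
        (Xi μ N).a (w • ψ (l + 1)) - (PowerSeries.X * τ) • (w • ψ (l + 1)) := by
      rw [C.a_smul_psi (by omega), eulerOp_apply, hτ]
      refine cf_ext fun n => ?_
      simp only [cf_add, cf_sub, cf_smul, PowerSeries.smul_eq_C_mul, ← hν]
      linear_combination (PowerSeries.X ^ 2 * PowerSeries.derivative ℂ w * cf (ψ (l + 1)) n) * hwi
    set g : ℕ → ℂ⟦X⟧ := fun j => PowerSeries.C ((m : ℂ) - j) * c j +
      PowerSeries.X * PowerSeries.derivative ℂ (c j) - τ * c j with hg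
    refine ⟨w * V l, fun j => (if j = 0 then 0 else c (j - 1)) + if j < m + 1 then g j else 0,
      ?_, by simp [hcm], ?_, ?_⟩
    · have := C.unit l (by omega)
      simp only [PowerSeries.coeff_zero_eq_constantCoeff] at hw this ⊢
      rw [map_mul]
      exact mul_ne_zero hw this
    · rw [hstep, hψ, map_sum, Finset.smul_sum, ← Finset.sum_sub_distrib]
      simp only [mul_add, add_smul, Finset.sum_add_distrib]
      rw [Finset.sum_range_succ' _ (m + 1), Finset.sum_range_succ (fun j => 
        (PowerSeries.X ^ (m + 1 - j) * if j < m + 1 then g j else 0) • ((Xi μ N).a ^ j) φ)]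
      simp only [Nat.add_eq_zero_iff, one_ne_zero, and_false, if_false, if_true, mul_zero, zero_smul,
        add_zero, lt_irrefl, Nat.add_sub_cancel, Nat.add_sub_add_right]
      rw [← Finset.sum_add_distrib]
      refine Finset.sum_congr rfl fun j hj => ?_
      rw [Finset.mem_range] at hj
      rw [if_pos hj, a_smul, ← LinearMap.comp_apply, ← Module.End.mul_eq_comp, ← pow_succ',
        smul_smul]
      obtain ⟨n, rfl⟩ : ∃ n, m = j + n := ⟨m - j, by omega⟩
      rw [show j + n - j = n by omega, show j + n + 1 - j = n + 1 by omega]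
      have hd : PowerSeries.X ^ 2 * PowerSeries.derivative ℂ (PowerSeries.X ^ n * c j) =
          PowerSeries.X ^ (n + 1) * (PowerSeries.C (n : ℂ) * c j + PowerSeries.X * PowerSeries.derivative ℂ (c j)) := by
        rw [map_natCast, Derivation.leibniz, PowerSeries.derivative_pow, PowerSeries.derivative_X]
        simp only [smul_eq_mul]
        cases n with
        | zero => simp; ring
        | succ n => push_cast; ring_nf
      have hjn : (((j + n : ℕ) : ℂ) - j) = n := by push_cast; ring
      simp only [hd, hg, hjn]
      refine cf_ext fun n => ?_
      simp only [cf_add, cf_sub, cf_smul]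
      ring
    · intro T
      rw [Finset.prod_range_succ, ← hT T, show k - 1 - m = l by omega, ← hν]
      simp only [map_add, add_mul, Finset.sum_add_distrib]
      rw [Finset.sum_range_succ' _ (m + 1), Finset.sum_range_succ (fun j => 
        PowerSeries.coeff 0 (if j < m + 1 then g j else 0) * (ascPochhammer ℂ j).eval T)]
      simp only [Nat.add_eq_zero_iff, one_ne_zero, and_false, if_false, if_true, map_zero, zero_mul,
        add_zero, lt_irrefl, Nat.add_sub_cancel]
      rw [← Finset.sum_add_distrib, Finset.sum_mul]
      refine Finset.sum_congr rfl fun j hj => ?_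
      rw [Finset.mem_range] at hj
      rw [if_pos hj, ascPochhammer_succ_eval, hg, hτ]
      simp
      ring

/-- The indicial polynomial of the annihilator of `φ`. -/
theorem Chain.indicial (C : Chain μ k φ d ψ V)
    (hi : LinearIndependent ℂ⟦X⟧ fun j : Fin k => ((Xi μ N).a ^ (j : ℕ)) φ)
    {S : Fin k → ℂ⟦X⟧} (hS : ((Xi μ N).a ^ k) φ = ∑ j, S j • ((Xi μ N).a ^ (j : ℕ)) φ) (T : ℂ) :
    (ascPochhammer ℂ k).eval T - ∑ j : Fin k, PowerSeries.coeff (k - j) (S j) *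
      (ascPochhammer ℂ j).eval T = ∏ i ∈ Finset.range k, (T + i - (μ + d (k - 1 - i))) := by
  -- At `m = k` the vector is `ψ 0 = 0`, so the combination is a relation among `φ, …, a ^ k φ`.
  -- Linear independence identifies its coefficients with those of `S`.
  obtain ⟨w, c, hw, hck, hψ, hT⟩ := C.exists_symbol (m := k) le_rfl
  rw [Nat.sub_self, C.psi_zero, smul_zero, Finset.sum_range_succ, hck, Nat.sub_self, hS,
    Finset.sum_range, pow_zero, one_mul, one_smul, ← Finset.sum_add_distrib] at hψ
  simp only [← add_smul] at hψ
  have hz := Fintype.linearIndependent_iff.1 hi _ hψ.symm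
  rw [← hT T, Finset.sum_range_succ, hck, Finset.sum_range, add_comm, sub_eq_add_neg,
    ← Finset.sum_neg_distrib]
  simp only [PowerSeries.coeff_zero_one, one_mul]
  congr 1
  refine Finset.sum_congr rfl fun j _ => ?_
  have hj : S j = -(PowerSeries.X ^ (k - (j : ℕ)) * c j) := by linear_combination hz j
  have := PowerSeries.coeff_X_pow_mul (c j) (k - (j : ℕ)) 0
  rw [zero_add] at this
  rw [hj, map_neg, this]
  ring

/-- Two monic polynomials of degree `k` agreeing at `k` points coincide, so their roots agree as
multisets. A multiset has only one decreasing enumeration. -/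
theorem antitone_eq_of_prod_eq {k : ℕ} {e e' : ℕ → ℤ} (he : ∀ m, m + 1 < k → e (m + 1) ≤ e m)
    (he' : ∀ m, m + 1 < k → e' (m + 1) ≤ e' m)
    (h : ∀ t < k, ∏ i ∈ Finset.range k, ((t : ℤ) - e i) = ∏ i ∈ Finset.range k, ((t : ℤ) - e' i)) :
    ∀ m < k, e m = e' m := by
  have hpoly : ∏ i ∈ Finset.range k, (Polynomial.X - Polynomial.C (e i)) =
      ∏ i ∈ Finset.range k, (Polynomial.X - Polynomial.C (e' i)) := by
    refine Polynomial.eq_of_degree_le_of_eval_finset_eq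
      ((Finset.range k).map ⟨fun n : ℕ => (n : ℤ), Nat.cast_injective⟩) ?_ ?_ ?_ ?_
    · simp only [Polynomial.degree_prod, Polynomial.degree_X_sub_C]
      simp
    · simp only [Polynomial.degree_prod, Polynomial.degree_X_sub_C]
    · rw [(Polynomial.monic_prod_X_sub_C e _).leadingCoeff,
        (Polynomial.monic_prod_X_sub_C e' _).leadingCoeff]
    · intro x hx
      simp only [Finset.mem_map, Finset.mem_range, Function.Embedding.coeFn_mk] at hx
      obtain ⟨t, ht, rfl⟩ := hx
      simpa [Polynomial.eval_prod] using h t ht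
  have hroots : (Finset.range k).val.map e = (Finset.range k).val.map e' := by
    have h1 := Polynomial.roots_multiset_prod_X_sub_C ((Finset.range k).val.map e)
    have h2 := Polynomial.roots_multiset_prod_X_sub_C ((Finset.range k).val.map e')
    rw [Multiset.map_map] at h1 h2
    rw [← h1, ← h2]
    exact congrArg Polynomial.roots hpoly
  have hperm : ((List.range k).map e).Perm ((List.range k).map e') := Multiset.coe_eq_coe.1 hroots
  have hsorted : ∀ f : ℕ → ℤ, (∀ m, m + 1 < k → f (m + 1) ≤ f m) →
      ((List.range k).map f).Pairwise (· ≥ ·) := by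
    intro f hf
    rw [List.pairwise_map]
    refine List.Pairwise.imp_of_mem (R := (· < ·)) ?_ List.pairwise_lt_range
    intro a b _ hb hab
    rw [List.mem_range] at hb
    induction b, hab using Nat.le_induction with
    | base => exact hf a hb
    | succ n hn ih => exact (hf n hb).trans (ih (by omega))
  have := hperm.eq_of_pairwise' (hsorted e he) (hsorted e' he')
  intro m hm
  rw [List.map_inj_left] at this
  exact this m (List.mem_range.2 hm)

end Indicial

/-! ### Holomorphic families of triangular bases -/

section FamilyChains

variable {X : Type*} [TopologicalSpace X] [ReducedComplexSpace X] {μ : ℂ} {N k : ℕ}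

theorem Chain.congr_exponents {φ : XiSpace N} {d d' : ℕ → ℕ} {ψ : ℕ → XiSpace N} {V : ℕ → ℂ⟦X⟧}
    (C : Chain μ k φ d ψ V) (h : ∀ j < k, d j = d' j) : Chain μ k φ d' ψ V where
  le := C.le
  supp := C.supp
  top j hj := by rw [← h j hj]; exact C.top j hj
  unit := C.unit
  gen := C.gen
  step j hj := by rw [← h j hj]; exact C.step j hj

/-- The exponents of the members of a thematic family are locally constant. -/
theorem IsThematic.eventually_exponents_eq {U : Set X} (hU : IsOpen U) {φ : X → XiSpace N}
    (hφ : IsThematic U μ N k φ) {d : X → ℕ → ℕ} {ψ : X → ℕ → XiSpace N} {V : X → ℕ → ℂ⟦X⟧}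
    (C : ∀ x ∈ U, Chain μ k (φ x) (d x) (ψ x) (V x)) {x₀ : X} (hx₀ : x₀ ∈ U) :
    ∀ᶠ x in 𝓝 x₀, x ∈ U ∧ ∀ j < k, d x j = d x₀ j := by
  obtain ⟨-, hi, S, hS, hrel⟩ := hφ
  have key : ∀ t < k, ∀ᶠ x in 𝓝 x₀, x ∈ U ∧
      ∏ i ∈ Finset.range k, ((t : ℤ) - (d x (k - 1 - i) - i)) =
      ∏ i ∈ Finset.range k, ((t : ℤ) - (d x₀ (k - 1 - i) - i)) := by
    intro t _
    -- This is the indicial polynomial evaluated at `μ + t`. It is holomorphic with integer values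
    -- on `U`, so near `x₀`, where it varies by less than `1`, it is constant.
    set F : X → ℂ := fun x => (ascPochhammer ℂ k).eval (μ + t) - ∑ j : Fin k,
      PowerSeries.coeff (k - j) (S j x) * (ascPochhammer ℂ j).eval (μ + t) with hF
    have hFU : ∀ x ∈ U, F x = ((∏ i ∈ Finset.range k, ((t : ℤ) - (d x (k - 1 - i) - i)) : ℤ) : ℂ) := by
      intro x hx
      rw [hF]
      dsimp only
      rw [(C x hx).indicial (hi x hx) (hrel x hx)]
      push_cast
      exact Finset.prod_congr rfl fun i _ => by ring
    have hFc : ContinuousAt F x₀ := by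
      have : HolOn U F := (HolOn.const _).sub (HolOn.sum fun j _ => (hS j _).mul (HolOn.const _))
      exact HolAt.continuousAt (this x₀ hx₀)
    have hnear := hFc.eventually (Metric.ball_mem_nhds (F x₀) one_pos)
    filter_upwards [hU.mem_nhds hx₀, hnear] with x hx hd
    refine ⟨hx, ?_⟩
    rw [hFU x hx, hFU x₀ hx₀, dist_eq_norm, ← Int.cast_sub, Complex.norm_intCast,
      ← Int.cast_abs] at hd
    rw [← Int.cast_one (R := ℝ), Int.cast_lt, Int.abs_lt_one_iff] at hd
    exact sub_eq_zero.1 hd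
  have hall : ∀ᶠ x in 𝓝 x₀, ∀ t ∈ Finset.range k, x ∈ U ∧
      ∏ i ∈ Finset.range k, ((t : ℤ) - (d x (k - 1 - i) - i)) =
      ∏ i ∈ Finset.range k, ((t : ℤ) - (d x₀ (k - 1 - i) - i)) :=
    (Filter.eventually_all_finset _).2 fun t ht => key t (Finset.mem_range.1 ht)
  filter_upwards [hU.mem_nhds hx₀, hall] with x hx h
  -- The inequality `d j ≤ d (j + 1) + 1` says that the roots, shifted by `μ`, are already listed in
  -- decreasing order; their multiset therefore determines each exponent.
  have hanti : ∀ y ∈ U, ∀ m, m + 1 < k →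
      ((d y (k - 1 - (m + 1)) : ℤ) - (m + 1 : ℕ)) ≤ (d y (k - 1 - m) : ℤ) - m := by
    intro y hy m hm
    have := (C y hy).exponent_le (j := k - 1 - (m + 1)) (by omega)
    rw [show k - 1 - (m + 1) + 1 = k - 1 - m by omega] at this
    omega
  have := antitone_eq_of_prod_eq (e := fun i => (d x (k - 1 - i) : ℤ) - i)
    (e' := fun i => (d x₀ (k - 1 - i) : ℤ) - i) (hanti x hx) (hanti x₀ hx₀)
    (fun t ht => (h t (Finset.mem_range.2 ht)).2)
  refine ⟨hx, fun j hj => ?_⟩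
  have := this (k - 1 - j) (by omega)
  rw [show k - 1 - (k - 1 - j) = j by omega] at this
  omega

variable {W : Set X}

/-- The unit is coordinate `l` of `g` divided by `X ^ n`. The power `n` must not depend on the
point, which is why constancy of the exponents is needed first. -/
theorem HolMap.of_eq_unit_smul (hW : IsOpen W) {g χ : X → XiSpace N} {u : X → ℂ⟦X⟧} {l n : ℕ}
    (hg : HolMap W g) (e : ∀ x ∈ W, g x = u x • χ x)
    (hχ : ∀ x ∈ W, cf (χ x) l = PowerSeries.X ^ n) (hu : ∀ x ∈ W, PowerSeries.coeff 0 (u x) ≠ 0) :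
    HolSeriesOn W u ∧ HolMap W χ := by
  have h1 : HolSeriesOn W u := by
    refine ((hg l).divXPow n).congr hW fun x hx => ?_
    ext m
    rw [PowerSeries.coeff_mk, e x hx, cf_smul, hχ x hx, PowerSeries.coeff_mul_X_pow]
  refine ⟨h1, (HolMap.smul (h1.inv hu) hg).congr hW fun x hx => ?_⟩
  rw [e x hx, smul_smul, PowerSeries.inv_mul_cancel _ (by simpa using hu x hx), one_smul]

variable {φ : X → XiSpace N} {d : ℕ → ℕ} {ψ : X → ℕ → XiSpace N} {V : X → ℕ → ℂ⟦X⟧}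

/-- Starting from `φ = V k • ψ k`, each application of `step` yields the next product `V j • ψ j`.
The unit `V 0` multiplies `ψ 0 = 0`, so the recursion does not control it. -/
theorem holMap_chain (hW : IsOpen W) (hφ : HolMap W φ)
    (C : ∀ x ∈ W, Chain μ k (φ x) d (ψ x) (V x)) {j : ℕ} (hj : j ≤ k) :
    HolMap W (fun x => ψ x j) ∧ (1 ≤ j → HolSeriesOn W fun x => V x j) := by
  have key : ∀ j ≤ k, HolMap W (fun x => V x j • ψ x j) →
      HolMap W (fun x => ψ x j) ∧ (1 ≤ j → HolSeriesOn W fun x => V x j) := by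
    intro j hj h
    cases j with
    | zero =>
      refine ⟨(HolMap.const 0).congr hW fun x hx => ?_, by omega⟩
      rw [(C x hx).psi_zero]
    | succ j =>
      have := HolMap.of_eq_unit_smul (l := j) (n := d j) (χ := fun x => ψ x (j + 1))
        (u := fun x => V x (j + 1)) hW h (fun x _ => rfl)
        (fun x hx => (C x hx).top j hj) (fun x hx => (C x hx).unit _ hj)
      exact ⟨this.2, fun _ => this.1⟩
  induction hj using Nat.decreasingInduction with
  | self => exact key k le_rfl (hφ.congr hW fun x hx => (C x hx).gen)
  | of_succ j hj ih =>
    refine key j hj.le (HolMap.congr ((ih.1.a μ).sub (HolMap.smul_complex (HolOn.const (μ + d j))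
      (HolMap.smul (HolSeriesOn.const PowerSeries.X) ih.1))) hW fun x hx => ?_)
    exact (C x hx).step j hj

/-- `f` is a combination of `φ, a φ, …, a^(m-1) φ` with coefficients holomorphic on `W`. -/
def HolComb (W : Set X) (μ : ℂ) (φ : X → XiSpace N) (m : ℕ) (f : X → XiSpace N) : Prop :=
  ∃ S : ℕ → X → ℂ⟦X⟧, (∀ j, HolSeriesOn W (S j)) ∧
    ∀ x ∈ W, f x = ∑ j ∈ Finset.range m, S j x • ((Xi μ N).a ^ j) (φ x)

namespace HolComb

variable {m : ℕ} {f g : X → XiSpace N}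

theorem congr (h : HolComb W μ φ m f) (e : ∀ x ∈ W, f x = g x) : HolComb W μ φ m g := by
  obtain ⟨S, hS, hf⟩ := h
  exact ⟨S, hS, fun x hx => (e x hx).symm.trans (hf x hx)⟩

theorem zero : HolComb W μ φ m fun _ => 0 :=
  ⟨fun _ _ => 0, fun _ => HolSeriesOn.const 0, fun x _ => by simp⟩

theorem add (hf : HolComb W μ φ m f) (hg : HolComb W μ φ m g) :
    HolComb W μ φ m fun x => f x + g x := by
  obtain ⟨S, hS, hf⟩ := hf
  obtain ⟨T, hT, hg⟩ := hg
  refine ⟨fun j x => S j x + T j x, fun j => (hS j).add (hT j), fun x hx => ?_⟩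
  simp only [hf x hx, hg x hx, add_smul, Finset.sum_add_distrib]

theorem smul {P : X → ℂ⟦X⟧} (hP : HolSeriesOn W P) (hf : HolComb W μ φ m f) :
    HolComb W μ φ m fun x => P x • f x := by
  obtain ⟨S, hS, hf⟩ := hf
  refine ⟨fun j x => P x * S j x, fun j => hP.mul (hS j), fun x hx => ?_⟩
  simp only [hf x hx, Finset.smul_sum, smul_smul]

theorem mono {n : ℕ} (hmn : m ≤ n) (hf : HolComb W μ φ m f) : HolComb W μ φ n f := by
  classical
  obtain ⟨S, hS, hf⟩ := hf
  refine ⟨fun j x => if j < m then S j x else 0, fun j => ?_, fun x hx => ?_⟩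
  · dsimp only
    split_ifs
    · exact hS j
    · exact HolSeriesOn.const 0
  · rw [hf x hx]
    refine Finset.sum_subset_zero_on_sdiff (Finset.range_mono hmn) (fun j hj => ?_)
      (fun j hj => ?_)
    · simp only [Finset.mem_sdiff, Finset.mem_range] at hj
      simp only [if_neg hj.2, zero_smul]
    · simp only [if_pos (Finset.mem_range.1 hj)]

theorem a (hf : HolComb W μ φ m f) : HolComb W μ φ (m + 1) fun x => (Xi μ N).a (f x) := by
  obtain ⟨S, hS, hf⟩ := hf
  have h1 : HolComb W μ φ (m + 1) fun x =>
      ∑ j ∈ Finset.range m, S j x • ((Xi μ N).a ^ (j + 1)) (φ x) := by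
    refine ⟨fun j x => if j = 0 then 0 else S (j - 1) x, fun j => ?_, fun x _ => ?_⟩
    · dsimp only
      split_ifs
      · exact HolSeriesOn.const 0
      · exact hS _
    · rw [Finset.sum_range_succ']
      simp
  have h2 : HolComb W μ φ m fun x => ∑ j ∈ Finset.range m,
      (PowerSeries.X ^ 2 * PowerSeries.derivative ℂ (S j x)) • ((Xi μ N).a ^ j) (φ x) :=
    ⟨fun j x => PowerSeries.X ^ 2 * PowerSeries.derivative ℂ (S j x),
      fun j => (HolSeriesOn.const _).mul (hS j).derivative, fun x _ => rfl⟩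
  refine (h1.add (h2.mono (Nat.le_succ m))).congr fun x hx => ?_
  rw [hf x hx, map_sum, ← Finset.sum_add_distrib]
  refine Finset.sum_congr rfl fun j _ => ?_
  rw [a_smul, pow_succ']
  rfl

theorem fin (hf : HolComb W μ φ m f) : ∃ S : Fin m → X → ℂ⟦X⟧, (∀ j, HolSeriesOn W (S j)) ∧
    ∀ x ∈ W, f x = ∑ j : Fin m, S j x • ((Xi μ N).a ^ (j : ℕ)) (φ x) := by
  obtain ⟨S, hS, hf⟩ := hf
  exact ⟨fun j => S j, fun j => hS j, fun x hx => by rw [hf x hx, Finset.sum_range]⟩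

end HolComb

/-- Each step down from `ψ k` costs one power of `a`, so `ψ j` needs only `φ, …, a ^ (k - j) φ`. -/
theorem holComb_chain (hW : IsOpen W) (hφ : HolMap W φ)
    (C : ∀ x ∈ W, Chain μ k (φ x) d (ψ x) (V x)) {j : ℕ} (hj : j ≤ k) (hj1 : 1 ≤ j) :
    HolComb W μ φ k fun x => ψ x j := by
  refine HolComb.mono (m := k - j + 1) (by omega) ?_
  have key : ∀ j ≤ k, 1 ≤ j → ∀ n, HolComb W μ φ n (fun x => V x j • ψ x j) →
      HolComb W μ φ n (fun x => ψ x j) := by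
    intro j hj hj1 n h
    refine (HolComb.smul (((holMap_chain hW hφ C hj).2 hj1).inv
      fun x hx => (C x hx).unit j hj) h).congr fun x hx => (C x hx).inv_smul_smul hj _
  induction hj using Nat.decreasingInduction with
  | self =>
    refine key k le_rfl hj1 _ ⟨fun _ _ => 1, fun _ => HolSeriesOn.const 1, fun x hx => ?_⟩
    simp [(C x hx).gen.symm]
  | of_succ j hj ih =>
    specialize ih (by omega)
    rw [show k - j + 1 = k - (j + 1) + 1 + 1 by omega]
    refine key j hj.le hj1 _ ?_
    have h2 := (ih.smul (P := fun _ => PowerSeries.C (-(μ + d j)) * PowerSeries.X)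
      (HolSeriesOn.const _)).mono (Nat.le_succ _)
    refine (ih.a.add h2).congr fun x hx => ?_
    rw [← (C x hx).step j hj, sub_eq_add_neg, mul_smul, ← neg_smul]
    congr 1
    exact algebraMap_smul ℂ⟦X⟧ (-(μ + d j)) (PowerSeries.X • ψ x (j + 1))

/-- A holomorphic map with values in the themes is a holomorphic section of the family. -/
theorem holComb_of_mem_generated (hW : IsOpen W) (hφ : HolMap W φ)
    (C : ∀ x ∈ W, Chain μ k (φ x) d (ψ x) (V x)) {f : X → XiSpace N} (hf : HolMap W f)
    (hmem : ∀ x ∈ W, f x ∈ generated μ N (φ x)) : HolComb W μ φ k f := by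
  have key : ∀ j ≤ k, ∀ f : X → XiSpace N, HolMap W f → (∀ x ∈ W, f x ∈ flag (ψ x) j) →
      HolComb W μ φ k f := by
    intro j
    induction j with
    | zero =>
      intro hj f hf hm
      refine HolComb.zero.congr fun x hx => ?_
      exact (supp_zero_iff.1 ((C x hx).supp_of_mem_flag hj (hm x hx))).symm
    | succ j ih =>
      intro hj f hf hm
      set P : X → ℂ⟦X⟧ := fun x =>
        PowerSeries.mk fun n => PowerSeries.coeff (n + d j) (cf (f x) j) with hP
      have hPh : HolSeriesOn W P := (hf j).divXPow (d j)
      have hψ := (holMap_chain hW hφ C hj).1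
      have hrest := ih (by omega) (fun x => f x - P x • ψ x (j + 1)) (hf.sub (HolMap.smul hPh hψ))
        (fun x hx => by
          obtain ⟨Q, g, hg, e⟩ := mem_flag_succ.1 (hm x hx)
          have hPQ : P x = Q := by
            ext n
            rw [hP, PowerSeries.coeff_mk, e, (C x hx).cf_of_mem_flag_succ hj hg,
              PowerSeries.coeff_mul_X_pow]
          rw [hPQ, e, add_sub_cancel_left]
          exact hg)
      refine (hrest.add ((holComb_chain hW hφ C hj (by omega)).smul hPh)).congr fun x hx => ?_
      exact sub_add_cancel _ _
  refine key k le_rfl f hf fun x hx => ?_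
  rw [← (C x hx).generated_eq]
  exact hmem x hx

theorem pow_a_mem_generated (φ : XiSpace N) (n : ℕ) : ((Xi μ N).a ^ n) φ ∈ generated μ N φ :=
  Submodule.subset_span ⟨n, rfl⟩

/-- A holomorphic family of cyclic vectors with constant exponents is thematic. -/
theorem isThematic_of_chain (hW : IsOpen W) (hφ : HolMap W φ)
    (C : ∀ x ∈ W, Chain μ k (φ x) d (ψ x) (V x)) : IsThematic W μ N k φ := by
  refine ⟨holMap_iff.1 hφ, fun x hx => ?_, ?_⟩
  · rw [linearIndependent_iff_injective_fintypeLinearCombination]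
    set b : Fin k → XiSpace N := fun j => ((Xi μ N).a ^ (j : ℕ)) (φ x) with hb
    have hbm : ∀ P, Fintype.linearCombination ℂ⟦X⟧ b P ∈ flag (ψ x) k := by
      intro P
      rw [← (C x hx).generated_eq, Fintype.linearCombination_apply]
      exact sum_mem fun j _ => Submodule.smul_mem _ _ (pow_a_mem_generated _ _)
    have hfl : flag (ψ x) k ≤ LinearMap.range (Fintype.linearCombination ℂ⟦X⟧ b) := by
      refine Submodule.span_le.2 ?_
      rintro _ ⟨j, hj, rfl⟩
      have hj : j ≤ k := hj
      rcases Nat.eq_zero_or_pos j with rfl | hj1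
      · rw [(C x hx).psi_zero]; exact zero_mem _
      · obtain ⟨S, -, hS⟩ := (holComb_chain hW hφ C hj hj1).fin
        refine ⟨fun l => S l x, ?_⟩
        rw [hS x hx, Fintype.linearCombination_apply]
    set T := Fintype.linearCombination ℂ⟦X⟧ (fun l : Fin k => ψ x (l + 1)) with hT
    have hTinj : Function.Injective T :=
      linearIndependent_iff_injective_fintypeLinearCombination.1 ((C x hx).linearIndependent le_rfl)
    have hTr : LinearMap.range T = flag (ψ x) k := by
      rw [hT, Fintype.range_linearCombination, (C x hx).span_eq_flag]
    have hTm : ∀ P, T P ∈ flag (ψ x) k := fun P => hTr ▸ LinearMap.mem_range_self T P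
    have hsurj : Function.Surjective ((Fintype.linearCombination ℂ⟦X⟧ b).codRestrict _ hbm) := by
      rintro ⟨f, hf⟩
      obtain ⟨P, hP⟩ := hfl hf
      exact ⟨P, Subtype.ext hP⟩
    -- The `k` vectors `a ^ j φ` generate a free module of rank `k`; a surjection of this kind is
    -- injective.
    have : Module.Finite ℂ⟦X⟧ (flag (ψ x) k) := Module.Finite.of_surjective _ hsurj
    have := OrzechProperty.injective_of_surjective_of_injective (T.codRestrict _ hTm) _
      (fun P Q h => hTinj (congrArg Subtype.val h)) hsurj
    exact fun P Q h => this (Subtype.ext h)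
  · exact (holComb_of_mem_generated hW hφ C (hφ.pow_a μ k)
      fun x _ => pow_a_mem_generated _ _).fin

/-- The holomorphic sections of the family are the holomorphic maps with values in the themes. -/
theorem exists_holSeries_iff (hW : IsOpen W) (hφ : HolMap W φ)
    (C : ∀ x ∈ W, Chain μ k (φ x) d (ψ x) (V x)) {f : X → XiSpace N}
    (hmem : ∀ x ∈ W, f x ∈ generated μ N (φ x)) {x : X} (hx : x ∈ W) :
    (∃ (W' : Set X) (S : Fin k → X → ℂ⟦X⟧), IsOpen W' ∧ x ∈ W' ∧ (∀ j, HolSeriesOn W' (S j)) ∧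
      ∀ y ∈ W', f y = ∑ j : Fin k, S j y • ((Xi μ N).a ^ (j : ℕ)) (φ y)) ↔
    ∃ W' ⊆ W, IsOpen W' ∧ x ∈ W' ∧ HolMap W' f := by
  constructor
  · rintro ⟨W', S, hW', hxW', hS, hf⟩
    refine ⟨W' ∩ W, Set.inter_subset_right, hW'.inter hW, ⟨hxW', hx⟩, ?_⟩
    refine HolMap.congr (HolMap.sum fun j _ => HolMap.smul
      ((hS j).mono Set.inter_subset_left) ((hφ.mono Set.inter_subset_right).pow_a μ j))
      (hW'.inter hW) fun y hy => (hf y hy.1).symm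
  · rintro ⟨W', hW'W, hW', hxW', hf⟩
    obtain ⟨S, hS, hfS⟩ := (holComb_of_mem_generated hW' (hφ.mono hW'W)
      (fun y hy => C y (hW'W hy)) hf (fun y hy => hmem y (hW'W hy))).fin
    exact ⟨W', S, hW', hxW', hS, hfS⟩

end FamilyChains

/-! ### The `b`-adic filtration and power series in an operator -/

section Filtration

variable {N : ℕ}

/-- `f ∈ b^n Ξ`. -/
def HasOrd (n : ℕ) (f : XiSpace N) : Prop := ∀ l, PowerSeries.X ^ n ∣ cf f l

theorem ord_iff {n : ℕ} {f : XiSpace N} :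
    HasOrd n f ↔ ∀ l m, m < n → PowerSeries.coeff m (cf f l) = 0 := by
  simp only [HasOrd, PowerSeries.X_pow_dvd_iff]

theorem ord_zero (f : XiSpace N) : HasOrd 0 f := fun l => by simp

theorem HasOrd.mono {m n : ℕ} {f : XiSpace N} (h : HasOrd n f) (hmn : m ≤ n) : HasOrd m f :=
  fun l => (pow_dvd_pow _ hmn).trans (h l)

theorem HasOrd.add {n : ℕ} {f g : XiSpace N} (hf : HasOrd n f) (hg : HasOrd n g) : HasOrd n (f + g) :=
  fun l => by rw [cf_add]; exact dvd_add (hf l) (hg l)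

theorem HasOrd.sub {n : ℕ} {f g : XiSpace N} (hf : HasOrd n f) (hg : HasOrd n g) : HasOrd n (f - g) :=
  fun l => by rw [cf_sub]; exact dvd_sub (hf l) (hg l)

theorem HasOrd.smul_complex {n : ℕ} {f : XiSpace N} (c : ℂ) (hf : HasOrd n f) : HasOrd n (c • f) :=
  fun l => by rw [cf_smul_complex, PowerSeries.smul_eq_C_mul]; exact (hf l).mul_left _

theorem HasOrd.sum {ι : Type*} {s : Finset ι} {n : ℕ} {f : ι → XiSpace N}
    (hf : ∀ i ∈ s, HasOrd n (f i)) : HasOrd n (∑ i ∈ s, f i) :=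
  fun l => by rw [cf_sum]; exact Finset.dvd_sum fun i hi => hf i hi l

theorem HasOrd.X_smul {n : ℕ} {f : XiSpace N} (hf : HasOrd n f) :
    HasOrd (n + 1) ((PowerSeries.X : ℂ⟦X⟧) • f) :=
  fun l => by rw [cf_smul, pow_succ']; exact mul_dvd_mul_left _ (hf l)

theorem HasOrd.exists_eq_smul {n : ℕ} {f : XiSpace N} (hf : HasOrd n f) :
    ∃ g : XiSpace N, f = (PowerSeries.X ^ n : ℂ⟦X⟧) • g := by
  have : ∀ j : Fin (N + 1), ∃ P, f j = PowerSeries.X ^ n * P := fun j => by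
    rw [← cf_fin f]; exact hf j
  choose g hg using this
  exact ⟨g, funext hg⟩

theorem HasOrd.a {μ : ℂ} {n : ℕ} {f : XiSpace N} (hf : HasOrd n f) : HasOrd (n + 1) ((Xi μ N).a f) := by
  rw [ord_iff] at *
  intro l m hm
  rw [cf_a, map_add]
  cases m with
  | zero => rw [coeff_zero_eulerOp]; simp
  | succ m =>
    rw [coeff_succ_eulerOp, PowerSeries.coeff_succ_X_mul, hf l m (by omega),
      hf (l + 1) m (by omega)]
    simp

theorem eq_zero_of_ord {f : XiSpace N} (h : ∀ n, HasOrd n f) : f = 0 := by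
  refine cf_ext fun l => ?_
  ext m
  rw [ord_iff.1 (h (m + 1)) l m (Nat.lt_succ_self m)]
  simp

theorem eq_of_ord {f g : XiSpace N} (h : ∀ n, HasOrd n (f - g)) : f = g :=
  sub_eq_zero.1 (eq_zero_of_ord h)

/-- The operator preserves the `b`-adic filtration. -/
def IsFiltered (Q : Module.End ℂ (XiSpace N)) : Prop := ∀ n f, HasOrd n f → HasOrd n (Q f)

/-- The operator is topologically nilpotent: it maps `b^n Ξ` to `b^(n+1) Ξ`. -/
def IsRaising (B : Module.End ℂ (XiSpace N)) : Prop := ∀ n f, HasOrd n f → HasOrd (n + 1) (B f)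

theorem isRaising_a (μ : ℂ) : IsRaising (Xi μ N).a := fun _ _ h => h.a

theorem IsRaising.isFiltered {B : Module.End ℂ (XiSpace N)} (hB : IsRaising B) : IsFiltered B :=
  fun n f h => (hB n f h).mono (Nat.le_succ n)

theorem IsRaising.pow {B : Module.End ℂ (XiSpace N)} (hB : IsRaising B) (i : ℕ) {n : ℕ}
    {f : XiSpace N} (h : HasOrd n f) : HasOrd (n + i) ((B ^ i) f) := by
  induction i with
  | zero => simpa using h
  | succ i ih => rw [pow_succ']; exact hB _ _ ih

/-- The operator `T(B) = ∑ₙ Tₙ Bⁿ`, for `B` topologically nilpotent. -/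
noncomputable def evalOp (B : Module.End ℂ (XiSpace N)) (T : ℂ⟦X⟧) :
    Module.End ℂ (XiSpace N) where
  -- Truncation at `i ≤ m` loses nothing when `B` is raising: `B ^ i` then has no coefficient below
  -- degree `i`.
  toFun f j := PowerSeries.mk fun m => ∑ i ∈ Finset.range (m + 1),
    PowerSeries.coeff i T * PowerSeries.coeff m ((B ^ i) f j)
  map_add' f g := by
    funext j
    ext m
    simp [mul_add, Finset.sum_add_distrib]
  map_smul' c f := by
    funext j
    ext m
    simp only [map_smul, Pi.smul_apply, PowerSeries.coeff_mk, smul_eq_mul, RingHom.id_apply,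
      Finset.mul_sum]
    exact Finset.sum_congr rfl fun i _ => by ring

theorem coeff_cf_evalOp (B : Module.End ℂ (XiSpace N)) (T : ℂ⟦X⟧) (f : XiSpace N) (l m : ℕ) :
    PowerSeries.coeff m (cf (evalOp B T f) l) = ∑ i ∈ Finset.range (m + 1),
      PowerSeries.coeff i T * PowerSeries.coeff m (cf ((B ^ i) f) l) := by
  by_cases h : l < N + 1
  · simp [cf, h, evalOp]
  · simp [cf, h]

variable {B : Module.End ℂ (XiSpace N)}

theorem evalOp_spec (hB : IsRaising B) (T : ℂ⟦X⟧) (n : ℕ) (f : XiSpace N) :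
    HasOrd n (evalOp B T f - ∑ i ∈ Finset.range n, PowerSeries.coeff i T • (B ^ i) f) := by
  rw [ord_iff]
  intro l m hm
  rw [cf_sub, map_sub, coeff_cf_evalOp, cf_sum, map_sum, sub_eq_zero]
  refine Finset.sum_subset_zero_on_sdiff (Finset.range_mono hm) (fun i hi => ?_) fun i _ => by
    rw [cf_smul_complex, map_smul, smul_eq_mul]
  simp only [Finset.mem_sdiff, Finset.mem_range] at hi
  have := ord_iff.1 (hB.pow i (ord_zero f)) l m (by omega)
  rw [cf_smul_complex, map_smul, this, smul_zero]

/-- By separatedness, the approximation property characterizes `T(B) f`; it reduces operator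
identities for `T(B)` to identities for the powers of `B`. -/
theorem eq_evalOp (hB : IsRaising B) {T : ℂ⟦X⟧} {f g : XiSpace N} (h : ∀ n,
    HasOrd n (g - ∑ i ∈ Finset.range n, PowerSeries.coeff i T • (B ^ i) f)) : g = evalOp B T f :=
  eq_of_ord fun n => by simpa using (h n).sub (evalOp_spec hB T n f)

theorem isFiltered_evalOp (hB : IsRaising B) (T : ℂ⟦X⟧) : IsFiltered (evalOp B T) := by
  intro n f hf
  have := (evalOp_spec hB T n f).add (HasOrd.sum (s := Finset.range n) (n := n)
    (f := fun i => PowerSeries.coeff i T • (B ^ i) f)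
    fun i _ => ((hB.pow i hf).mono (Nat.le_add_right n i)).smul_complex _)
  simpa using this

theorem evalOp_commute (hB : IsRaising B) {Q : Module.End ℂ (XiSpace N)} (hQ : IsFiltered Q)
    (hQB : Commute Q B) (T : ℂ⟦X⟧) : Commute Q (evalOp B T) := by
  refine LinearMap.ext fun f => ?_
  refine eq_evalOp hB fun n => ?_
  have := hQ n _ (evalOp_spec hB T n f)
  rw [map_sub, map_sum] at this
  have e : ∀ i, Q ((B ^ i) f) = (B ^ i) (Q f) := fun i => LinearMap.congr_fun (hQB.pow_right i).eq f
  simp only [map_smul, e] at this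
  exact this

theorem evalOp_X_mul (hB : IsRaising B) (T : ℂ⟦X⟧) (f : XiSpace N) :
    evalOp B (PowerSeries.X * T) f = B (evalOp B T f) := by
  symm
  refine eq_evalOp hB fun n => ?_
  cases n with
  | zero => exact ord_zero _
  | succ n =>
    have := hB n _ (evalOp_spec hB T n f)
    rw [map_sub, map_sum] at this
    rw [Finset.sum_range_succ']
    simp only [PowerSeries.coeff_succ_X_mul, PowerSeries.coeff_zero_X_mul, zero_smul, add_zero,
      pow_succ', Module.End.mul_apply]
    simpa only [map_smul] using this

theorem evalOp_add (S T : ℂ⟦X⟧) (f : XiSpace N) :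
    evalOp B (S + T) f = evalOp B S f + evalOp B T f := by
  refine cf_ext fun l => ?_
  ext m
  simp only [cf_add, map_add, coeff_cf_evalOp, add_mul, Finset.sum_add_distrib]

theorem evalOp_smul (c : ℂ) (T : ℂ⟦X⟧) (f : XiSpace N) :
    evalOp B (c • T) f = c • evalOp B T f := by
  refine cf_ext fun l => ?_
  ext m
  simp only [cf_smul_complex, map_smul, coeff_cf_evalOp, smul_eq_mul, mul_assoc, Finset.mul_sum]

theorem evalOp_zero (f : XiSpace N) : evalOp B 0 f = 0 := by
  simpa using evalOp_smul (B := B) 0 0 f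

theorem evalOp_C (hB : IsRaising B) (c : ℂ) (f : XiSpace N) :
    evalOp B (PowerSeries.C c) f = c • f := by
  symm
  refine eq_evalOp hB fun n => ?_
  cases n with
  | zero => exact ord_zero _
  | succ n =>
    rw [Finset.sum_range_succ']
    simp only [PowerSeries.coeff_succ_C, zero_smul, Finset.sum_const_zero, zero_add,
      PowerSeries.coeff_zero_C, pow_zero, Module.End.one_apply, sub_self]
    exact fun l => by simp

/-- Splitting off the constant term. -/
theorem evalOp_eq (hB : IsRaising B) (T : ℂ⟦X⟧) (f : XiSpace N) :
    evalOp B T f = PowerSeries.coeff 0 T • f +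
      B (evalOp B (PowerSeries.mk fun n => PowerSeries.coeff (n + 1) T) f) := by
  conv_lhs => rw [PowerSeries.eq_X_mul_shift_add_const T]
  rw [evalOp_add, evalOp_X_mul hB, evalOp_C hB, add_comm]
  simp

theorem supp_evalOp {j : ℕ} (hBs : ∀ f : XiSpace N, Supp j f → Supp j (B f)) (T : ℂ⟦X⟧)
    {f : XiSpace N} (hf : Supp j f) : Supp j (evalOp B T f) := by
  have hpow : ∀ i, Supp j ((B ^ i) f) := fun i => by
    induction i with
    | zero => simpa using hf
    | succ i ih => rw [pow_succ']; exact hBs _ ih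
  intro l hl
  ext m
  rw [coeff_cf_evalOp, map_zero]
  exact Finset.sum_eq_zero fun i _ => by rw [hpow i l hl, map_zero, mul_zero]

/-- If `a B - B a = B²`, then `a T(B) - T(B) a = B² T'(B)`. -/
theorem evalOp_commutator_left (hB : IsRaising B) {A : Module.End ℂ (XiSpace N)}
    (hA : IsFiltered A) (hAB : ∀ f, A (B f) = B (A f) + B (B f)) (T : ℂ⟦X⟧) (f : XiSpace N) :
    A (evalOp B T f) = evalOp B T (A f) +
      evalOp B (PowerSeries.X ^ 2 * PowerSeries.derivative ℂ T) f := by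
  have hpow : ∀ i : ℕ, A ((B ^ i) f) = (B ^ i) (A f) + (i : ℂ) • (B ^ (i + 1)) f := by
    intro i
    induction i with
    | zero => simp
    | succ i ih =>
      rw [pow_succ', Module.End.mul_apply, hAB, ih]
      simp only [pow_succ', Module.End.mul_apply, map_add, map_smul]
      push_cast
      module
  rw [← sub_eq_iff_eq_add]
  refine eq_evalOp hB fun n => ?_
  have h1 := hA n _ (evalOp_spec hB T n f)
  have h2 := (evalOp_spec hB (PowerSeries.X ^ 2 * PowerSeries.derivative ℂ T) (n + 1) f).mono
    (Nat.le_succ n)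
  have hc : ∀ i, PowerSeries.coeff (i + 1) (PowerSeries.X ^ 2 * PowerSeries.derivative ℂ T) =
      i * PowerSeries.coeff i T := by
    intro i
    rw [pow_two, mul_assoc, PowerSeries.coeff_succ_X_mul]
    cases i with
    | zero => simp
    | succ i => rw [PowerSeries.coeff_succ_X_mul, PowerSeries.coeff_derivative]; push_cast; ring
  have hc0 : PowerSeries.coeff 0 (PowerSeries.X ^ 2 * PowerSeries.derivative ℂ T) = 0 := by
    simp [pow_two, mul_assoc]
  rw [Finset.sum_range_succ', hc0] at h2
  simp only [hc] at h2
  rw [map_sub, map_sum] at h1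
  simp only [map_smul, hpow, smul_add, Finset.sum_add_distrib] at h1
  convert h1.sub h2 using 1
  simp only [smul_smul, mul_comm]
  module

/-- If `a b - b a = b²`, then `T(a) b - b T(a) = b T'(a) b`. -/
theorem evalOp_commutator_right (hB : IsRaising B) {b : Module.End ℂ (XiSpace N)}
    (hb : IsRaising b) (hBb : ∀ f, B (b f) = b (B f) + b (b f)) (T : ℂ⟦X⟧) (f : XiSpace N) :
    evalOp B T (b f) = b (evalOp B T f) + b (evalOp B (PowerSeries.derivative ℂ T) (b f)) := by
  have hpow : ∀ (i : ℕ) (f : XiSpace N), (B ^ (i + 1)) (b f) =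
      b ((B ^ (i + 1)) f) + ((i + 1 : ℕ) : ℂ) • b ((B ^ i) (b f)) := by
    intro i
    induction i with
    | zero => intro f; simp [hBb]
    | succ i ih =>
      intro f
      have e : (B ^ (i + 1)) (b f) = (B ^ i) (b (B f)) + (B ^ i) (b (b f)) := by
        rw [pow_succ, Module.End.mul_apply, hBb, map_add]
      rw [pow_succ B (i + 1), Module.End.mul_apply, Module.End.mul_apply, hBb, map_add, ih (B f),
        ih (b f), e, map_add]
      push_cast
      module
  symm
  refine eq_evalOp hB fun n => ?_
  cases n with
  | zero => exact ord_zero _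
  | succ n =>
    have h1 := (hb _ _ (evalOp_spec hB T (n + 1) f)).mono (Nat.le_succ _)
    have h2 := hb _ _ (evalOp_spec hB (PowerSeries.derivative ℂ T) n (b f))
    rw [Finset.sum_range_succ', map_sub, map_add, map_sum] at h1
    rw [map_sub, map_sum] at h2
    rw [Finset.sum_range_succ']
    simp only [hpow, smul_add, Finset.sum_add_distrib, pow_zero, Module.End.one_apply, map_smul]
      at h1 ⊢
    simp only [PowerSeries.coeff_derivative, map_smul] at h2
    convert h1.add h2 using 1
    simp only [smul_smul]
    push_cast
    module

end Filtration

/-! ### Change of variable on `Ξ_μ^{(N)}` -/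

section Solutions

variable {X : Type*} [TopologicalSpace X] [ReducedComplexSpace X] {N : ℕ}

/-- The family of operators maps holomorphic maps to holomorphic maps. -/
def HolPreserving (W : Set X) (Q : X → Module.End ℂ (XiSpace N)) : Prop :=
  ∀ f, HolMap W f → HolMap W fun x => Q x (f x)

theorem HolPreserving.pow {W : Set X} {Q : X → Module.End ℂ (XiSpace N)} (h : HolPreserving W Q)
    (n : ℕ) : HolPreserving W fun x => Q x ^ n := by
  induction n with
  | zero => exact fun f hf => by simpa using hf
  | succ n ih => exact fun f hf => by simpa only [pow_succ', Module.End.mul_apply] using h _ (ih f hf)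

theorem HolPreserving.evalOp {W : Set X} {Q : X → Module.End ℂ (XiSpace N)}
    (h : HolPreserving W Q) {T : X → ℂ⟦X⟧} (hT : HolSeriesOn W T) :
    HolPreserving W fun x => evalOp (Q x) (T x) := by
  intro f hf l m
  simp only [coeff_cf_evalOp]
  exact HolOn.sum fun i _ => (hT i).mul (h.pow i f hf l m)

/-- The coefficients of `b^k`, multiplied by `c`, moved to `b^n`. -/
noncomputable def monomialAt (n k : ℕ) (c : ℂ) (g : XiSpace N) : XiSpace N :=
  fun j => PowerSeries.C (c * PowerSeries.coeff k (g j)) * PowerSeries.X ^ n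

theorem cf_monomialAt (n k : ℕ) (c : ℂ) (g : XiSpace N) (l : ℕ) : cf (monomialAt n k c g) l =
    PowerSeries.C (c * PowerSeries.coeff k (cf g l)) * PowerSeries.X ^ n := by
  unfold cf
  split_ifs <;> simp [monomialAt]

theorem hasOrd_monomialAt (n k : ℕ) (c : ℂ) (g : XiSpace N) : HasOrd n (monomialAt n k c g) :=
  fun l => by rw [cf_monomialAt]; exact dvd_mul_left _ _

theorem HolMap.monomialAt {W : Set X} (n k : ℕ) {c : X → ℂ} {g : X → XiSpace N}
    (hc : HolOn W c) (hg : HolMap W g) : HolMap W fun x => monomialAt n k (c x) (g x) := by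
  intro l m
  simp only [cf_monomialAt, PowerSeries.coeff_C_mul]
  exact (hc.mul (hg l k)).mul (HolOn.const _)

/-- The nonzero factor `c n` forces the leading coefficient of a kernel element to vanish in each
degree successively. -/
theorem eq_zero_of_leading {Q : Module.End ℂ (XiSpace N)} {s n₀ : ℕ} {c : ℕ → ℂ}
    (hlead : ∀ n f, HasOrd n f → ∀ l, PowerSeries.coeff (n + s) (cf (Q f) l) =
      c n * PowerSeries.coeff n (cf f l))
    (hc : ∀ n, n₀ ≤ n → c n ≠ 0) {f : XiSpace N} (hf : HasOrd n₀ f) (h : Q f = 0) : f = 0 := by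
  have key : ∀ m, HasOrd (n₀ + m) f := by
    intro m
    induction m with
    | zero => exact hf
    | succ m ih =>
      rw [ord_iff]
      intro l i hi
      rcases (by omega : i < n₀ + m ∨ i = n₀ + m) with hi | rfl
      · exact ord_iff.1 ih l i hi
      · have := hlead _ f ih l
        rw [h, cf_zero, map_zero, zero_eq_mul] at this
        exact this.resolve_left (hc _ (Nat.le_add_right _ _))
  exact eq_zero_of_ord fun n => (key n).mono (Nat.le_add_left _ _)

/-- Linear equations `Q f = t`, for an operator `Q` which has degree `s` for the `b`-adic
filtration and whose leading part is invertible, have holomorphic solutions. -/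
theorem exists_solution {W : Set X} {Q : X → Module.End ℂ (XiSpace N)} {s n₀ : ℕ}
    {c : X → ℕ → ℂ} (hQ : HolPreserving W Q)
    (hord : ∀ x ∈ W, ∀ n f, HasOrd n f → HasOrd (n + s) (Q x f))
    (hlead : ∀ x ∈ W, ∀ n f, HasOrd n f → ∀ l, PowerSeries.coeff (n + s) (cf (Q x f) l) =
      c x n * PowerSeries.coeff n (cf f l))
    (hc : ∀ n, HolOn W fun x => c x n) (hc0 : ∀ x ∈ W, ∀ n, n₀ ≤ n → c x n ≠ 0)
    {t : X → XiSpace N} (ht : HolMap W t) (hto : ∀ x ∈ W, HasOrd (n₀ + s) (t x)) :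
    ∃ f, HolMap W f ∧ ∀ x ∈ W, HasOrd n₀ (f x) ∧ Q x (f x) = t x := by
  -- Successive approximation: the `m`-th correction sits in degree `n₀ + m` and cancels the
  -- remainder in degree `n₀ + m + s`.
  let P : ℕ → X → XiSpace N := fun m => Nat.rec (fun _ => 0)
    (fun m p x => p x + monomialAt (n₀ + m) (n₀ + m + s) (c x (n₀ + m))⁻¹ (t x - Q x (p x))) m
  have hPsucc : ∀ m x, P (m + 1) x = P m x +
      monomialAt (n₀ + m) (n₀ + m + s) (c x (n₀ + m))⁻¹ (t x - Q x (P m x)) := fun m x => rfl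
  have hPhol : ∀ m, HolMap W (P m) := by
    intro m
    induction m with
    | zero => exact HolMap.const 0
    | succ m ih =>
      exact ih.add (HolMap.monomialAt _ _ ((hc _).inv fun x hx => hc0 x hx _ (Nat.le_add_right _ _))
        (ht.sub (hQ _ ih)))
  have hPrem : ∀ x ∈ W, ∀ m, HasOrd (n₀ + m + s) (t x - Q x (P m x)) := by
    intro x hx m
    induction m with
    | zero => simpa [P] using hto x hx
    | succ m ih =>
      rw [hPsucc, map_add, ← sub_sub, ord_iff]
      set δ := monomialAt (n₀ + m) (n₀ + m + s) (c x (n₀ + m))⁻¹ (t x - Q x (P m x)) with hδ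
      have hδo : HasOrd (n₀ + m) δ := hasOrd_monomialAt _ _ _ _
      intro l i hi
      rcases (by omega : i < n₀ + m + s ∨ i = n₀ + m + s) with hi | rfl
      · exact ord_iff.1 (ih.sub (hord x hx _ _ hδo)) l i hi
      · rw [cf_sub, map_sub, hlead x hx _ _ hδo, hδ, cf_monomialAt, PowerSeries.coeff_C_mul_X_pow,
          if_pos rfl, mul_inv_cancel_left₀ (hc0 x hx _ (Nat.le_add_right _ _)), sub_self]
  have hPstable : ∀ x m n, m ≤ n → HasOrd (n₀ + m) (P n x - P m x) := by
    intro x m n hmn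
    induction n, hmn using Nat.le_induction with
    | base => rw [sub_self]; exact fun l => by simp
    | succ n hn ih =>
      rw [hPsucc, add_sub_right_comm]
      exact ih.add ((hasOrd_monomialAt _ _ _ _).mono (by omega))
  set f : X → XiSpace N := fun x j => PowerSeries.mk fun n => PowerSeries.coeff n (P (n + 1) x j)
    with hf
  have hcf : ∀ x l n, PowerSeries.coeff n (cf (f x) l) =
      PowerSeries.coeff n (cf (P (n + 1) x) l) := by
    intro x l n
    unfold cf
    split_ifs <;> simp [hf]
  have hfP : ∀ x m, HasOrd (n₀ + m) (f x - P m x) := by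
    intro x m
    rw [ord_iff]
    intro l i hi
    rw [cf_sub, map_sub, hcf, ← map_sub, ← cf_sub]
    rcases le_total m (i + 1) with h | h
    · exact ord_iff.1 (hPstable x m (i + 1) h) l i hi
    · have := ord_iff.1 (hPstable x (i + 1) m h) l i (by omega)
      rw [cf_sub, map_sub, sub_eq_zero] at this ⊢
      exact this.symm
  refine ⟨f, fun l n => ?_, fun x hx => ⟨by simpa [P] using hfP x 0, ?_⟩⟩
  · simp only [hcf]
    exact hPhol (n + 1) l n
  · refine (eq_of_ord fun n => ?_).symm
    have h1 := hord x hx _ _ (hfP x n)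
    have h2 := (hPrem x hx n).sub h1
    rw [map_sub, sub_sub, add_sub_cancel] at h2
    exact h2.mono (by omega)

end Solutions

/-! ### The isomorphism of `Ξ` with `θ_* Ξ` -/

section Transport

variable {N : ℕ} (μ : ℂ) (θ : ℂ⟦X⟧)

/-- The operator `θ(a)`. -/
noncomputable def thetaA (N : ℕ) : Module.End ℂ (XiSpace N) := evalOp (Xi μ N).a θ

/-- The operator `b θ'(a)`. -/
noncomputable def thetaB (N : ℕ) : Module.End ℂ (XiSpace N) :=
  (Xi μ N).b * evalOp (Xi μ N).a (PowerSeries.derivative ℂ θ)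

variable {μ θ}

theorem thetaB_apply (f : XiSpace N) : thetaB μ θ N f =
    (PowerSeries.X : ℂ⟦X⟧) • evalOp (Xi μ N).a (PowerSeries.derivative ℂ θ) f := by
  simp [thetaB]

theorem isRaising_b : IsRaising (Xi μ N).b := fun n f hf => by rw [Xi_b]; exact hf.X_smul

theorem isRaising_thetaB : IsRaising (thetaB μ θ N) := fun n f hf => by
  rw [thetaB_apply]
  exact (isFiltered_evalOp (isRaising_a μ) _ n f hf).X_smul

theorem thetaA_apply (h0 : PowerSeries.coeff 0 θ = 0) (f : XiSpace N) : thetaA μ θ N f =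
    (Xi μ N).a (evalOp (Xi μ N).a (PowerSeries.mk fun n => PowerSeries.coeff (n + 1) θ) f) := by
  rw [thetaA, evalOp_eq (isRaising_a μ), h0, zero_smul, zero_add]

theorem thetaA_apply' (h0 : PowerSeries.coeff 0 θ = 0) (f : XiSpace N) : thetaA μ θ N f =
    PowerSeries.coeff 1 θ • (Xi μ N).a f + (Xi μ N).a ((Xi μ N).a
      (evalOp (Xi μ N).a (PowerSeries.mk fun n => PowerSeries.coeff (n + 2) θ) f)) := by
  rw [thetaA_apply h0, evalOp_eq (isRaising_a μ), map_add, map_smul]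
  simp

theorem isRaising_thetaA (h0 : PowerSeries.coeff 0 θ = 0) : IsRaising (thetaA μ θ N) :=
  fun n f hf => by
    rw [thetaA_apply h0]
    exact (isFiltered_evalOp (isRaising_a μ) _ n f hf).a

theorem a_b_apply (f : XiSpace N) :
    (Xi μ N).a ((Xi μ N).b f) = (Xi μ N).b ((Xi μ N).a f) + (Xi μ N).b ((Xi μ N).b f) := by
  simp only [Xi_b, a_smul, PowerSeries.derivative_X, mul_one, smul_smul, pow_two]

/-- `θ(a)` commutes with `θ'(a)`, and its commutator with `b` is `b θ'(a) b`. Hence the new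
operators satisfy the same relation as `a` and `b`. -/
theorem thetaA_thetaB (h0 : PowerSeries.coeff 0 θ = 0) (f : XiSpace N) :
    thetaA μ θ N (thetaB μ θ N f) =
      thetaB μ θ N (thetaA μ θ N f) + thetaB μ θ N (thetaB μ θ N f) := by
  have hc : Commute (thetaA μ θ N) (evalOp (Xi μ N).a (PowerSeries.derivative ℂ θ)) :=
    evalOp_commute (isRaising_a μ) (isRaising_thetaA h0).isFiltered
      (evalOp_commute (isRaising_a μ) (isRaising_a μ).isFiltered (Commute.refl _) _).symm _
  have hc' := LinearMap.congr_fun hc.eq f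
  simp only [Module.End.mul_apply] at hc'
  simp only [thetaB, Module.End.mul_apply]
  rw [← hc', thetaA, evalOp_commutator_right (isRaising_a μ) isRaising_b a_b_apply]

theorem coeff_thetaB {n : ℕ} {f : XiSpace N} (hf : HasOrd n f) (l : ℕ) :
    PowerSeries.coeff (n + 1) (cf (thetaB μ θ N f) l) =
      PowerSeries.coeff 1 θ * PowerSeries.coeff n (cf f l) := by
  rw [thetaB_apply, cf_smul, PowerSeries.coeff_succ_X_mul, evalOp_eq (isRaising_a μ), cf_add,
    map_add, ord_iff.1 (isRaising_a μ n _ (isFiltered_evalOp (isRaising_a μ) _ n f hf)) l n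
      (Nat.lt_succ_self n), add_zero, cf_smul_complex, map_smul, PowerSeries.coeff_derivative]
  simp

theorem coeff_thetaA (h0 : PowerSeries.coeff 0 θ = 0) {n : ℕ} {f : XiSpace N} (hf : HasOrd n f)
    (l : ℕ) : PowerSeries.coeff (n + 1) (cf (thetaA μ θ N f) l) = PowerSeries.coeff 1 θ *
      ((μ + n) * PowerSeries.coeff n (cf f l) + PowerSeries.coeff n (cf f (l + 1))) := by
  rw [thetaA_apply' h0, cf_add, map_add, ord_iff.1 (isRaising_a μ _ _ (isRaising_a μ _ _
    (isFiltered_evalOp (isRaising_a μ) _ n f hf))) l (n + 1) (Nat.lt_succ_self _), add_zero,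
    cf_smul_complex, map_smul, cf_a, map_add, coeff_succ_eulerOp, PowerSeries.coeff_succ_X_mul,
    smul_eq_mul]

theorem supp_thetaB {j : ℕ} {f : XiSpace N} (hf : Supp j f) : Supp j (thetaB μ θ N f) := by
  rw [thetaB_apply]
  exact (supp_evalOp (fun _ h => h.a) _ hf).smul _

/-- The logarithmic shift as a `ℂ`-linear operator. -/
noncomputable def shift (N : ℕ) : Module.End ℂ (XiSpace N) := (logShift N).restrictScalars ℂ

@[simp] theorem cf_shift (f : XiSpace N) (l : ℕ) : cf (shift N f) l = cf f (l + 1) :=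
  cf_logShift f l

theorem cf_shift_pow (m : ℕ) (f : XiSpace N) (l : ℕ) : cf ((shift N ^ m) f) l = cf f (l + m) := by
  induction m generalizing l with
  | zero => simp
  | succ m ih => rw [pow_succ', Module.End.mul_apply, cf_shift, ih]; congr 1; omega

theorem isFiltered_shift : IsFiltered (shift N) := fun n f hf l => by
  rw [cf_shift]; exact hf (l + 1)

theorem shift_commute_a : Commute (shift N) (Xi μ N).a :=
  LinearMap.ext fun f => (a_logShift μ f).symm

theorem shift_commute_thetaA : Commute (shift N) (thetaA μ θ N) :=
  evalOp_commute (isRaising_a μ) isFiltered_shift shift_commute_a _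

theorem shift_commute_thetaB : Commute (shift N) (thetaB μ θ N) := by
  refine Commute.mul_right (LinearMap.ext fun f => ?_)
    (evalOp_commute (isRaising_a μ) isFiltered_shift shift_commute_a _)
  simp only [Module.End.mul_apply, Xi_b]
  exact (logShift N).map_smul _ _

/-- The operator whose kernel contains the images of the basis vectors. -/
noncomputable def transportEqn (μ : ℂ) (θ : ℂ⟦X⟧) (N : ℕ) : Module.End ℂ (XiSpace N) :=
  thetaA μ θ N - thetaB μ θ N * (μ • 1 + shift N)

theorem transportEqn_apply (f : XiSpace N) : transportEqn μ θ N f =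
    thetaA μ θ N f - thetaB μ θ N (μ • f + shift N f) := by
  simp [transportEqn]

theorem hasOrd_transportEqn (h0 : PowerSeries.coeff 0 θ = 0) {n : ℕ} {f : XiSpace N}
    (hf : HasOrd n f) : HasOrd (n + 1) (transportEqn μ θ N f) := by
  rw [transportEqn_apply]
  exact (isRaising_thetaA h0 _ _ hf).sub
    (isRaising_thetaB _ _ ((hf.smul_complex μ).add (isFiltered_shift _ _ hf)))

/-- The terms in `μ` and in the logarithmic shift cancel, leaving `r n` in degree `n`. The equation
is thus solvable in all degrees `n ≥ 1`, while the constant term of a solution may be prescribed. -/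
theorem coeff_transportEqn (h0 : PowerSeries.coeff 0 θ = 0) {n : ℕ} {f : XiSpace N}
    (hf : HasOrd n f) (l : ℕ) : PowerSeries.coeff (n + 1) (cf (transportEqn μ θ N f) l) =
      (PowerSeries.coeff 1 θ * n) * PowerSeries.coeff n (cf f l) := by
  rw [transportEqn_apply, cf_sub, map_sub, coeff_thetaA h0 hf,
    coeff_thetaB ((hf.smul_complex μ).add (isFiltered_shift _ _ hf)), cf_add, cf_smul_complex,
    cf_shift, map_add, map_smul, smul_eq_mul]
  ring

/-- `v` is the image of the basis vector `s^(μ-1) (Log s)^N / N!` under an isomorphism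
`Ξ_μ^{(N)} → θ_* Ξ_μ^{(N)}`. -/
structure IsTransportVector (μ : ℂ) (θ : ℂ⟦X⟧) (v : XiSpace N) : Prop where
  eqn : transportEqn μ θ N v = 0
  coeff_zero : ∀ l, PowerSeries.coeff 0 (cf v l) = if l = N then 1 else 0

/-- The map `Ξ_μ^{(N)} → θ_* Ξ_μ^{(N)}` with a given value on the basis vector
`s^(μ-1) (Log s)^N / N!`. -/
noncomputable def transport (μ : ℂ) (θ : ℂ⟦X⟧) (v : XiSpace N) : Module.End ℂ (XiSpace N) where
  toFun F := ∑ j : Fin (N + 1), evalOp (thetaB μ θ N) (F j) ((shift N ^ (N - (j : ℕ))) v)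
  map_add' F G := by
    rw [← Finset.sum_add_distrib]
    exact Finset.sum_congr rfl fun j _ => evalOp_add _ _ _
  map_smul' c F := by
    rw [RingHom.id_apply, Finset.smul_sum]
    exact Finset.sum_congr rfl fun j _ => evalOp_smul _ _ _

theorem transport_apply (v F : XiSpace N) : transport μ θ v F =
    ∑ j : Fin (N + 1), evalOp (thetaB μ θ N) (F j) ((shift N ^ (N - (j : ℕ))) v) := rfl

variable {v : XiSpace N}

theorem transport_X_smul (F : XiSpace N) : transport μ θ v ((PowerSeries.X : ℂ⟦X⟧) • F) =
    thetaB μ θ N (transport μ θ v F) := by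
  simp only [transport_apply, map_sum, Pi.smul_apply, smul_eq_mul, evalOp_X_mul isRaising_thetaB]

theorem shift_pow_succ_eq_zero (f : XiSpace N) : (shift N ^ (N + 1)) f = 0 :=
  cf_ext fun l => by rw [cf_shift_pow, cf_of_lt _ (by omega), cf_zero]

theorem shift_evalOp_thetaB (T : ℂ⟦X⟧) (u : XiSpace N) :
    shift N (evalOp (thetaB μ θ N) T u) = evalOp (thetaB μ θ N) T (shift N u) :=
  LinearMap.congr_fun
    (evalOp_commute isRaising_thetaB isFiltered_shift shift_commute_thetaB T).eq u

theorem transport_shift (F : XiSpace N) :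
    transport μ θ v (shift N F) = shift N (transport μ θ v F) := by
  simp only [transport_apply, map_sum, shift_evalOp_thetaB]
  -- The last summand on one side and the first on the other vanish by nilpotency of the shift; the
  -- others match after reindexing.
  rw [Fin.sum_univ_castSucc, Fin.sum_univ_succ]
  have h1 : shift N F (Fin.last N) = 0 := by
    rw [← cf_fin (shift N F), cf_shift]; exact cf_of_lt _ (by simp)
  have h2 : shift N ((shift N ^ (N - ((0 : Fin (N + 1)) : ℕ))) v) = 0 := by
    rw [← Module.End.mul_apply, ← pow_succ']; exact shift_pow_succ_eq_zero v
  rw [h1, h2, evalOp_zero, map_zero, add_zero, zero_add]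
  refine Finset.sum_congr rfl fun j _ => ?_
  have h3 : shift N ((shift N ^ (N - (j.succ : ℕ))) v) = (shift N ^ (N - (j.castSucc : ℕ))) v := by
    rw [← Module.End.mul_apply (shift N), ← pow_succ']
    congr 2
    have := j.2
    simp only [Fin.val_castSucc, Fin.val_succ]
    omega
  have h4 : shift N F j.castSucc = F j.succ := by
    rw [← cf_fin (shift N F), cf_shift, ← cf_fin F j.succ]
    rfl
  rw [h3, h4]

theorem thetaB_evalOp_thetaB (T : ℂ⟦X⟧) (u : XiSpace N) :
    thetaB μ θ N (evalOp (thetaB μ θ N) T u) = evalOp (thetaB μ θ N) T (thetaB μ θ N u) := by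
  have h := evalOp_commute (isRaising_thetaB (μ := μ) (θ := θ) (N := N))
    isRaising_thetaB.isFiltered (Commute.refl _) T
  rw [← Module.End.mul_apply (thetaB μ θ N), h.eq, Module.End.mul_apply]

theorem IsTransportVector.thetaA_shift_pow (hv : IsTransportVector μ θ v) (m : ℕ) :
    thetaA μ θ N ((shift N ^ m) v) =
      thetaB μ θ N (μ • (shift N ^ m) v + shift N ((shift N ^ m) v)) := by
  have h := hv.eqn
  rw [transportEqn_apply, sub_eq_zero] at h
  have hA := LinearMap.congr_fun ((shift_commute_thetaA (μ := μ) (θ := θ) (N := N)).pow_left m).eq v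
  have hB := LinearMap.congr_fun ((shift_commute_thetaB (μ := μ) (θ := θ) (N := N)).pow_left m).eq
    (μ • v + shift N v)
  have hs : (shift N ^ m) (shift N v) = shift N ((shift N ^ m) v) :=
    LinearMap.congr_fun ((Commute.refl (shift N)).pow_left m).eq v
  simp only [Module.End.mul_apply] at hA hB
  rw [← hA, h, hB, map_add, map_smul, hs]

theorem IsTransportVector.thetaA_evalOp (h0 : PowerSeries.coeff 0 θ = 0)
    (hv : IsTransportVector μ θ v) (T : ℂ⟦X⟧) (m : ℕ) :
    thetaA μ θ N (evalOp (thetaB μ θ N) T ((shift N ^ m) v)) =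
      evalOp (thetaB μ θ N) (PowerSeries.X ^ 2 * PowerSeries.derivative ℂ T) ((shift N ^ m) v) +
        thetaB μ θ N (μ • evalOp (thetaB μ θ N) T ((shift N ^ m) v) +
          shift N (evalOp (thetaB μ θ N) T ((shift N ^ m) v))) := by
  rw [evalOp_commutator_left isRaising_thetaB (isRaising_thetaA h0).isFiltered (thetaA_thetaB h0),
    hv.thetaA_shift_pow, ← thetaB_evalOp_thetaB, map_add (evalOp _ _), map_smul (evalOp _ _),
    shift_evalOp_thetaB, add_comm]

/-- This separates differentiation of the coefficients from a term built out of `b` and the shift,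
both of which `transport` intertwines. -/
theorem a_eq_derivative_add (F : XiSpace N) : (Xi μ N).a F =
    (fun j => PowerSeries.X ^ 2 * PowerSeries.derivative ℂ (F j)) +
      (PowerSeries.X : ℂ⟦X⟧) • (μ • F + shift N F) := by
  refine cf_ext fun l => ?_
  have hDl : cf (N := N) (fun j => PowerSeries.X ^ 2 * PowerSeries.derivative ℂ (F j)) l =
      PowerSeries.X ^ 2 * PowerSeries.derivative ℂ (cf F l) := by
    unfold cf
    split_ifs
    · rfl
    · rw [map_zero, mul_zero]
  rw [cf_a, eulerOp_apply, cf_add, cf_smul, cf_add, cf_smul_complex, cf_shift, hDl,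
    PowerSeries.smul_eq_C_mul, PowerSeries.smul_eq_C_mul]
  ring

theorem transport_a (h0 : PowerSeries.coeff 0 θ = 0) (hv : IsTransportVector μ θ v)
    (F : XiSpace N) : transport μ θ v ((Xi μ N).a F) = thetaA μ θ N (transport μ θ v F) := by
  rw [a_eq_derivative_add, map_add, transport_X_smul, map_add, map_smul, transport_shift]
  have h : thetaA μ θ N (transport μ θ v F) =
      ∑ j : Fin (N + 1), thetaA μ θ N (evalOp (thetaB μ θ N) (F j) ((shift N ^ (N - (j : ℕ))) v)) := by
    rw [transport_apply, map_sum]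
  rw [h, Finset.sum_congr rfl fun j _ => hv.thetaA_evalOp h0 (F j) _, Finset.sum_add_distrib,
    ← map_sum, Finset.sum_add_distrib, ← Finset.smul_sum, ← map_sum (shift N)]
  simp only [transport_apply]

/-- Modulo `b`, the vector `shift ^ (N - j) v` is the `j`-th basis vector, so the map is the
identity in degree `0`. Each factor `b` becomes `b θ'(a)` and contributes `r`. -/
theorem leading_transport (hv : IsTransportVector μ θ v) {n : ℕ} {F : XiSpace N}
    (hF : HasOrd n F) : HasOrd n (transport μ θ v F) ∧ ∀ l,
      PowerSeries.coeff n (cf (transport μ θ v F) l) =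
        PowerSeries.coeff 1 θ ^ n * PowerSeries.coeff n (cf F l) := by
  induction n generalizing F with
  | zero =>
    refine ⟨ord_zero _, fun l => ?_⟩
    rw [transport_apply, cf_sum, map_sum, pow_zero, one_mul]
    simp only [coeff_cf_evalOp, zero_add, Finset.sum_range_one, pow_zero, Module.End.one_apply,
      cf_shift_pow, hv.coeff_zero]
    by_cases hl : l < N + 1
    · rw [Finset.sum_eq_single (⟨l, hl⟩ : Fin (N + 1))]
      · rw [if_pos (by simp only []; omega), mul_one, cf, dif_pos hl]
      · intro j _ hj
        have := j.2
        have : (j : ℕ) ≠ l := fun h => hj (Fin.ext h)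
        rw [if_neg (by omega), mul_zero]
      · simp
    · rw [cf_of_lt F (by omega), map_zero]
      refine Finset.sum_eq_zero fun j _ => ?_
      have := j.2
      rw [if_neg (by omega), mul_zero]
  | succ n ih =>
    obtain ⟨G, rfl⟩ := hF.exists_eq_smul
    rw [pow_succ', mul_smul]
    have hG : HasOrd n ((PowerSeries.X ^ n : ℂ⟦X⟧) • G) := fun l => by
      rw [cf_smul]; exact dvd_mul_right _ _
    obtain ⟨h1, h2⟩ := ih hG
    rw [transport_X_smul]
    refine ⟨isRaising_thetaB _ _ h1, fun l => ?_⟩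
    rw [coeff_thetaB h1, h2, cf_smul _ (_ • G), PowerSeries.coeff_succ_X_mul]
    ring

theorem supp_transport {j : ℕ} {F : XiSpace N} (hF : Supp j F) : Supp j (transport μ θ v F) := by
  rw [transport_apply]
  refine Supp.sum fun i _ => ?_
  rcases lt_or_ge (i : ℕ) j with h | h
  · refine supp_evalOp (fun _ h => supp_thetaB h) _ fun l hl => ?_
    have := i.2
    rw [cf_shift_pow, cf_of_lt _ (by omega)]
  · rw [← cf_fin F, hF i h, evalOp_zero]
    simp [Supp]

/-- Coordinates below `j` are transported to coordinates below `j` and do not affect coordinate `j`.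
The order of the top coordinate alone therefore matters. -/
theorem top_transport (hv : IsTransportVector μ θ v) {j n : ℕ} {F : XiSpace N}
    (hF : Supp (j + 1) F) (hn : PowerSeries.X ^ n ∣ cf F j) :
    PowerSeries.X ^ n ∣ cf (transport μ θ v F) j ∧
      PowerSeries.coeff n (cf (transport μ θ v F) j) =
        PowerSeries.coeff 1 θ ^ n * PowerSeries.coeff n (cf F j) := by
  set G : XiSpace N := fun i => if (i : ℕ) = j then F i else 0 with hG
  have hGl : ∀ l, cf G l = if l = j then cf F l else 0 := by
    intro l
    unfold cf
    split_ifs with h1 h2 <;> simp_all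
  have hGo : HasOrd n G := by
    intro l
    rw [hGl]
    split_ifs with h
    · rw [h]; exact hn
    · exact dvd_zero _
  have hFG : Supp j (F - G) := by
    intro l hl
    rw [cf_sub, hGl]
    split_ifs with h
    · exact sub_self _
    · rw [hF l (by omega), sub_zero]
  have e : cf (transport μ θ v F) j = cf (transport μ θ v G) j := by
    have := supp_transport (μ := μ) (θ := θ) (v := v) hFG j le_rfl
    rwa [map_sub, cf_sub, sub_eq_zero] at this
  obtain ⟨h1, h2⟩ := leading_transport hv hGo
  rw [e]
  refine ⟨h1 j, ?_⟩
  rw [h2 j, hGl, if_pos rfl]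

/-- The leading coefficient of the highest coordinate is multiplied by `r ^ n ≠ 0`, so transport
cannot shrink the support. -/
theorem supp_of_supp_transport (hr : PowerSeries.coeff 1 θ ≠ 0) (hv : IsTransportVector μ θ v)
    {j : ℕ} {F : XiSpace N} (hF : Supp j (transport μ θ v F)) : Supp j F := by
  have key : ∀ i, Supp (j + i) F → Supp j F := by
    intro i
    induction i with
    | zero => exact id
    | succ i ih =>
      intro h
      refine ih (Supp.pred (j := j + i) h ?_)
      by_contra h0
      obtain ⟨n, u, hu, e⟩ := exists_eq_unit_mul_X_pow h0
      have := (top_transport (j := j + i) hv (n := n) h (e ▸ dvd_mul_left _ _)).2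
      have hu' := PowerSeries.coeff_mul_X_pow u n 0
      rw [zero_add] at hu'
      rw [hF _ (Nat.le_add_right j i), map_zero, e, hu', zero_eq_mul] at this
      exact this.elim (pow_ne_zero _ hr) hu
  exact key (N + 1) ((supp_last F).mono (by omega))

end Transport

/-! ### Holomorphic dependence of the isomorphism on the parameter -/

section HolomorphicTransport

variable {X : Type*} [TopologicalSpace X] [ReducedComplexSpace X] {N : ℕ} {W : Set X} {μ : ℂ}
  {θ : X → ℂ⟦X⟧}

theorem holPreserving_a : HolPreserving (N := N) W fun _ => (Xi μ N).a := fun _ hf => hf.a μ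

theorem holPreserving_thetaA (hθ : HolSeriesOn W θ) :
    HolPreserving W fun x => thetaA μ (θ x) N :=
  holPreserving_a.evalOp hθ

theorem holPreserving_thetaB (hθ : HolSeriesOn W θ) :
    HolPreserving W fun x => thetaB μ (θ x) N := by
  intro f hf
  simp only [thetaB_apply]
  exact (holPreserving_a.evalOp hθ.derivative f hf).smul (HolSeriesOn.const _)

theorem holPreserving_shift : HolPreserving (N := N) W fun _ => shift N := fun f hf l => by
  simp only [cf_shift]
  exact hf (l + 1)

theorem holPreserving_transportEqn (hθ : HolSeriesOn W θ) :
    HolPreserving W fun x => transportEqn μ (θ x) N := by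
  intro f hf
  simp only [transportEqn_apply]
  exact (holPreserving_thetaA hθ f hf).sub (holPreserving_thetaB hθ _
    ((hf.smul_complex (HolOn.const μ)).add (holPreserving_shift f hf)))

theorem holPreserving_transport (hθ : HolSeriesOn W θ) {v : X → XiSpace N} (hv : HolMap W v) :
    HolPreserving W fun x => transport μ (θ x) (v x) := by
  intro F hF
  simp only [transport_apply]
  exact HolMap.sum fun j _ => (holPreserving_thetaB hθ).evalOp (holMap_iff.1 hF j) _
    (holPreserving_shift.pow _ v hv)

/-- Look for `v = e + f` with `f` divisible by `b`. The leading factor `r n` vanishes at `n = 0`, so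
`transportEqn e` has order at least `2`, exactly what is needed to solve for `f`. -/
theorem exists_isTransportVector (hθ : HolSeriesOn W θ)
    (h0 : ∀ x ∈ W, PowerSeries.coeff 0 (θ x) = 0) (h1 : ∀ x ∈ W, PowerSeries.coeff 1 (θ x) ≠ 0) :
    ∃ v : X → XiSpace N, HolMap W v ∧ ∀ x ∈ W, IsTransportVector μ (θ x) (v x) := by
  set e : XiSpace N := fun j => if (j : ℕ) = N then 1 else 0 with he
  have hel : ∀ l, cf e l = if l = N then 1 else 0 := by
    intro l
    unfold cf
    split_ifs with h2 h3 <;> simp_all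
  have hK := holPreserving_transportEqn (μ := μ) (N := N) hθ
  obtain ⟨f, hf, hfe⟩ := exists_solution (n₀ := 1) (s := 1)
    (c := fun x n => PowerSeries.coeff 1 (θ x) * n) (t := fun x => 0 - transportEqn μ (θ x) N e) hK
    (fun x hx n f hf => hasOrd_transportEqn (h0 x hx) hf)
    (fun x hx n f hf l => coeff_transportEqn (h0 x hx) hf l)
    (fun n => (hθ 1).mul (HolOn.const _))
    (fun x hx n hn => mul_ne_zero (h1 x hx) (Nat.cast_ne_zero.2 (by omega)))
    ((HolMap.const 0).sub (hK _ (HolMap.const e)))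
    (fun x hx => by
      rw [ord_iff]
      intro l m hm
      rw [cf_sub, map_sub, cf_zero, map_zero, zero_sub, neg_eq_zero]
      have h := hasOrd_transportEqn (μ := μ) (h0 x hx) (ord_zero e)
      rcases (by omega : m < 0 + 1 ∨ m = 0 + 1) with hm | rfl
      · exact ord_iff.1 h l m hm
      · rw [coeff_transportEqn (h0 x hx) (ord_zero e)]
        simp)
  refine ⟨fun x => e + f x, (HolMap.const e).add hf, fun x hx => ⟨?_, fun l => ?_⟩⟩
  · rw [map_add, (hfe x hx).2]
    simp
  · rw [cf_add, map_add, ord_iff.1 (hfe x hx).1 l 0 zero_lt_one, add_zero, hel]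
    split_ifs <;> simp

/-- `g` is inverse to the isomorphism `Ξ_μ^{(N)} → θ_* Ξ_μ^{(N)}` given by a transport vector. -/
structure IsTransportInverse (μ : ℂ) (θ : ℂ⟦X⟧) (v : XiSpace N) (g : Module.End ℂ (XiSpace N)) :
    Prop where
  coeff_zero : PowerSeries.coeff 0 θ = 0
  coeff_one : PowerSeries.coeff 1 θ ≠ 0
  vector : IsTransportVector μ θ v
  right_inv : ∀ f, transport μ θ v (g f) = f
  left_inv : ∀ f, g (transport μ θ v f) = f

/-- The leading factors `r ^ n` never vanish, so the transport is injective and solvable with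
holomorphic solutions over every open subset. This makes both directions preserve holomorphy. -/
theorem exists_isTransportInverse (hθ : HolSeriesOn W θ)
    (h0 : ∀ x ∈ W, PowerSeries.coeff 0 (θ x) = 0) (h1 : ∀ x ∈ W, PowerSeries.coeff 1 (θ x) ≠ 0) :
    ∃ (v : X → XiSpace N) (g : X → Module.End ℂ (XiSpace N)),
      (∀ x ∈ W, IsTransportInverse μ (θ x) (v x) (g x)) ∧
      ∀ W' ⊆ W, IsOpen W' → ∀ f, HolMap W' f ↔ HolMap W' fun x => g x (f x) := by
  obtain ⟨v, hv, hvt⟩ := exists_isTransportVector (μ := μ) (N := N) hθ h0 h1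
  have hT : ∀ W' ⊆ W, HolPreserving W' fun x => transport μ (θ x) (v x) := fun W' hW' =>
    holPreserving_transport (hθ.mono hW') (hv.mono hW')
  have hsol : ∀ W' ⊆ W, ∀ t, HolMap W' t →
      ∃ f, HolMap W' f ∧ ∀ x ∈ W', transport μ (θ x) (v x) (f x) = t x := by
    intro W' hW' t ht
    obtain ⟨f, hf, hfe⟩ := exists_solution (n₀ := 0) (s := 0)
      (c := fun x n => PowerSeries.coeff 1 (θ x) ^ n) (hT W' hW')
      (fun x hx n f hf => (leading_transport (hvt x (hW' hx)) hf).1)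
      (fun x hx n f hf l => (leading_transport (hvt x (hW' hx)) hf).2 l)
      (fun n => ((hθ 1).mono hW').pow n) (fun x hx n _ => pow_ne_zero _ (h1 x (hW' hx))) ht
      (fun x _ => ord_zero _)
    exact ⟨f, hf, fun x hx => (hfe x hx).2⟩
  have hinj : ∀ x ∈ W, Function.Injective (transport μ (θ x) (v x)) := by
    intro x hx
    rw [← LinearMap.ker_eq_bot, LinearMap.ker_eq_bot']
    exact fun f hf => eq_zero_of_leading (s := 0) (n₀ := 0)
      (fun n f h l => (leading_transport (hvt x hx) h).2 l)
      (fun n _ => pow_ne_zero _ (h1 x hx)) (ord_zero f) hf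
  have hex : ∀ x, ∃ g : Module.End ℂ (XiSpace N), x ∈ W →
      (∀ f, transport μ (θ x) (v x) (g f) = f) ∧ ∀ f, g (transport μ (θ x) (v x) f) = f := by
    intro x
    by_cases hx : x ∈ W
    · have hb : Function.Bijective (transport μ (θ x) (v x)) := ⟨hinj x hx, fun t => by
        obtain ⟨f, -, hf⟩ := hsol W le_rfl (fun _ => t) (HolMap.const t)
        exact ⟨f x, hf x hx⟩⟩
      let e := LinearEquiv.ofBijective _ hb
      exact ⟨e.symm.toLinearMap, fun _ => ⟨e.apply_symm_apply, e.symm_apply_apply⟩⟩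
    · exact ⟨0, fun h => absurd h hx⟩
  choose g hg using hex
  refine ⟨v, g, fun x hx => ⟨h0 x hx, h1 x hx, hvt x hx, (hg x hx).1, (hg x hx).2⟩,
    fun W' hW' hWo f => ⟨fun hf => ?_, fun hf => ?_⟩⟩
  · obtain ⟨u, hu, hue⟩ := hsol W' hW' f hf
    exact hu.congr hWo fun x hx => by rw [← hue x hx, (hg x (hW' hx)).2]
  · exact (hT W' hW' _ hf).congr hWo fun x hx => (hg x (hW' hx)).1 _

end HolomorphicTransport

/-! ### Comparison of the triangular bases of `φ` and of its inverse transport -/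

section ChangeOfVariable

variable {μ : ℂ} {N k : ℕ} {φ : XiSpace N} {d : ℕ → ℕ} {ψ : ℕ → XiSpace N} {V : ℕ → ℂ⟦X⟧}
  {θ : ℂ⟦X⟧} {v : XiSpace N} {g : Module.End ℂ (XiSpace N)}

/-- The partial sums lie in the flag, and a remainder of sufficiently high order lies in it by the
conductor bound. -/
theorem Chain.evalOp_mem_flag (C : Chain μ k φ d ψ V) {j : ℕ} (hj : j ≤ k) (S : ℂ⟦X⟧)
    {f : XiSpace N} (hf : f ∈ flag ψ j) : evalOp (Xi μ N).a S f ∈ flag ψ j := by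
  obtain ⟨q, hq⟩ := C.exists_conductor hj
  have hpow : ∀ n : ℕ, ((Xi μ N).a ^ n) f ∈ flag ψ j := by
    intro n
    induction n with
    | zero => simpa using hf
    | succ n ih => rw [pow_succ', Module.End.mul_apply]; exact C.a_mem_flag hj ih
  have hsum : ∑ i ∈ Finset.range q, PowerSeries.coeff i S • ((Xi μ N).a ^ i) f ∈ flag ψ j :=
    Submodule.sum_mem _ fun i _ => Submodule.smul_of_tower_mem _ _ (hpow i)
  have hrem := hq (evalOp (Xi μ N).a S f -
    ∑ i ∈ Finset.range q, PowerSeries.coeff i S • ((Xi μ N).a ^ i) f)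
    ((supp_evalOp (fun _ h => h.a) S (C.supp_of_mem_flag hj hf)).sub (C.supp_of_mem_flag hj hsum))
    (evalOp_spec (isRaising_a μ) S q f)
  simpa using Submodule.add_mem _ hrem hsum

theorem Chain.thetaA_mem_flag (C : Chain μ k φ d ψ V) {j : ℕ} (hj : j ≤ k)
    {f : XiSpace N} (hf : f ∈ flag ψ j) : thetaA μ θ N f ∈ flag ψ j :=
  C.evalOp_mem_flag hj θ hf

theorem Chain.exists_thetaB_eq (C : Chain μ k φ d ψ V) {j : ℕ} (hj : j ≤ k)
    {f : XiSpace N} (hf : f ∈ flag ψ j) :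
    ∃ w ∈ flag ψ j, thetaB μ θ N f = (PowerSeries.X : ℂ⟦X⟧) • w :=
  ⟨_, C.evalOp_mem_flag hj _ hf, thetaB_apply f⟩

theorem Chain.thetaB_mem_flag (C : Chain μ k φ d ψ V) {j : ℕ} (hj : j ≤ k)
    {f : XiSpace N} (hf : f ∈ flag ψ j) : thetaB μ θ N f ∈ flag ψ j := by
  obtain ⟨w, hw, e⟩ := C.exists_thetaB_eq (θ := θ) hj hf
  rw [e]
  exact Submodule.smul_mem _ _ hw

/-- `transport` is not `ℂ⟦X⟧`-linear, since `b` becomes `b θ'(a)`. The image is therefore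
approximated in the flag modulo `X ^ q`, and the conductor absorbs the error. -/
theorem Chain.transport_smul_mem (C : Chain μ k φ d ψ V) (T : IsTransportInverse μ θ v g)
    (P : ℂ⟦X⟧) {f : XiSpace N} (hf : transport μ θ v f ∈ flag ψ k) :
    transport μ θ v (P • f) ∈ flag ψ k := by
  obtain ⟨q, hq⟩ := C.exists_conductor le_rfl
  have key : ∀ (q : ℕ) (P : ℂ⟦X⟧), ∃ z ∈ flag ψ k, HasOrd q (transport μ θ v (P • f) - z) := by
    intro q
    induction q with
    | zero => exact fun P => ⟨0, Submodule.zero_mem _, ord_zero _⟩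
    | succ q ih =>
      intro P
      obtain ⟨z, hz, hzo⟩ := ih (PowerSeries.mk fun n => PowerSeries.coeff (n + 1) P)
      refine ⟨thetaB μ θ N z + PowerSeries.constantCoeff P • transport μ θ v f,
        Submodule.add_mem _ (C.thetaB_mem_flag le_rfl hz) (Submodule.smul_of_tower_mem _ _ hf), ?_⟩
      have e : P • f = (PowerSeries.X : ℂ⟦X⟧) •
          ((PowerSeries.mk fun n => PowerSeries.coeff (n + 1) P) • f) +
            PowerSeries.constantCoeff P • f := by
        conv_lhs => rw [PowerSeries.eq_X_mul_shift_add_const P]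
        rw [add_smul, mul_smul]
        congr 1
        exact cf_ext fun l => by rw [cf_smul, cf_smul_complex, PowerSeries.smul_eq_C_mul]
      rw [e, map_add, transport_X_smul, map_smul _ (PowerSeries.constantCoeff P), add_sub_add_right_eq_sub, ← map_sub]
      exact isRaising_thetaB _ _ hzo
  obtain ⟨z, hz, hzo⟩ := key q P
  have hs : Supp k (transport μ θ v (P • f)) := supp_transport (Supp.smul _
    (supp_of_supp_transport T.coeff_one T.vector (C.supp_of_mem_flag le_rfl hf)))
  simpa using Submodule.add_mem _ (hq _ (hs.sub (C.supp_of_mem_flag le_rfl hz)) hzo) hz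

/-- The preimage of `Ã φ` under the isomorphism `Ξ_μ^{(N)} → θ_* Ξ_μ^{(N)}`. -/
noncomputable def Chain.preimage (C : Chain μ k φ d ψ V) (T : IsTransportInverse μ θ v g) :
    Submodule ℂ⟦X⟧ (XiSpace N) where
  carrier := {f | transport μ θ v f ∈ flag ψ k}
  add_mem' hf hf' := by
    simp only [Set.mem_ofPred_eq, map_add] at *
    exact Submodule.add_mem _ hf hf'
  zero_mem' := by simp
  smul_mem' P _ hf := C.transport_smul_mem T P hf

theorem Chain.mem_preimage (C : Chain μ k φ d ψ V) (T : IsTransportInverse μ θ v g)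
    {f : XiSpace N} : f ∈ C.preimage T ↔ transport μ θ v f ∈ flag ψ k := Iff.rfl

theorem Chain.a_mem_preimage (C : Chain μ k φ d ψ V) (T : IsTransportInverse μ θ v g)
    {f : XiSpace N} (hf : f ∈ C.preimage T) : (Xi μ N).a f ∈ C.preimage T := by
  rw [C.mem_preimage, transport_a T.coeff_zero T.vector]
  exact C.thetaA_mem_flag le_rfl hf

theorem Chain.self_mem_flag (C : Chain μ k φ d ψ V) : φ ∈ flag ψ k := by
  rw [← C.generated_eq]
  exact self_mem_generated φ

theorem Chain.inverse_mem_preimage (C : Chain μ k φ d ψ V) (T : IsTransportInverse μ θ v g) :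
    g φ ∈ C.preimage T := by
  rw [C.mem_preimage, T.right_inv]
  exact C.self_mem_flag

theorem Chain.supp_of_mem_preimage (C : Chain μ k φ d ψ V) (T : IsTransportInverse μ θ v g)
    {f : XiSpace N} (hf : f ∈ C.preimage T) : Supp k f :=
  supp_of_supp_transport T.coeff_one T.vector (C.supp_of_mem_flag le_rfl hf)

theorem Chain.transport_mem_flag (C : Chain μ k φ d ψ V) (T : IsTransportInverse μ θ v g)
    {f : XiSpace N} (hf : f ∈ C.preimage T) {j : ℕ} (hj : j ≤ k) (hs : Supp j f) :
    transport μ θ v f ∈ flag ψ j :=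
  (C.mem_flag_iff hj le_rfl).2 ⟨hf, supp_transport hs⟩

theorem Chain.cf_self (C : Chain μ k φ d ψ V) {j : ℕ} (hj : k = j + 1) :
    cf φ j = V k * PowerSeries.X ^ d j := by
  rw [C.gen, cf_smul, hj, C.top j (by omega)]

theorem Chain.exists_chain_inverse (C : Chain μ k φ d ψ V) (T : IsTransportInverse μ θ v g) :
    ∃ d' ψ' V', Chain μ k (g φ) d' ψ' V' := by
  have hs := C.supp_of_mem_preimage T (C.inverse_mem_preimage T)
  refine exists_chain k (g φ) hs fun j hj h0 => ?_
  have h1 : Supp j (g φ) := Supp.pred (hj ▸ hs) h0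
  have h2 := supp_transport (μ := μ) (θ := θ) (v := v) h1
  rw [T.right_inv] at h2
  have h3 := h2 j le_rfl
  rw [C.cf_self hj] at h3
  rcases mul_eq_zero.1 h3 with h | h
  · exact C.unit k le_rfl (by rw [h, map_zero])
  · exact pow_ne_zero _ PowerSeries.X_ne_zero h

theorem coeff_ne_zero_le {P : ℂ⟦X⟧} {m n : ℕ} (h : PowerSeries.X ^ m ∣ P)
    (hn : PowerSeries.coeff n P ≠ 0) : m ≤ n := by
  by_contra hlt
  exact hn (PowerSeries.X_pow_dvd_iff.1 h n (by omega))

variable {d' : ℕ → ℕ} {ψ' : ℕ → XiSpace N} {V' : ℕ → ℂ⟦X⟧}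

theorem Chain.psi_mem_preimage (C : Chain μ k φ d ψ V) (T : IsTransportInverse μ θ v g)
    (C' : Chain μ k (g φ) d' ψ' V') {j : ℕ} (hj : j ≤ k) : ψ' j ∈ C.preimage T :=
  C'.mem_of_stable (C.inverse_mem_preimage T) (fun _ => C.a_mem_preimage T) hj

theorem Chain.top_transport_smul (C' : Chain μ k (g φ) d' ψ' V') (T : IsTransportInverse μ θ v g)
    {j : ℕ} (hj : j < k) (P : ℂ⟦X⟧) :
    PowerSeries.X ^ d' j ∣ cf (transport μ θ v (P • ψ' (j + 1))) j ∧
      PowerSeries.coeff (d' j) (cf (transport μ θ v (P • ψ' (j + 1))) j) =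
        PowerSeries.coeff 1 θ ^ d' j * PowerSeries.coeff 0 P := by
  have e : cf (P • ψ' (j + 1)) j = P * PowerSeries.X ^ d' j := by rw [cf_smul, C'.top j hj]
  have hs : Supp (j + 1) (P • ψ' (j + 1)) := (C'.supp (j + 1) hj).smul P
  have h := top_transport T.vector hs (e ▸ dvd_mul_left _ _)
  have hc := PowerSeries.coeff_mul_X_pow P (d' j) 0
  rw [zero_add] at hc
  rwa [e, hc] at h

theorem Chain.top_transport_psi (C' : Chain μ k (g φ) d' ψ' V') (T : IsTransportInverse μ θ v g)
    {j : ℕ} (hj : j < k) : PowerSeries.coeff (d' j) (cf (transport μ θ v (ψ' (j + 1))) j) =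
        PowerSeries.coeff 1 θ ^ d' j := by
  simpa using (C'.top_transport_smul T hj 1).2

/-- On `flag ψ (j + 1)` coordinate `j` has order at least `d j`, whereas the transport of `ψ' (j +
1)` has there a nonzero coefficient in degree `d' j`. -/
theorem Chain.exponent_le_inverse (C : Chain μ k φ d ψ V) (T : IsTransportInverse μ θ v g)
    (C' : Chain μ k (g φ) d' ψ' V') {j : ℕ} (hj : j < k) : d j ≤ d' j := by
  refine coeff_ne_zero_le (C.X_pow_dvd hj (C.transport_mem_flag T (C.psi_mem_preimage T C' hj) hj
    (C'.supp _ hj))) (n := d' j) ?_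
  rw [C'.top_transport_psi T hj]
  exact pow_ne_zero _ T.coeff_one

theorem Chain.exponent_last_eq (C : Chain μ k φ d ψ V) (T : IsTransportInverse μ θ v g)
    (C' : Chain μ k (g φ) d' ψ' V') {j : ℕ} (hj : k = j + 1) : d' j = d j := by
  refine le_antisymm ?_ (C.exponent_le_inverse T C' (by omega))
  have h := (C'.top_transport_smul T (j := j) (by omega) (V' k)).1
  have e : V' k • ψ' (j + 1) = g φ := by rw [C'.gen, hj]
  rw [e, T.right_inv, C.cf_self hj] at h
  refine coeff_ne_zero_le h ?_
  have hc := PowerSeries.coeff_mul_X_pow (V k) (d j) 0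
  rw [zero_add] at hc
  rw [hc]
  exact C.unit k le_rfl

/-- The leading coefficient of `θ(a) y` modulo `b`. -/
theorem Chain.thetaA_mod_b (C : Chain μ k φ d ψ V) (h0 : PowerSeries.coeff 0 θ = 0) {j : ℕ}
    (hj : j + 1 < k) {f : XiSpace N} (hf : f ∈ flag ψ (j + 2)) :
    ∃ z ∈ flag ψ (j + 1), ∃ w ∈ flag ψ (j + 2),
      thetaA μ θ N f = z + (PowerSeries.X : ℂ⟦X⟧) • w ∧ PowerSeries.coeff (d j) (cf z j) =
        PowerSeries.coeff 1 θ * (PowerSeries.coeff 0 (V (j + 1)) *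
          PowerSeries.coeff (d (j + 1)) (cf f (j + 1))) := by
  -- Write `θ(a) f = r a f + a² f'`. Modulo `b`, `a²` descends two levels of the flag, so coordinate
  -- `j` sees only `r a f`.
  set f' := evalOp (Xi μ N).a (PowerSeries.mk fun n => PowerSeries.coeff (n + 2) θ) f
  have hf' : f' ∈ flag ψ (j + 2) := C.evalOp_mem_flag hj _ hf
  obtain ⟨z, hz, w, hw, e, hc⟩ := C.a_mod_b hj hf
  obtain ⟨z₁, hz₁, w₁, hw₁, e₁, -⟩ := C.a_mod_b hj hf'
  obtain ⟨z₂, hz₂, w₂, hw₂, e₂, -⟩ := C.a_mod_b (j := j) (by omega) hz₁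
  refine ⟨PowerSeries.coeff 1 θ • z + z₂, Submodule.add_mem _ (Submodule.smul_of_tower_mem _ _ hz)
    (flag_mono ψ (Nat.le_succ j) hz₂), PowerSeries.coeff 1 θ • w + w₂ + (Xi μ N).a w₁ +
      (PowerSeries.X : ℂ⟦X⟧) • w₁, Submodule.add_mem _ (Submodule.add_mem _ (Submodule.add_mem _
        (Submodule.smul_of_tower_mem _ _ hw) (flag_mono ψ (Nat.le_succ _) hw₂))
        (C.a_mem_flag hj hw₁)) (Submodule.smul_mem _ _ hw₁), ?_, ?_⟩
  · have hX : (PowerSeries.X : ℂ⟦X⟧) • (PowerSeries.coeff 1 θ • w) =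
        PowerSeries.coeff 1 θ • ((PowerSeries.X : ℂ⟦X⟧) • w) := smul_comm _ _ _
    rw [thetaA_apply' h0, e, e₁, map_add, e₂, a_smul, PowerSeries.derivative_X, mul_one, pow_two,
      mul_smul, smul_add, smul_add, smul_add, smul_add, hX]
    abel
  · rw [cf_add, cf_smul_complex, C.supp_of_mem_flag (j := j) (by omega) hz₂ j le_rfl, add_zero,
      map_smul, smul_eq_mul, hc j rfl]

/-- Transport turns `step` for `ψ'` into an identity involving `θ(a) y` and `b θ'(a) y`, with `y`
the transport of `ψ' (j + 2)`. In coordinate `j`, degree `d j`, only the part of `θ(a) y` not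
divisible by `b` contributes: `r` from `θ(a)`, `V (j + 1)` from the old chain, and `r ^ d (j + 1)`
from `y`. This is nonzero, which bounds `d' j` by `d j`; equality then relates the units. -/
theorem Chain.inverse_step (C : Chain μ k φ d ψ V) (T : IsTransportInverse μ θ v g)
    (C' : Chain μ k (g φ) d' ψ' V') {j : ℕ} (hj : j + 1 < k) (he : d' (j + 1) = d (j + 1)) :
    d' j = d j ∧ PowerSeries.coeff 1 θ ^ d j * PowerSeries.coeff 0 (V' (j + 1)) =
      PowerSeries.coeff 1 θ ^ (d (j + 1) + 1) * PowerSeries.coeff 0 (V (j + 1)) := by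
  set y := transport μ θ v (ψ' (j + 2)) with hy
  have hym : y ∈ flag ψ (j + 2) :=
    C.transport_mem_flag T (C.psi_mem_preimage T C' hj) hj (C'.supp _ hj)
  have hyc : PowerSeries.coeff (d (j + 1)) (cf y (j + 1)) = PowerSeries.coeff 1 θ ^ d (j + 1) := by
    rw [← he]
    exact C'.top_transport_psi T hj
  obtain ⟨z, hz, w, hw, e, hc⟩ := C.thetaA_mod_b T.coeff_zero hj hym
  obtain ⟨w', hw', e'⟩ := C.exists_thetaB_eq (θ := θ) hj hym
  obtain ⟨hdvd, htop⟩ := C'.top_transport_smul T (j := j) (by omega) (V' (j + 1))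
  set u := transport μ θ v (V' (j + 1) • ψ' (j + 1)) with hu
  have hum : u ∈ flag ψ (j + 1) := C.transport_mem_flag T
    (Submodule.smul_mem _ _ (C.psi_mem_preimage T C' (by omega))) (by omega)
    ((C'.supp _ (by omega)).smul _)
  have hstep : u = z + (PowerSeries.X : ℂ⟦X⟧) • (w - (μ + d' (j + 1)) • w') := by
    have hX : (PowerSeries.X : ℂ⟦X⟧) • ((μ + d' (j + 1)) • w') =
      (μ + d' (j + 1)) • ((PowerSeries.X : ℂ⟦X⟧) • w') := smul_comm _ _ _
    have := transport_a T.coeff_zero T.vector (ψ' (j + 2))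
    rw [C'.a_psi hj, map_add, map_smul, transport_X_smul, ← hy, ← hu, e, e'] at this
    rw [smul_sub, hX, ← add_sub_assoc, ← this, add_sub_cancel_left]
  -- Both `u` and `z` are supported below `j + 1`, hence so is their difference divided by `b`. Its
  -- coordinate `j` is then divisible by `X ^ d j`, and after multiplication by `X` it no longer
  -- reaches degree `d j`.
  have hwm : w - (μ + d' (j + 1)) • w' ∈ flag ψ (j + 1) := by
    refine C.mem_flag_of_succ hj (Submodule.sub_mem _ hw (Submodule.smul_of_tower_mem _ _ hw')) ?_
    have h1 := C.supp_of_mem_flag (by omega) (Submodule.sub_mem _ hum hz) (j + 1) le_rfl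
    rw [hstep, add_sub_cancel_left, cf_smul] at h1
    exact (mul_eq_zero.1 h1).resolve_left PowerSeries.X_ne_zero
  have huc : PowerSeries.coeff (d j) (cf u j) =
      PowerSeries.coeff 1 θ ^ (d (j + 1) + 1) * PowerSeries.coeff 0 (V (j + 1)) := by
    have h1 : PowerSeries.X ^ (d j + 1) ∣
        cf ((PowerSeries.X : ℂ⟦X⟧) • (w - (μ + d' (j + 1)) • w')) j := by
      rw [cf_smul, pow_succ']
      exact mul_dvd_mul_left _ (C.X_pow_dvd (by omega) hwm)
    rw [hstep, cf_add, map_add, PowerSeries.X_pow_dvd_iff.1 h1 _ (Nat.lt_succ_self _), add_zero, hc,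
      hyc, pow_succ]
    ring
  have hle : d' j ≤ d j := by
    refine coeff_ne_zero_le hdvd ?_
    rw [huc]
    exact mul_ne_zero (pow_ne_zero _ T.coeff_one) (C.unit _ (by omega))
  have heq : d' j = d j := le_antisymm hle (C.exponent_le_inverse T C' (by omega))
  refine ⟨heq, ?_⟩
  rw [← huc, ← heq, htop]

theorem Chain.exponent_inverse_eq (C : Chain μ k φ d ψ V) (T : IsTransportInverse μ θ v g)
    (C' : Chain μ k (g φ) d' ψ' V') {j : ℕ} (hj : j < k) : d' j = d j := by
  obtain ⟨m, rfl⟩ : ∃ m, k = j + 1 + m := ⟨k - (j + 1), by omega⟩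
  have key : ∀ i ≤ m, d' (j + m - i) = d (j + m - i) := by
    intro i
    induction i with
    | zero => exact fun _ => C.exponent_last_eq T C' (by omega)
    | succ i ih =>
      intro hi
      refine (C.inverse_step T C' (by omega) ?_).1
      rw [show j + m - (i + 1) + 1 = j + m - i by omega]
      exact ih (by omega)
  simpa using key m le_rfl

/-- The generator of the theme obtained by change of variable, together with its chain. -/
theorem Chain.exists_inverse (C : Chain μ k φ d ψ V) (T : IsTransportInverse μ θ v g) :
    ∃ ψ' V', Chain μ k (g φ) d ψ' V' ∧ ∀ j, j + 1 < k →
      PowerSeries.coeff 1 θ ^ d j * PowerSeries.coeff 0 (V' (j + 1)) =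
        PowerSeries.coeff 1 θ ^ (d (j + 1) + 1) * PowerSeries.coeff 0 (V (j + 1)) := by
  obtain ⟨d', ψ', V', C'⟩ := C.exists_chain_inverse T
  have he : ∀ j < k, d' j = d j := fun j hj => C.exponent_inverse_eq T C' hj
  exact ⟨ψ', V', C'.congr_exponents he, fun j hj => (C.inverse_step T C' hj (he _ hj)).2⟩

/-- The preimage contains the theme of `g φ`. Equality follows because the exponents agree: the top
coordinate of any element of the preimage is divisible by `X ^ d j` and can be eliminated with `ψ'
(j + 1)`. -/
theorem Chain.mem_generated_inverse_iff (C : Chain μ k φ d ψ V) (T : IsTransportInverse μ θ v g)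
    (f : XiSpace N) :
    f ∈ generated μ N (g φ) ↔ transport μ θ v f ∈ generated μ N φ := by
  obtain ⟨ψ', V', C', -⟩ := C.exists_inverse T
  rw [C.generated_eq, ← C.mem_preimage T]
  refine ⟨fun hf => generated_le (C.inverse_mem_preimage T) (fun _ => C.a_mem_preimage T) hf,
    fun hf => ?_⟩
  rw [C'.generated_eq]
  have key : ∀ j ≤ k, ∀ f ∈ C.preimage T, Supp j f → f ∈ flag ψ' j := by
    intro j
    induction j with
    | zero => intro _ f _ hs; rw [supp_zero_iff.1 hs]; exact Submodule.zero_mem _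
    | succ j ih =>
      intro hj f hf hs
      have hd := C.X_pow_dvd hj (C.transport_mem_flag T hf hj hs)
      have hdf : PowerSeries.X ^ d j ∣ cf f j := by
        by_cases h0 : cf f j = 0
        · rw [h0]; exact dvd_zero _
        obtain ⟨n, u, hu, e⟩ := exists_eq_unit_mul_X_pow h0
        have h1 := (top_transport T.vector (n := n) hs (e ▸ dvd_mul_left _ _)).2
        have hc := PowerSeries.coeff_mul_X_pow u n 0
        rw [zero_add] at hc
        rw [e, hc] at h1
        rw [e]
        refine (pow_dvd_pow _ (coeff_ne_zero_le hd (n := n) ?_)).trans (dvd_mul_left _ _)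
        rw [h1]
        exact mul_ne_zero (pow_ne_zero _ T.coeff_one) hu
      obtain ⟨P, hP⟩ := hdf
      refine mem_flag_succ.2 ⟨P, f - P • ψ' (j + 1), ih (by omega) _ (Submodule.sub_mem _ hf
        (Submodule.smul_mem _ _ (C.psi_mem_preimage T C' hj))) (Supp.pred
          (hs.sub ((C'.supp _ hj).smul P)) ?_), by simp⟩
      rw [cf_sub, cf_smul, C'.top j hj, hP, mul_comm, sub_self]
  exact key k le_rfl f hf (C.supp_of_mem_preimage T hf)

end ChangeOfVariable

/-! ### Power series in `a` on an abstract theme -/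

section EvalA

variable {E : Type*} [AddCommGroup E] [Module ℂ E] {A : ABStructure E} {μ : ℂ} {N k : ℕ}
  {i : E →ₗ[ℂ] XiSpace N} {φ : XiSpace N} {d : ℕ → ℕ} {ψ : ℕ → XiSpace N} {V : ℕ → ℂ⟦X⟧}

theorem IsEmbeddingOnto.map_pow_a {L : Submodule ℂ⟦X⟧ (XiSpace N)} (h : IsEmbeddingOnto A μ i L)
    (n : ℕ) (x : E) : i ((A.a ^ n) x) = ((Xi μ N).a ^ n) (i x) := by
  induction n with
  | zero => simp
  | succ n ih => rw [pow_succ', pow_succ', Module.End.mul_apply, Module.End.mul_apply, h.map_a, ih]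

theorem IsEmbeddingOnto.map_pow_b {L : Submodule ℂ⟦X⟧ (XiSpace N)} (h : IsEmbeddingOnto A μ i L)
    (n : ℕ) (x : E) : i ((A.b ^ n) x) = (PowerSeries.X ^ n : ℂ⟦X⟧) • i x := by
  induction n with
  | zero => simp
  | succ n ih => rw [pow_succ', pow_succ', Module.End.mul_apply, h.map_b, ih, mul_smul]

/-- The theme's own `b`-adic topology agrees with the one induced from `Ξ`: by the conductor, an
element of order `m + q` in `Ξ` is `b ^ m` times an element of the theme. -/
theorem Chain.isAdicSum_iff (C : Chain μ k φ d ψ V)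
    (h : IsEmbeddingOnto A μ i (generated μ N φ)) (S : ℂ⟦X⟧) (x y : E) :
    A.IsAdicSum S x y ↔ i y = evalOp (Xi μ N).a S (i x) := by
  have hi : ∀ n, i (y - ∑ l ∈ Finset.range n, PowerSeries.coeff l S • (A.a ^ l) x) =
      i y - ∑ l ∈ Finset.range n, PowerSeries.coeff l S • ((Xi μ N).a ^ l) (i x) := fun n => by
    simp only [map_sub, map_sum, map_smul, h.map_pow_a]
  constructor
  · refine fun hy => eq_of_ord fun m => ?_
    obtain ⟨M, hM⟩ := hy m
    obtain ⟨w, hw⟩ := hM (max M m) (le_max_left _ _)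
    have h1 := hi (max M m)
    rw [← hw, h.map_pow_b] at h1
    have h2 : HasOrd m ((PowerSeries.X ^ m : ℂ⟦X⟧) • i w) := fun l => by
      rw [cf_smul]; exact dvd_mul_right _ _
    rw [h1] at h2
    simpa using h2.sub ((evalOp_spec (isRaising_a μ) S (max M m) (i x)).mono (le_max_right _ _))
  · intro hy m
    obtain ⟨q, hq⟩ := C.exists_conductor le_rfl
    refine ⟨m + q, fun n hn => ?_⟩
    have h1 := (evalOp_spec (isRaising_a μ) S n (i x)).mono hn
    rw [← hy, ← hi] at h1
    set u := y - ∑ l ∈ Finset.range n, PowerSeries.coeff l S • (A.a ^ l) x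
    obtain ⟨f, hf⟩ := (h1.mono (Nat.le_add_right m q)).exists_eq_smul
    have hu : i u ∈ flag ψ k := by
      have : i u ∈ Set.range i := ⟨u, rfl⟩
      rwa [C.range_eq h] at this
    have hX : (PowerSeries.X ^ m : ℂ⟦X⟧) ≠ 0 := pow_ne_zero _ PowerSeries.X_ne_zero
    have hfm : f ∈ flag ψ k := by
      refine hq f (fun l hl => ?_) fun l => ?_
      · have := C.supp_of_mem_flag le_rfl hu l hl
        rw [hf, cf_smul] at this
        exact (mul_eq_zero.1 this).resolve_left hX
      · have := h1 l
        rw [hf, cf_smul, pow_add] at this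
        exact (mul_dvd_mul_iff_left hX).1 this
    have : f ∈ Set.range i := by rw [C.range_eq h]; exact hfm
    obtain ⟨w, rfl⟩ := this
    exact ⟨w, h.injective (by rw [h.map_pow_b, hf])⟩

/-- Existence and uniqueness of the sums show that `evalA` never takes its default value `0` on a
theme. -/
theorem Chain.map_evalA (C : Chain μ k φ d ψ V)
    (h : IsEmbeddingOnto A μ i (generated μ N φ)) (S : ℂ⟦X⟧) (x : E) :
    i (A.evalA S x) = evalOp (Xi μ N).a S (i x) := by
  have hex : ∀ x, ∃! y, A.IsAdicSum S x y := by
    intro x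
    have hx : i x ∈ flag ψ k := by
      have : i x ∈ Set.range i := ⟨x, rfl⟩
      rwa [C.range_eq h] at this
    have : evalOp (Xi μ N).a S (i x) ∈ Set.range i := by
      rw [C.range_eq h]
      exact C.evalOp_mem_flag le_rfl S hx
    obtain ⟨y, hy⟩ := this
    refine ⟨y, (C.isAdicSum_iff h S x y).2 hy, fun y' hy' => h.injective ?_⟩
    rw [(C.isAdicSum_iff h S x y').1 hy', hy]
  rw [ABStructure.evalA, dif_pos hex]
  exact (C.isAdicSum_iff h S x _).1 (hex x).choose_spec.1

/-- The theme obtained by change of variable is again embedded in `Ξ_μ^{(N)}`. -/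
theorem Chain.isEmbeddingOnto_changeVar (C : Chain μ k φ d ψ V)
    (h : IsEmbeddingOnto A μ i (generated μ N φ)) {θ : ℂ⟦X⟧} {v : XiSpace N}
    {g : Module.End ℂ (XiSpace N)} (T : IsTransportInverse μ θ v g) :
    IsEmbeddingOnto (A.changeVar θ) μ (g ∘ₗ i) (generated μ N (g φ)) where
  injective := (Function.LeftInverse.injective T.right_inv).comp h.injective
  range_eq := by
    ext f
    rw [SetLike.mem_coe, C.mem_generated_inverse_iff T, ← SetLike.mem_coe, ← h.range_eq]
    constructor
    · rintro ⟨x, rfl⟩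
      exact ⟨x, (T.right_inv _).symm⟩
    · rintro ⟨x, hx⟩
      exact ⟨x, by rw [LinearMap.comp_apply, hx, T.left_inv]⟩
  map_a x := by
    have e := transport_a T.coeff_zero T.vector (g (i x))
    rw [T.right_inv] at e
    rw [LinearMap.comp_apply, LinearMap.comp_apply, ← T.left_inv ((Xi μ N).a _), e]
    exact congrArg g (C.map_evalA h θ x)
  map_b x := by
    have e := transport_X_smul (μ := μ) (θ := θ) (v := v) (g (i x))
    rw [T.right_inv] at e
    rw [LinearMap.comp_apply, LinearMap.comp_apply, ← T.left_inv ((PowerSeries.X : ℂ⟦X⟧) • _), e,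
      thetaB_apply, ← C.map_evalA h, ← h.map_b]
    rfl

end EvalA

/-! ### Charts of a family and globalization -/

section Charts

variable {X : Type*} [TopologicalSpace X] [ReducedComplexSpace X]

/-- On the open set `W` the family is embedded in `Ξ_μ^{(N)}` as the family of the themes
generated by the holomorphic map `φ`, with adapted bases `ψ` whose exponents are constant. -/
structure IsThemeChart (lam : ℚ) (k : ℕ) {E : X → Type*} [∀ x, AddCommGroup (E x)]
    [∀ x, Module ℂ (E x)] (A : ∀ x, ABStructure (E x)) (Hol : (∀ x, E x) → X → Prop) (W : Set X)
    (μ : ℚ) {N : ℕ} (φ : X → XiSpace N) (i : ∀ x, E x →ₗ[ℂ] XiSpace N) (d : ℕ → ℕ)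
    (ψ : X → ℕ → XiSpace N) (V : X → ℕ → ℂ⟦X⟧) : Prop where
  isOpen : IsOpen W
  pos : 0 < μ
  congruent : ∃ m : ℤ, μ = lam + m
  holMap : HolMap W φ
  chain : ∀ x ∈ W, Chain (μ : ℂ) k (φ x) d (ψ x) (V x)
  embedding : ∀ x ∈ W, IsEmbeddingOnto (A x) (μ : ℂ) (i x) (generated (μ : ℂ) N (φ x))
  hol_iff : ∀ x ∈ W, ∀ s : ∀ x, E x, Hol s x ↔
    ∃ W' ⊆ W, IsOpen W' ∧ x ∈ W' ∧ HolMap W' fun y => i y (s y)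

variable {lam : ℚ} {k : ℕ} {E : X → Type*} [∀ x, AddCommGroup (E x)]
  [∀ x, Module ℂ (E x)] {A : ∀ x, ABStructure (E x)} {Hol : (∀ x, E x) → X → Prop}

theorem IsEmbeddingOnto.mem {M : Type*} [AddCommGroup M] [Module ℂ M] {A : ABStructure M} {μ : ℂ}
    {N : ℕ} {i : M →ₗ[ℂ] XiSpace N} {L : Submodule ℂ⟦X⟧ (XiSpace N)} (h : IsEmbeddingOnto A μ i L)
    (x : M) : i x ∈ L := by
  rw [← SetLike.mem_coe, ← h.range_eq]
  exact ⟨x, rfl⟩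

theorem IsHolomorphicThemeFamily.exists_isThemeChart
    (hE : IsHolomorphicThemeFamily lam k A Hol) (x₀ : X) :
    ∃ (W : Set X) (μ : ℚ) (N : ℕ) (φ : X → XiSpace N) (i : ∀ x, E x →ₗ[ℂ] XiSpace N) (d : ℕ → ℕ)
      (ψ : X → ℕ → XiSpace N) (V : X → ℕ → ℂ⟦X⟧),
      x₀ ∈ W ∧ IsThemeChart lam k A Hol W μ φ i d ψ V := by
  obtain ⟨U, μ, N, φ, i, hU, hx₀, hμ, hm, hφ, hi, hs⟩ := hE x₀
  have hex : ∀ x, ∃ d ψ V, x ∈ U → Chain (μ : ℂ) k (φ x) d ψ V := by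
    intro x
    by_cases hx : x ∈ U
    · obtain ⟨-, hli, S, -, hS⟩ := hφ
      obtain ⟨d, ψ, V, C⟩ := exists_chain_of_linearIndependent (hli x hx) (hS x hx)
      exact ⟨d, ψ, V, fun _ => C⟩
    · exact ⟨0, 0, 0, fun h => absurd h hx⟩
  choose d ψ V C using hex
  obtain ⟨W, hW, hWo, hxW⟩ := eventually_nhds_iff.1
    (hφ.eventually_exponents_eq hU C hx₀)
  have hC : ∀ x ∈ W, Chain (μ : ℂ) k (φ x) (d x₀) (ψ x) (V x) := fun x hx =>
    (C x (hW x hx).1).congr_exponents (hW x hx).2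
  have hφW : HolMap W φ := (holMap_iff.2 hφ.1).mono fun x hx => (hW x hx).1
  have hiW : ∀ x ∈ W, IsEmbeddingOnto (A x) (μ : ℂ) (i x) (generated (μ : ℂ) N (φ x)) :=
    fun x hx => by
      obtain ⟨h1, h2, h3, h4⟩ := hi x (hW x hx).1
      exact ⟨h1, h2, h3, fun v => by rw [h4, Xi_b]⟩
  refine ⟨W, μ, N, φ, i, d x₀, ψ, V, hxW, hWo, hμ, hm, hφW, hC, hiW, fun x hx s => ?_⟩
  rw [hs x (hW x hx).1 s]
  exact exists_holSeries_iff hWo hφW hC (f := fun y => i y (s y))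
    (fun y hy => (hiW y hy).mem _) hx

theorem isHolomorphicThemeFamily_of_isThemeChart
    (h : ∀ x₀ : X, ∃ (W : Set X) (μ : ℚ) (N : ℕ) (φ : X → XiSpace N)
      (i : ∀ x, E x →ₗ[ℂ] XiSpace N) (d : ℕ → ℕ) (ψ : X → ℕ → XiSpace N) (V : X → ℕ → ℂ⟦X⟧),
      x₀ ∈ W ∧ IsThemeChart lam k A Hol W μ φ i d ψ V) :
    IsHolomorphicThemeFamily lam k A Hol := by
  intro x₀
  obtain ⟨W, μ, N, φ, i, d, ψ, V, hx₀, H⟩ := h x₀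
  refine ⟨W, μ, N, φ, i, H.isOpen, hx₀, H.pos, H.congruent,
    isThematic_of_chain H.isOpen H.holMap H.chain, fun x hx => ?_, fun x hx s => ?_⟩
  · have h := H.embedding x hx
    exact ⟨h.injective, h.range_eq, h.map_a, fun v => by rw [h.map_b, Xi_b]⟩
  · rw [H.hol_iff x hx s]
    exact (exists_holSeries_iff H.isOpen H.holMap H.chain (f := fun y => i y (s y))
      (fun y hy => (H.embedding y hy).mem _) hx).symm

variable {W : Set X} {μ : ℚ} {N : ℕ} {φ : X → XiSpace N} {i : ∀ x, E x →ₗ[ℂ] XiSpace N}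
  {d : ℕ → ℕ} {ψ : X → ℕ → XiSpace N} {V : X → ℕ → ℂ⟦X⟧}

theorem IsThemeChart.changeVar (H : IsThemeChart lam k A Hol W μ φ i d ψ V) {θ : X → ℂ⟦X⟧}
    (hθ : IsRelativeChangeOfVariable θ) :
    ∃ (φ' : X → XiSpace N) (i' : ∀ x, E x →ₗ[ℂ] XiSpace N) (ψ' : X → ℕ → XiSpace N)
      (V' : X → ℕ → ℂ⟦X⟧),
      IsThemeChart lam k (fun x => (A x).changeVar (θ x)) Hol W μ φ' i' d ψ' V' ∧
      ∀ x ∈ W, ∀ j, j + 1 < k →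
        PowerSeries.coeff 1 (θ x) ^ d j * PowerSeries.coeff 0 (V' x (j + 1)) =
          PowerSeries.coeff 1 (θ x) ^ (d (j + 1) + 1) * PowerSeries.coeff 0 (V x (j + 1)) := by
  obtain ⟨v, g, hT, hg⟩ := exists_isTransportInverse (μ := (μ : ℂ)) (N := N) (W := W)
    (hθ.1.mono (Set.subset_univ W)) (fun x _ => (hθ.2 x).1) fun x _ => (hθ.2 x).2
  have hex : ∀ x, ∃ ψ' V', x ∈ W → Chain (μ : ℂ) k (g x (φ x)) d ψ' V' ∧ ∀ j, j + 1 < k →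
      PowerSeries.coeff 1 (θ x) ^ d j * PowerSeries.coeff 0 (V' (j + 1)) =
        PowerSeries.coeff 1 (θ x) ^ (d (j + 1) + 1) * PowerSeries.coeff 0 (V x (j + 1)) := by
    intro x
    by_cases hx : x ∈ W
    · obtain ⟨ψ', V', h⟩ := (H.chain x hx).exists_inverse (hT x hx)
      exact ⟨ψ', V', fun _ => h⟩
    · exact ⟨0, 0, fun h => absurd h hx⟩
  choose ψ' V' h using hex
  refine ⟨fun x => g x (φ x), fun x => g x ∘ₗ i x, ψ', V', ⟨H.isOpen, H.pos, H.congruent,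
    (hg W le_rfl H.isOpen φ).1 H.holMap, fun x hx => (h x hx).1,
    fun x hx => (H.chain x hx).isEmbeddingOnto_changeVar (H.embedding x hx) (hT x hx),
    fun x hx s => ?_⟩, fun x hx => (h x hx).2⟩
  rw [H.hol_iff x hx s]
  constructor
  · rintro ⟨W', hW', ho, hxW', hf⟩
    exact ⟨W', hW', ho, hxW', (hg W' hW' ho _).1 hf⟩
  · rintro ⟨W', hW', ho, hxW', hf⟩
    exact ⟨W', hW', ho, hxW', (hg W' hW' ho _).2 hf⟩

theorem IsThemeChart.hasFundamentalInvariants_iff (H : IsThemeChart lam k A Hol W μ φ i d ψ V)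
    {x : X} (hx : x ∈ W) {l₁ : ℚ} {p : ℕ → ℕ} : HasFundamentalInvariants (A x) k l₁ p ↔
      ∀ j < k, ((exponent l₁ p (j + 1) : ℚ) : ℂ) = μ + d j := by
  refine ⟨fun h j hj => ?_, fun h => (H.chain x hx).hasFundamentalInvariants (H.embedding x hx) h⟩
  exact ((h (j + 1) (Nat.le_add_left 1 j) hj _).1
    ((H.chain x hx).subquotientIso_rankOne (H.embedding x hx) hj)).symm

theorem exponent_succ_succ (l₁ : ℚ) (p : ℕ → ℕ) (j : ℕ) :
    exponent l₁ p (j + 2) = exponent l₁ p (j + 1) + (p (j + 1) - 1) := by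
  rw [exponent, exponent, Finset.sum_Ico_succ_top (by omega), add_assoc]

theorem exists_exponent_eq (μ : ℚ) {d : ℕ → ℕ} (hd : ∀ j, j + 1 < k → d j ≤ d (j + 1) + 1) :
    ∃ (l₁ : ℚ) (p : ℕ → ℕ), ∀ j < k, ((exponent l₁ p (j + 1) : ℚ) : ℂ) = μ + d j := by
  -- For `1 ≤ j < k` the hypothesis `hd` ensures that the natural subtraction is not truncated; the
  -- other values of `p` are not used.
  refine ⟨μ + d 0, fun j => d j + 1 - d (j - 1), fun j => ?_⟩
  induction j with
  | zero => intro _; simp [exponent]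
  | succ j ih =>
    intro hj
    rw [exponent_succ_succ, Rat.cast_add, ih (by omega)]
    push_cast [Nat.cast_sub (hd j hj), Nat.add_sub_cancel]
    ring

theorem add_eq_of_exponent {l₁ μ : ℚ} {p d : ℕ → ℕ}
    (h : ∀ j < k, ((exponent l₁ p (j + 1) : ℚ) : ℂ) = μ + d j) {j : ℕ} (hj : j + 1 < k) :
    p (j + 1) + d j = d (j + 1) + 1 := by
  have h1 := h (j + 1) hj
  rw [exponent_succ_succ, Rat.cast_add, h j (by omega)] at h1
  push_cast at h1
  have : (p (j + 1) + d j : ℂ) = d (j + 1) + 1 := by linear_combination h1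
  exact_mod_cast this

theorem IsThemeChart.isPrincipalParameter_iff (H : IsThemeChart lam k A Hol W μ φ i d ψ V)
    {x : X} (hx : x ∈ W) {l₁ : ℚ} {p : ℕ → ℕ} (hf : HasFundamentalInvariants (A x) k l₁ p) {j : ℕ}
    (hj : j + 1 < k) (hp : 1 ≤ p (j + 1)) (c : ℂ) :
    IsPrincipalParameter (A x) l₁ p (j + 1) c ↔ c = (PowerSeries.coeff 0 (V x (j + 1)))⁻¹ := by
  have h := (H.hasFundamentalInvariants_iff hx).1 hf
  exact (H.chain x hx).isPrincipalParameter_iff (H.embedding x hx) hj (h j (by omega)) hp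
    (add_eq_of_exponent h hj) c

theorem IsThemeChart.holOn_inv_coeff (H : IsThemeChart lam k A Hol W μ φ i d ψ V) {j : ℕ}
    (hj : j + 1 < k) : HolOn W fun x => (PowerSeries.coeff 0 (V x (j + 1)))⁻¹ :=
  ((holMap_chain H.isOpen H.holMap H.chain (j := j + 1) hj.le).2 (Nat.le_add_left 1 j) 0).inv
    fun x hx => (H.chain x hx).unit _ hj.le

/-- In a chart, having given invariants is a condition on the constant `d` alone. The set where the
invariants found at one point remain valid is therefore open and closed. -/
theorem IsHolomorphicThemeFamily.exists_hasFundamentalInvariants [ConnectedSpace X]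
    (hE : IsHolomorphicThemeFamily lam k A Hol) :
    ∃ (l₁ : ℚ) (p : ℕ → ℕ), ∀ x, HasFundamentalInvariants (A x) k l₁ p := by
  obtain ⟨x₁⟩ := (inferInstance : Nonempty X)
  obtain ⟨W, μ, N, φ, i, d, ψ, V, hx₁, H⟩ := hE.exists_isThemeChart x₁
  obtain ⟨l₁, p, hlp⟩ := exists_exponent_eq (k := k) (d := d) μ fun j hj => (H.chain x₁ hx₁).exponent_le hj
  refine ⟨l₁, p, ?_⟩
  have hiff : ∀ x₀, ∀ᶠ x in 𝓝 x₀,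
      (HasFundamentalInvariants (A x) k l₁ p ↔ HasFundamentalInvariants (A x₀) k l₁ p) := by
    intro x₀
    obtain ⟨W, μ, N, φ, i, d, ψ, V, hx₀, H⟩ := hE.exists_isThemeChart x₀
    filter_upwards [H.isOpen.mem_nhds hx₀] with x hx
    rw [H.hasFundamentalInvariants_iff hx, H.hasFundamentalInvariants_iff hx₀]
  have hclopen : IsClopen {x | HasFundamentalInvariants (A x) k l₁ p} := by
    refine ⟨⟨isOpen_iff_mem_nhds.2 fun x₀ hx₀ => ?_⟩, isOpen_iff_mem_nhds.2 fun x₀ hx₀ => ?_⟩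
    · filter_upwards [hiff x₀] with x hx using fun h => hx₀ (hx.1 h)
    · filter_upwards [hiff x₀] with x hx using hx.2 hx₀
  exact fun x => Set.eq_univ_iff_forall.1
    (hclopen.eq_univ ⟨x₁, (H.hasFundamentalInvariants_iff hx₁).2 hlp⟩) x

theorem IsHolomorphicThemeFamily.exists_principalParameters
    (hE : IsHolomorphicThemeFamily lam k A Hol) {l₁ : ℚ} {p : ℕ → ℕ}
    (hf : ∀ x, HasFundamentalInvariants (A x) k l₁ p) :
    ∃ α : ℕ → X → ℂ, HasPrincipalParameterFunctions A k l₁ p α := by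
  have hex : ∀ (j : ℕ) (x : X), ∃ a : ℂ, 1 ≤ j → j < k → 1 ≤ p j →
      ∀ c, IsPrincipalParameter (A x) l₁ p j c ↔ c = a := by
    intro j x
    obtain ⟨W, μ, N, φ, i, d, ψ, V, hx, H⟩ := hE.exists_isThemeChart x
    refine ⟨(PowerSeries.coeff 0 (V x j))⁻¹, fun h1 hj hp => ?_⟩
    obtain ⟨j, rfl⟩ := Nat.exists_eq_add_of_le' h1
    exact H.isPrincipalParameter_iff hx (hf x) hj hp
  choose α hα using hex
  refine ⟨α, fun j h1 hj hp => ⟨fun x₀ _ => ?_, fun x => hα j x h1 hj hp⟩⟩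
  obtain ⟨W, μ, N, φ, i, d, ψ, V, hx₀, H⟩ := hE.exists_isThemeChart x₀
  obtain ⟨j, rfl⟩ := Nat.exists_eq_add_of_le' h1
  -- The function `α` was chosen pointwise; uniqueness of the parameter identifies it on the chart
  -- with the inverse constant coefficient of the holomorphic unit.
  refine (H.holOn_inv_coeff hj).congr H.isOpen (fun x hx => ?_) x₀ hx₀
  rw [← hα (j + 1) x h1 hj hp]
  exact (H.isPrincipalParameter_iff hx (hf x) hj hp _).2 rfl

end Charts

theorem mainTheorem8 {X : Type*} [TopologicalSpace X] [ReducedComplexSpace X] [ConnectedSpace X]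
    (lam : ℚ) (k : ℕ) {E : X → Type*} [∀ x, AddCommGroup (E x)] [∀ x, Module ℂ (E x)]
    (A : ∀ x, ABStructure (E x)) (Hol : (∀ x, E x) → X → Prop)
    (hE : IsHolomorphicThemeFamily lam k A Hol)
    (θ : X → PowerSeries ℂ) (hθ : IsRelativeChangeOfVariable θ) :
    ∃ (l₁ : ℚ) (p : ℕ → ℕ) (α : ℕ → X → ℂ),
      (∀ x, HasFundamentalInvariants (A x) k l₁ p) ∧
      HasPrincipalParameterFunctions A k l₁ p α ∧
      IsHolomorphicThemeFamily lam k (fun x => (A x).changeVar (θ x)) Hol ∧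
      (∀ x, HasFundamentalInvariants ((A x).changeVar (θ x)) k l₁ p) ∧
      HasPrincipalParameterFunctions (fun x => (A x).changeVar (θ x)) k l₁ p
        (fun j x => (PowerSeries.coeff 1 (θ x) ^ p j)⁻¹ * α j x) := by
  obtain ⟨l₁, p, hf⟩ := hE.exists_hasFundamentalInvariants
  obtain ⟨α, hα⟩ := hE.exists_principalParameters hf
  have hf' : ∀ x, HasFundamentalInvariants ((A x).changeVar (θ x)) k l₁ p := by
    intro x
    obtain ⟨W, μ, N, φ, i, d, ψ, V, hx, H⟩ := hE.exists_isThemeChart x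
    obtain ⟨φ', i', ψ', V', H', -⟩ := H.changeVar hθ
    exact (H'.hasFundamentalInvariants_iff hx).2 ((H.hasFundamentalInvariants_iff hx).1 (hf x))
  refine ⟨l₁, p, α, hf, hα, isHolomorphicThemeFamily_of_isThemeChart fun x₀ => ?_, hf',
    fun j h1 hj hp => ⟨?_, fun x c => ?_⟩⟩
  · obtain ⟨W, μ, N, φ, i, d, ψ, V, hx₀, H⟩ := hE.exists_isThemeChart x₀
    obtain ⟨φ', i', ψ', V', H', -⟩ := H.changeVar hθ
    exact ⟨W, μ, N, φ', i', d, ψ', V', hx₀, H'⟩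
  · exact (((hθ.1 1).pow (p j)).inv fun x _ => pow_ne_zero _ (hθ.2 x).2).mul (hα j h1 hj hp).1
  · obtain ⟨W, μ, N, φ, i, d, ψ, V, hx, H⟩ := hE.exists_isThemeChart x
    obtain ⟨φ', i', ψ', V', H', hV⟩ := H.changeVar hθ
    have hαx := (hα j h1 hj hp).2 x
    obtain ⟨j, rfl⟩ := Nat.exists_eq_add_of_le' h1
    have hαV := (hαx _).1 ((H.isPrincipalParameter_iff hx (hf x) hj hp _).2 rfl)
    have hpd := add_eq_of_exponent ((H.hasFundamentalInvariants_iff hx).1 (hf x)) hj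
    have hV' := hV x hx j hj
    -- Since `d (j + 1) + 1 = p (j + 1) + d j`, cancelling `r ^ d j` leaves `V'(0) = r ^ p (j + 1) *
    -- V(0)`; inverting gives the factor `r ^ (-p (j + 1))`.
    rw [← hpd, pow_add, mul_comm (_ ^ p (j + 1)), mul_assoc] at hV'
    rw [H'.isPrincipalParameter_iff hx (hf' x) hj hp,
      mul_left_cancel₀ (pow_ne_zero _ (hθ.2 x).2) hV', mul_inv, hαV]
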